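/- Let $d\ge 2$, and let $b,f:(0,\infty)\times\mathbf R^d\to\mathbf R^d$ be measurable, extended by $0$ to times $t\le 0$. A measurable $h:(0,\infty)\times\mathbf R^d\to\mathbf R$ (extended by $0$ in the same way) belongs to the Kato class $\mathbf K_{d,1}$ if for every $\lambda>0$ $$\lim_{T\downarrow 0}\ \sup_{t\ge 0,\,x\in\mathbf R^d}\int_0^T\!\!\int_{\mathbf R^d}s^{-\frac{d+1}{2}}e^{-\frac{\lambda|x-y|^2}{2s}}|h(t\pm s,y)|\,dy\,ds=0$$ for both choices of the sign. For $h$ with values in $\mathbf R^d$ put $$\mathcal N^{1}_h(T)=\sup_{t\ge 0,\,x\in\mathbf R^d}\int_t^{t+T}\!\!\int_{\mathbf R^d}(s-t)^{-\frac{d+1}{2}}e^{-\frac{|x-y|^2}{4(s-t)}}|h(s,y)|\,dy\,ds .$$ Let $q(t,x,y)=(2\pi t)^{-d/2}e^{-|x-y|^2/(2t)}$. Let $C_b^{0,1}([0,T]\times\mathbf R^d)$ be the space of bounded continuous $u:[0,T]\times\mathbf R^d\to\mathbf R^d$ whose spatial gradient $\nabla u$ exists and is bounded and continuous on $[0,T]\times\mathbf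 R^d$, and for $S\subseteq\mathbf R^d$ write $\|u\|_{C_b^{0,1}([0,T]\times S)}=\sup_{[0,T]\times S}|u|+\sup_{[0,T]\times S}|\nabla u|$. For $u=(u_1,\dots,u_d)$, $\langle b,\nabla u\rangle$ is the vector with components $\langle b,\nabla u_i\rangle$. A mild solution on $[0,T]$ of $$\partial_tu+\tfrac12\Delta u+\langle b,\nabla u\rangle=f,\qquad u(T,\cdot)=0 \qquad(\ast)$$ is a $u\in C_b^{0,1}([0,T]\times\mathbf R^d)$ such that for all $(t,x)\in[0,T]\times\mathbf R^d$ $$u(t,x)=\int_t^T\!\!\int_{\mathbf R^d}q(s-t,x,y)\,[\langle b(s,y),\nabla u(s,y)\rangle-f(s,y)]\,dy\,ds,$$ the integral being absolutely convergent. For a nonnegative $\varphi\in C_c^\infty((0,1)\times B(0,1))$ with $\int\varphi=1$ and integers $n\ge1$, set $\varphi_n(t,x)=2^{nd+n}\varphi(2^nt,2^nx)$, $b_n=\varphi_n*b$, $f_n=\varphi_n*f$ (convolution on $\mathbf R^{d+1}$). **Proposition 4.3.** Suppose that $|b|$ and $|f|$ belong to $\mathbf K_{d,1}$. Then there is a constant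 $T>0$, depending only on $d$ and the functions $\mathcal N^1_b(\cdot)$ and $\mathcal N^1_f(\cdot)$, such that: (i) Equation $(\ast)$ has a unique mild solution $u\in C_b^{0,1}([0,T]\times\mathbf R^d)$. (ii) For every $\varphi$ as above and every $n\ge1$, the equation $\partial_tu_n+\frac12\Delta u_n+\langle b_n,\nabla u_n\rangle=f_n$ on $(0,T)\times\mathbf R^d$, $u_n(T,\cdot)=0$, has a unique classical solution $u_n\in C^{1,2}([0,T]\times\mathbf R^d)\cap C_b^{0,1}([0,T]\times\mathbf R^d)$, and $$\Big(\sup_{n\ge1}\|u_n\|_{C_b^{0,1}([0,T]\times\mathbf R^d)}\Big)\vee\|u\|_{C_b^{0,1}([0,T]\times\mathbf R^d)}\le M_3\,\mathcal N^1_f(T),$$ where $M_3>0$ depends only on $d$ and $\mathcal N^1_b(T)$; moreover, for every $R>0$, $$\lim_{n\to\infty}\|u_n-u\|_{C_b^{0,1}([0,T]\times B(0,R))}=0 .$$ (iii) $|u(t,y)-u(t,x)|\le\frac12|x-y|$ for all $t\in[0,T]$ and $x,y\in\mathbf R^d$. -/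

import Mathlib

open Set Filter Topology MeasureTheory
open scoped ENNReal NNReal

noncomputable section

namespace KatoPDE

/-- Euclidean space `ℝ^d`. -/
abbrev Space (d : ℕ) : Type := EuclideanSpace ℝ (Fin d)

/-- Space-time functions on `(0, ∞) × ℝ^d` are represented by total functions `ℝ → ℝ^d → F`, of
which only the values at positive times matter. `zeroExt h` is the extension of `h` by zero to
nonpositive times. -/
def zeroExt {d : ℕ} {F : Type*} [Zero F] (h : ℝ → Space d → F) : ℝ → Space d → F :=
  fun t x => if 0 < t then h t x else 0

/-- The forward Kato supremum
`sup_{t ≥ 0, x} ∫_0^T ∫ s^{-(d+2-α)/2} e^{-lam |x-y|²/(2s)} |h(t+s,y)| dy ds`. -/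
def katoForward {d : ℕ} (α lam : ℝ) (h : ℝ → Space d → ℝ) (T : ℝ) : ℝ≥0∞ :=
  ⨆ t ∈ Ici (0 : ℝ), ⨆ x : Space d, ∫⁻ s in Ioo 0 T, ∫⁻ y : Space d,
    ENNReal.ofReal (s ^ (-((d + 2 - α) / 2)) * Real.exp (-(lam * ‖x - y‖ ^ 2 / (2 * s)))) *
      ‖zeroExt h (t + s) y‖ₑ

/-- The backward Kato supremum, with `|h(t-s,y)|` in place of `|h(t+s,y)|`. -/
def katoBackward {d : ℕ} (α lam : ℝ) (h : ℝ → Space d → ℝ) (T : ℝ) : ℝ≥0∞ :=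
  ⨆ t ∈ Ici (0 : ℝ), ⨆ x : Space d, ∫⁻ s in Ioo 0 T, ∫⁻ y : Space d,
    ENNReal.ofReal (s ^ (-((d + 2 - α) / 2)) * Real.exp (-(lam * ‖x - y‖ ^ 2 / (2 * s)))) *
      ‖zeroExt h (t - s) y‖ₑ

/-- The (time-dependent) Kato class `K_{d,α}` of real functions on `(0, ∞) × ℝ^d`. -/
def IsKato {d : ℕ} (α : ℝ) (h : ℝ → Space d → ℝ) : Prop :=
  Measurable (Function.uncurry (zeroExt h)) ∧
  ∀ lam : ℝ, 0 < lam →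
    Tendsto (katoForward α lam h) (𝓝[>] 0) (𝓝 0) ∧
    Tendsto (katoBackward α lam h) (𝓝[>] 0) (𝓝 0)

/-- `N^lam_h(T) =
sup_{t ≥ 0, x} ∫_t^{t+T} ∫ (s-t)^{-(d+1)/2} e^{-lam |x-y|²/(4(s-t))} |h(s,y)| dy ds`,
a number in `[0, ∞]`. -/
def katoN {d : ℕ} {F : Type*} [NormedAddCommGroup F] (lam : ℝ) (h : ℝ → Space d → F) (T : ℝ) :
    ℝ≥0∞ :=
  ⨆ t ∈ Ici (0 : ℝ), ⨆ x : Space d, ∫⁻ s in Ioo t (t + T), ∫⁻ y : Space d,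
    ENNReal.ofReal ((s - t) ^ (-(((d : ℝ) + 1) / 2)) *
        Real.exp (-(lam * ‖x - y‖ ^ 2 / (4 * (s - t))))) * ‖h s y‖ₑ

/-- Transition density of `d`-dimensional Brownian motion,
`q(t,x,y) = (2πt)^{-d/2} e^{-|x-y|²/(2t)}` for `t > 0`. -/
def heatKernel {d : ℕ} (t : ℝ) (x y : Space d) : ℝ :=
  (2 * Real.pi * t) ^ (-((d : ℝ) / 2)) * Real.exp (-(‖x - y‖ ^ 2 / (2 * t)))

/-- The norm of `C_b^{0,1}([0,T] × S)`: `sup |u| + sup |∇_x u|` over `[0,T] × S`, as a number in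
`[0, ∞]`. The gradient is measured in the operator norm. -/
def c01Norm {d : ℕ} (T : ℝ) (S : Set (Space d)) (u : ℝ → Space d → Space d) : ℝ≥0∞ :=
  (⨆ t ∈ Icc 0 T, ⨆ x ∈ S, ‖u t x‖ₑ) + (⨆ t ∈ Icc 0 T, ⨆ x ∈ S, ‖fderiv ℝ (u t) x‖ₑ)

/-- Membership in `C_b^{0,1}([0,T] × ℝ^d)`: bounded continuous, differentiable in `x`, with
`∇_x u` bounded and jointly continuous. -/
structure IsCb01 {d : ℕ} (T : ℝ) (u : ℝ → Space d → Space d) : Prop where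
  continuousOn : ContinuousOn (Function.uncurry u) (Icc 0 T ×ˢ univ)
  differentiable : ∀ t ∈ Icc 0 T, Differentiable ℝ (u t)
  continuousOn_fderiv :
    ContinuousOn (fun p : ℝ × Space d => fderiv ℝ (u p.1) p.2) (Icc 0 T ×ˢ univ)
  norm_lt_top : c01Norm T univ u < ⊤

/-- Membership in `C^{1,2}([0,T] × ℝ^d)`: one continuous time derivative (one-sided at `0` and
`T`) and two continuous space derivatives. -/
structure IsC12 {d : ℕ} (T : ℝ) (u : ℝ → Space d → Space d) : Prop where
  continuousOn : ContinuousOn (Function.uncurry u) (Icc 0 T ×ˢ univ)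
  differentiable_time :
    ∀ x : Space d, DifferentiableOn ℝ (fun t => u t x) (Icc 0 T)
  continuousOn_time : ContinuousOn
    (fun p : ℝ × Space d => derivWithin (fun t => u t p.2) (Icc 0 T) p.1) (Icc 0 T ×ˢ univ)
  contDiff_space : ∀ t ∈ Icc 0 T, ContDiff ℝ 2 (u t)
  continuousOn_fderiv :
    ContinuousOn (fun p : ℝ × Space d => fderiv ℝ (u p.1) p.2) (Icc 0 T ×ˢ univ)
  continuousOn_fderiv_fderiv : ContinuousOn
    (fun p : ℝ × Space d => fderiv ℝ (fderiv ℝ (u p.1)) p.2) (Icc 0 T ×ˢ univ)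

/-- The integrand `q(s-t,x,y) [⟨b(s,y), ∇_y u(s,y)⟩ - f(s,y)]` of the mild formulation.
Componentwise, `⟨b, ∇ u_i⟩` is the derivative of `u_i` in the direction `b`. -/
def mildIntegrand {d : ℕ} (b f u : ℝ → Space d → Space d) (t : ℝ) (x : Space d)
    (s : ℝ) (y : Space d) : Space d :=
  heatKernel (s - t) x y • (fderiv ℝ (u s) y (b s y) - f s y)

/-- `u ∈ C_b^{0,1}([0,T] × ℝ^d)` is a mild solution on `[0,T]` of
`∂_t u + ½ Δu + ⟨b, ∇u⟩ = f`, `u(T) = 0`. -/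
structure IsMildSolution {d : ℕ} (b f : ℝ → Space d → Space d) (T : ℝ)
    (u : ℝ → Space d → Space d) : Prop where
  isCb01 : IsCb01 T u
  integrableOn : ∀ t ∈ Icc 0 T, ∀ x : Space d,
    IntegrableOn (Function.uncurry (mildIntegrand b f u t x)) (Ioc t T ×ˢ univ)
  eq_integral : ∀ t ∈ Icc 0 T, ∀ x : Space d,
    u t x = ∫ s in t..T, ∫ y : Space d, mildIntegrand b f u t x s y

/-- `u ∈ C^{1,2}([0,T] × ℝ^d) ∩ C_b^{0,1}([0,T] × ℝ^d)` solves
`∂_t u + ½ Δu + ⟨b, ∇u⟩ = f` on `(0,T) × ℝ^d`, `u(T) = 0`, in the classical sense. -/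
structure IsClassicalSolution {d : ℕ} (b f : ℝ → Space d → Space d) (T : ℝ)
    (u : ℝ → Space d → Space d) : Prop where
  isC12 : IsC12 T u
  isCb01 : IsCb01 T u
  equation : ∀ t ∈ Ioo 0 T, ∀ x : Space d,
    deriv (fun s => u s x) t + (1 / 2 : ℝ) • Laplacian.laplacian (u t) x
      + fderiv ℝ (u t) x (b t x) = f t x
  terminal : ∀ x : Space d, u T x = 0

/-- A nonnegative `φ ∈ C_c^∞((0,1) × B(0,1))` with integral one. -/
structure IsMollifier {d : ℕ} (φ : ℝ × Space d → ℝ) : Prop where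
  contDiff : ContDiff ℝ (⊤ : ℕ∞) φ
  hasCompactSupport : HasCompactSupport φ
  tsupport_subset : tsupport φ ⊆ Ioo 0 1 ×ˢ Metric.ball 0 1
  nonneg : ∀ p, 0 ≤ φ p
  integral_eq_one : ∫ p, φ p = 1

/-- `φ_n(t,x) = 2^{nd+n} φ(2^n t, 2^n x)`. -/
def scaled {d : ℕ} (φ : ℝ × Space d → ℝ) (n : ℕ) (p : ℝ × Space d) : ℝ :=
  2 ^ (n * d + n) * φ ((2 : ℝ) ^ n • p)

/-- `h_n(t,x) = ∫_{ℝ^{d+1}} φ_n(t-s,x-y) h(s,y) dy ds`, where `h = 0` at nonpositive times. -/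
def mollify {d : ℕ} (φ : ℝ × Space d → ℝ) (n : ℕ) (h : ℝ → Space d → Space d) :
    ℝ → Space d → Space d :=
  fun t x => ∫ p : ℝ × Space d, scaled φ n (t - p.1, x - p.2) • zeroExt h p.1 p.2

end KatoPDE

end

/-! A mild solution is determined by its gradient. If V = ∇u, the mild equation says that u is the
heat potential of the source ⟨b,V⟩ - f, and differentiating it gives a closed equation for V alone,
V = ∫∫ ∇q [⟨b,V⟩ - f] (`IsFix`). For times at most 1, both q and |∇q| are bounded by e⁴ times the
Kato kernel τ^{-(d+1)/2} e^{-|z|²/(4τ)} times e^{-|z|} (`gk_le`, `norm_dgk_le`): half of the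
Gaussian exponent builds the Kato kernel, the other half pays for the factor |z|/√τ and for the
exponential decay. Hence a potential of g on [0,T] is at most e⁴ N_g(T), and once e⁴ N_b(T) ≤ 1/4
the equation for V is a 1/4-contraction on bounded continuous functions. T is chosen so that this
smallness holds for b and for f. Existence, uniqueness, the bound 4e⁴ N_f(T) and the Lipschitz
constant 2 · 1/4 all follow.

Continuity and differentiability of potentials are obtained by cutting the kernel off near time
zero. The error is at most e⁴ N_g(2ε), uniformly in the base point, and the cut-off potential is
handled by dominated convergence. The dominating function e^{-|x-y|}|g| is integrable by uniform
local integrability, which is extracted from the forward and backward Kato conditions together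
(`IsKato.uli`).

Mollification does not increase the Kato functional (`kN_moll_le`), so the same T and the same
bounds serve every n. The mollified coefficients converge only in L¹ locally. Convergence of the
solutions is therefore measured in sup e^{-|x|}|·|, for which the spare factor e^{-|z|} of the
kernels keeps the contraction constant. The perturbation of the source has a small potential: short
times are small by the Kato condition, far points by the weight, and on the rest the kernel is
bounded (`IsKer.eventually_Iop_le`).

On times up to 1 the mollified coefficients coincide with bounded C¹ functions with bounded
derivatives. For these a fixed point is found for gradient and Hessian together, the extra
derivative falling on the source (`exists_isFix_hasFDerivAt`). The time derivative comes from the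
semigroup property and the generator ½Δ (`hasDerivWithinAt_Iop_kerq`), and uniqueness of classical
solutions from a maximum principle with barrier e^{K(T-t)}(1+|x|²). -/

open Set Filter Topology MeasureTheory
open scoped ENNReal NNReal

noncomputable section

namespace KatoPDE

variable {d : ℕ}

/-! ### Gaussian kernels and their comparison with the Kato kernel. -/

/-- The kernel `τ^{-(d+1)/2} e^{-|z|²/(4τ)}` of the Kato functional. -/
def kap (τ : ℝ) (z : Space d) : ℝ :=
  τ ^ (-(((d : ℝ) + 1) / 2)) * Real.exp (-(‖z‖ ^ 2 / (4 * τ)))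

/-- The Gaussian density of variance `τ`. -/
def gk (τ : ℝ) (z : Space d) : ℝ :=
  (2 * Real.pi * τ) ^ (-((d : ℝ) / 2)) * Real.exp (-(‖z‖ ^ 2 / (2 * τ)))

/-- The derivative of the Gaussian density. -/
def dgk (τ : ℝ) (z : Space d) : Space d →L[ℝ] ℝ := (-(gk τ z / τ)) • innerSL ℝ z

lemma kap_nonneg {τ : ℝ} (hτ : 0 < τ) (z : Space d) : 0 ≤ kap τ z := by
  unfold kap; positivity

lemma gk_pos {τ : ℝ} (hτ : 0 < τ) (z : Space d) : 0 < gk τ z := by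
  unfold gk; positivity

lemma gk_neg (τ : ℝ) (z : Space d) : gk τ (-z) = gk τ z := by simp [gk]

lemma rpow_half_neg_le_one : (2 * Real.pi) ^ (-((d : ℝ) / 2)) ≤ 1 := by
  apply Real.rpow_le_one_of_one_le_of_nonpos
  · have := Real.pi_gt_three; linarith
  · have : (0 : ℝ) ≤ d := Nat.cast_nonneg d
    linarith

/-- The exponent |z|²/(2τ) is twice that of the Kato kernel, so a full factor e^{-|z|²/(4τ)} is left
over, together with √τ from the powers of τ. -/
lemma gk_le_aux {τ : ℝ} (hτ : 0 < τ) (z : Space d) :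
    gk τ z ≤ √τ * kap τ z * Real.exp (-(‖z‖ ^ 2 / (4 * τ))) := by
  have h1 : (τ : ℝ) ^ (-((d : ℝ) / 2)) = √τ * τ ^ (-(((d : ℝ) + 1) / 2)) := by
    rw [Real.sqrt_eq_rpow, ← Real.rpow_add hτ]; congr 1; ring
  have h2 : Real.exp (-(‖z‖ ^ 2 / (2 * τ)))
      = Real.exp (-(‖z‖ ^ 2 / (4 * τ))) * Real.exp (-(‖z‖ ^ 2 / (4 * τ))) := by
    rw [← Real.exp_add]; congr 1; field_simp; ring
  unfold gk kap
  rw [Real.mul_rpow (by positivity) hτ.le, h2, h1]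
  have h3 := rpow_half_neg_le_one (d := d)
  have h4 : 0 ≤ √τ * τ ^ (-(((d : ℝ) + 1) / 2)) *
    (Real.exp (-(‖z‖ ^ 2 / (4 * τ))) * Real.exp (-(‖z‖ ^ 2 / (4 * τ)))) := by positivity
  nlinarith [mul_le_mul_of_nonneg_right h3 h4]

/-- With ρ = r/√τ ≥ r and max(1,ρ) ≤ e^ρ, the claim is -ρ²/4 + ρ ≤ 4 - ρ, that is (ρ/2 - 2)² ≥ 0.
This is where the constant e⁴ originates. -/
lemma exp_aux {τ : ℝ} (hτ : 0 < τ) (hτ1 : τ ≤ 1) {r : ℝ} (hr : 0 ≤ r) :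
    Real.exp (-(r ^ 2 / (4 * τ))) * max 1 (r / √τ) ≤ Real.exp 4 * Real.exp (-r) := by
  set ρ := r / √τ with hρ
  have hs : 0 < √τ := Real.sqrt_pos.2 hτ
  have hs1 : √τ ≤ 1 := Real.sqrt_le_one.2 hτ1
  have hρ0 : 0 ≤ ρ := by positivity
  have hrρ : r ≤ ρ := by
    rw [hρ, le_div_iff₀ hs]; nlinarith
  have e1 : r ^ 2 / (4 * τ) = ρ ^ 2 / 4 := by
    rw [hρ, div_pow, Real.sq_sqrt hτ.le]; field_simp
  have h1 : max 1 ρ ≤ Real.exp ρ := by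
    apply max_le (Real.one_le_exp hρ0)
    linarith [Real.add_one_le_exp ρ]
  rw [e1, ← Real.exp_add]
  calc _ ≤ Real.exp (-(ρ ^ 2 / 4)) * Real.exp ρ := by gcongr
    _ = Real.exp (-(ρ ^ 2 / 4) + ρ) := by rw [Real.exp_add]
    _ ≤ _ := by
      apply Real.exp_le_exp.2
      nlinarith [sq_nonneg (ρ / 2 - 2)]

lemma gk_le {τ : ℝ} (hτ : 0 < τ) (hτ1 : τ ≤ 1) (z : Space d) :
    gk τ z ≤ Real.exp 4 * kap τ z * Real.exp (-‖z‖) := by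
  have hs1 : √τ ≤ 1 := Real.sqrt_le_one.2 hτ1
  have hk := kap_nonneg hτ z
  have h := exp_aux hτ hτ1 (norm_nonneg z)
  have h' : Real.exp (-(‖z‖ ^ 2 / (4 * τ))) ≤ Real.exp 4 * Real.exp (-‖z‖) :=
    le_trans (le_mul_of_one_le_right (Real.exp_pos _).le (le_max_left _ _)) h
  calc gk τ z ≤ √τ * kap τ z * Real.exp (-(‖z‖ ^ 2 / (4 * τ))) := gk_le_aux hτ z
    _ ≤ 1 * kap τ z * (Real.exp 4 * Real.exp (-‖z‖)) := by gcongr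
    _ = _ := by ring

lemma norm_dgk (τ : ℝ) (hτ : 0 < τ) (z : Space d) : ‖dgk τ z‖ = gk τ z / τ * ‖z‖ := by
  rw [dgk, norm_smul, innerSL_apply_norm, norm_neg, Real.norm_of_nonneg]
  have := gk_pos hτ z
  positivity

/-- The gradient costs |z|/τ. Against the spare √τ this becomes |z|/√τ, which the spare Gaussian
absorbs; hence the power (d+1)/2 in the Kato kernel. -/
lemma norm_dgk_le {τ : ℝ} (hτ : 0 < τ) (hτ1 : τ ≤ 1) (z : Space d) :
    ‖dgk τ z‖ ≤ Real.exp 4 * kap τ z * Real.exp (-‖z‖) := by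
  have hs : 0 < √τ := Real.sqrt_pos.2 hτ
  have hk := kap_nonneg hτ z
  have h := exp_aux hτ hτ1 (norm_nonneg z)
  have h' : Real.exp (-(‖z‖ ^ 2 / (4 * τ))) * (‖z‖ / √τ) ≤ Real.exp 4 * Real.exp (-‖z‖) :=
    le_trans (by gcongr; exact le_max_right _ _) h
  rw [norm_dgk τ hτ]
  calc gk τ z / τ * ‖z‖
      ≤ (√τ * kap τ z * Real.exp (-(‖z‖ ^ 2 / (4 * τ)))) / τ * ‖z‖ := by
        gcongr; exact gk_le_aux hτ z
    _ = kap τ z * (Real.exp (-(‖z‖ ^ 2 / (4 * τ))) * (‖z‖ / √τ)) := by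
        have : √τ / τ = 1 / √τ := Real.sqrt_div_self'
        linear_combination (kap τ z * Real.exp (-(‖z‖ ^ 2 / (4 * τ))) * ‖z‖) * this
    _ ≤ kap τ z * (Real.exp 4 * Real.exp (-‖z‖)) := by gcongr
    _ = _ := by ring

lemma hasFDerivAt_gk (τ : ℝ) (z : Space d) : HasFDerivAt (gk τ) (dgk τ z) z := by
  have h1 : HasFDerivAt (fun z : Space d => ‖z‖ ^ 2) (2 • (innerSL ℝ z)) z :=
    (hasStrictFDerivAt_norm_sq z).hasFDerivAt
  have h2 := (((h1.mul_const (2 * τ)⁻¹).neg).exp).const_mul ((2 * Real.pi * τ) ^ (-((d : ℝ) / 2)))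
  have h3 : gk τ = fun z : Space d => (2 * Real.pi * τ) ^ (-((d : ℝ) / 2)) *
      Real.exp (-(‖z‖ ^ 2 * (2 * τ)⁻¹)) := by
    ext z; simp [gk, div_eq_mul_inv]
  rw [h3]
  refine h2.congr_fderiv ?_
  ext v
  simp [dgk, gk, div_eq_mul_inv]
  ring_nf

lemma continuousOn_gk :
    ContinuousOn (fun p : ℝ × Space d => gk p.1 p.2) (Ioi 0 ×ˢ univ) := by
  unfold gk
  apply ContinuousOn.mul
  · apply ContinuousOn.rpow_const (by fun_prop)
    rintro ⟨τ, z⟩ ⟨h, -⟩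
    left
    have : 0 < τ := h
    positivity
  · apply Real.continuous_exp.comp_continuousOn
    apply ContinuousOn.neg
    apply ContinuousOn.div (by fun_prop) (by fun_prop)
    rintro ⟨τ, z⟩ ⟨h, -⟩
    have : 0 < τ := h
    positivity

lemma continuousOn_dgk :
    ContinuousOn (fun p : ℝ × Space d => dgk p.1 p.2) (Ioi 0 ×ˢ univ) := by
  have h1 : ContinuousOn (fun p : ℝ × Space d => -(gk p.1 p.2 / p.1)) (Ioi 0 ×ˢ univ) := by
    refine (continuousOn_gk.div (by fun_prop) ?_).neg
    rintro ⟨τ, z⟩ ⟨h, -⟩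
    exact (ne_of_gt h)
  exact h1.smul ((innerSL ℝ).continuous.comp continuous_snd).continuousOn

lemma continuous_gk (τ : ℝ) : Continuous (gk τ : Space d → ℝ) := by
  unfold gk; fun_prop

lemma measurable_gk : Measurable (fun p : ℝ × Space d => gk p.1 p.2) := by
  unfold gk; fun_prop

lemma measurable_kap : Measurable (fun p : ℝ × Space d => kap p.1 p.2) := by
  unfold kap; fun_prop

lemma integral_gk {τ : ℝ} (hτ : 0 < τ) : ∫ z : Space d, gk τ z = 1 := by
  have h := GaussianFourier.integral_rexp_neg_mul_sq_norm (V := Space d)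
    (b := (2 * τ)⁻¹) (by positivity)
  have h3 : (gk τ : Space d → ℝ) = fun z : Space d => (2 * Real.pi * τ) ^ (-((d : ℝ) / 2)) *
      Real.exp (-(2 * τ)⁻¹ * ‖z‖ ^ 2) := by
    ext z; simp [gk, div_eq_mul_inv, mul_comm]
  rw [h3, integral_const_mul, h]
  simp only [finrank_euclideanSpace, Fintype.card_fin]
  rw [show Real.pi / (2 * τ)⁻¹ = 2 * Real.pi * τ by field_simp, ← Real.rpow_add (by positivity)]
  simp

lemma integrable_gk {τ : ℝ} (hτ : 0 < τ) : Integrable (gk τ : Space d → ℝ) := by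
  by_contra h
  have := integral_gk (d := d) hτ
  rw [integral_undef h] at this
  exact zero_ne_one this

lemma lintegral_gk {τ : ℝ} (hτ : 0 < τ) : ∫⁻ z : Space d, ENNReal.ofReal (gk τ z) = 1 := by
  rw [← ofReal_integral_eq_lintegral_ofReal (integrable_gk hτ)
    (ae_of_all _ fun z => (gk_pos hτ z).le), integral_gk hτ, ENNReal.ofReal_one]

/-- Completing the square: the law of a Brownian path at an intermediate time is the endpoint
density times the density of the bridge, of variance ab/(a+b). Integrating in z gives
Chapman–Kolmogorov. -/
lemma gk_mul_gk {a b : ℝ} (ha : 0 < a) (hb : 0 < b) (x y z : Space d) :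
    gk a (x - z) * gk b (z - y)
      = gk (a + b) (x - y) * gk (a * b / (a + b)) (z - ((b / (a + b)) • x + (a / (a + b)) • y)) := by
  have hab : 0 < a + b := by positivity
  have e1 : z - ((b / (a + b)) • x + (a / (a + b)) • y)
      = (a + b)⁻¹ • (a • (z - y) - b • (x - z)) := by
    have : z = (a + b)⁻¹ • ((a + b) • z) := by rw [smul_smul, inv_mul_cancel₀ hab.ne', one_smul]
    nth_rewrite 1 [this]
    simp only [div_eq_inv_mul, mul_smul, ← smul_add, ← smul_sub]
    congr 1
    module
  have e2 : x - y = (x - z) + (z - y) := by abel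
  have c : (2 * Real.pi * a) ^ (-((d : ℝ) / 2)) * (2 * Real.pi * b) ^ (-((d : ℝ) / 2))
      = (2 * Real.pi * (a + b)) ^ (-((d : ℝ) / 2)) *
        (2 * Real.pi * (a * b / (a + b))) ^ (-((d : ℝ) / 2)) := by
    rw [← Real.mul_rpow (by positivity) (by positivity),
      ← Real.mul_rpow (by positivity) (by positivity)]
    congr 1; field_simp
  have e : -(‖x - z‖ ^ 2 / (2 * a)) + -(‖z - y‖ ^ 2 / (2 * b))
      = -(‖x - y‖ ^ 2 / (2 * (a + b))) +
        -(‖z - ((b / (a + b)) • x + (a / (a + b)) • y)‖ ^ 2 / (2 * (a * b / (a + b)))) := by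
    rw [e1, e2]
    generalize x - z = p, z - y = q
    rw [norm_smul, norm_add_sq_real, mul_pow, norm_sub_sq_real, norm_smul, norm_smul,
      inner_smul_left, inner_smul_right, real_inner_comm q p]
    simp only [Real.norm_eq_abs, mul_pow, sq_abs, conj_trivial]
    field_simp
    ring
  unfold gk
  calc _ = ((2 * Real.pi * a) ^ (-((d : ℝ) / 2)) * (2 * Real.pi * b) ^ (-((d : ℝ) / 2))) *
      Real.exp (-(‖x - z‖ ^ 2 / (2 * a)) + -(‖z - y‖ ^ 2 / (2 * b))) := by
        rw [Real.exp_add]; ring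
    _ = _ := by rw [c, e, Real.exp_add]; ring

lemma integral_gk_mul_gk {a b : ℝ} (ha : 0 < a) (hb : 0 < b) (x y : Space d) :
    ∫ z, gk a (x - z) * gk b (z - y) = gk (a + b) (x - y) := by
  simp_rw [gk_mul_gk ha hb]
  rw [integral_const_mul, integral_sub_right_eq_self (gk (a * b / (a + b))),
    integral_gk (by positivity), mul_one]

lemma lintegral_gk_mul_gk {a b : ℝ} (ha : 0 < a) (hb : 0 < b) (x y : Space d) :
    ∫⁻ z, ENNReal.ofReal (gk a (x - z)) * ENNReal.ofReal (gk b (z - y))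
      = ENNReal.ofReal (gk (a + b) (x - y)) := by
  simp_rw [← ENNReal.ofReal_mul (gk_pos ha _).le, gk_mul_gk ha hb,
    ENNReal.ofReal_mul (gk_pos (add_pos ha hb) _).le]
  rw [lintegral_const_mul _ (by
    have := continuous_gk (d := d) (a * b / (a + b)); fun_prop),
    lintegral_sub_right_eq_self (fun z => ENNReal.ofReal (gk (a * b / (a + b)) z)),
    lintegral_gk (by positivity), mul_one]

/-- This form makes the semigroup property available for the Kato kernel and shows that its mass
τ^{-1/2}, up to a constant, is integrable in time. -/
lemma kap_eq {τ : ℝ} (hτ : 0 < τ) (z : Space d) :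
    kap τ z = (4 * Real.pi) ^ ((d : ℝ) / 2) * τ ^ (-(1 / 2 : ℝ)) * gk (2 * τ) z := by
  unfold kap gk
  rw [show 2 * Real.pi * (2 * τ) = (4 * Real.pi) * τ by ring,
    Real.mul_rpow (by positivity) hτ.le, show 2 * (2 * τ) = 4 * τ by ring,
    show (-(((d : ℝ) + 1) / 2)) = -(1 / 2) + (-((d : ℝ) / 2)) by ring, Real.rpow_add hτ]
  have : (4 * Real.pi) ^ ((d : ℝ) / 2) * (4 * Real.pi) ^ (-((d : ℝ) / 2)) = 1 := by
    rw [← Real.rpow_add (by positivity)]; simp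
  linear_combination (-(τ ^ (-(1 / 2 : ℝ)) * τ ^ (-((d : ℝ) / 2)) *
    Real.exp (-(‖z‖ ^ 2 / (4 * τ))))) * this

/-- Scaling of the Gaussian density. -/
lemma integral_gk_smul {F : Type*} [NormedAddCommGroup F] [NormedSpace ℝ F] {τ : ℝ} (hτ : 0 < τ)
    (w : Space d → F) (x : Space d) :
    ∫ y, gk τ (x - y) • w y = ∫ z, gk 1 z • w (x + √τ • z) := by
  have hs : 0 < √τ := Real.sqrt_pos.2 hτ
  have h1 : ∫ y, gk τ (x - y) • w y = ∫ y, gk τ y • w (x + y) := by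
    rw [← integral_sub_left_eq_self _ volume x]
    rw [← integral_neg_eq_self (fun y => gk τ y • w (x + y))]
    apply integral_congr_ae (ae_of_all _ fun y => ?_)
    simp [gk_neg, sub_eq_add_neg]
  rw [h1]
  have h2 := Measure.integral_comp_smul (volume : Measure (Space d))
    (fun y => gk τ y • w (x + y)) (√τ)
  have h3 : ∀ z : Space d, gk τ (√τ • z) = τ ^ (-((d : ℝ) / 2)) * gk 1 z := by
    intro z
    unfold gk
    rw [norm_smul, mul_pow, Real.norm_of_nonneg hs.le, Real.sq_sqrt hτ.le,
      Real.mul_rpow (by positivity) hτ.le, mul_one]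
    have : τ * ‖z‖ ^ 2 / (2 * τ) = ‖z‖ ^ 2 / 2 := by field_simp
    rw [this]; ring
  simp_rw [h3, mul_smul, integral_smul] at h2
  have h4 : |(√τ ^ Module.finrank ℝ (Space d))⁻¹| = τ ^ (-((d : ℝ) / 2)) := by
    rw [abs_of_pos (by positivity), finrank_euclideanSpace, Fintype.card_fin,
      Real.sqrt_eq_rpow, ← Real.rpow_natCast, ← Real.rpow_mul hτ.le, ← Real.rpow_neg hτ.le]
    congr 1; ring
  rw [h4] at h2
  have h5 : τ ^ (-((d : ℝ) / 2)) ≠ 0 := by positivity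
  exact (smul_right_injective F h5 h2).symm

end KatoPDE
end


/-! ### The Kato functional on space-time functions and its behaviour under mollification. -/

open Set Filter Topology MeasureTheory
open scoped ENNReal NNReal

noncomputable section

namespace KatoPDE

variable {d : ℕ}

instance : (volume : Measure (ℝ × Space d)).IsAddHaarMeasure :=
  inferInstanceAs ((volume : Measure ℝ).prod (volume : Measure (Space d))).IsAddHaarMeasure

@[fun_prop]
lemma Measurable.kap {α : Type*} [MeasurableSpace α] {f : α → ℝ} {g : α → Space d}
    (hf : Measurable f) (hg : Measurable g) : Measurable fun a => kap (f a) (g a) :=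
  measurable_kap.comp (hf.prodMk hg)

@[fun_prop]
lemma Measurable.gk {α : Type*} [MeasurableSpace α] {f : α → ℝ} {g : α → Space d}
    (hf : Measurable f) (hg : Measurable g) : Measurable fun a => gk (f a) (g a) :=
  measurable_gk.comp (hf.prodMk hg)

variable {F : Type*} [NormedAddCommGroup F]

/-- The Kato integral of a space-time function started at `(t, x)`. -/
def kI (h : ℝ × Space d → F) (T t : ℝ) (x : Space d) : ℝ≥0∞ :=
  ∫⁻ p in Ioo t (t + T) ×ˢ univ, ENNReal.ofReal (kap (p.1 - t) (x - p.2)) * ‖h p‖ₑ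

/-- The Kato functional of a space-time function. -/
def kN (h : ℝ × Space d → F) (T : ℝ) : ℝ≥0∞ := ⨆ t ∈ Ici (0 : ℝ), ⨆ x, kI h T t x

lemma kI_le_kN (h : ℝ × Space d → F) (T : ℝ) {t : ℝ} (ht : 0 ≤ t) (x : Space d) :
    kI h T t x ≤ kN h T :=
  le_trans (le_iSup (kI h T t) x) (le_iSup₂ (f := fun t (_ : t ∈ Ici (0 : ℝ)) => ⨆ x, kI h T t x) t ht)

lemma kN_le {h : ℝ × Space d → F} {T : ℝ} {M : ℝ≥0∞} (H : ∀ t, 0 ≤ t → ∀ x, kI h T t x ≤ M) :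
    kN h T ≤ M := iSup₂_le fun t ht => iSup_le fun x => H t ht x

lemma measurableSet_strip {s : Set ℝ} (hs : MeasurableSet s) :
    MeasurableSet (s ×ˢ (univ : Set (Space d))) := hs.prod .univ

variable {F₁ F₂ : Type*} [NormedAddCommGroup F₁] [NormedAddCommGroup F₂]

lemma lintegral_mul_enorm_le {h : ℝ × Space d → F} {g₁ : ℝ × Space d → F₁} {g₂ : ℝ × Space d → F₂}
    (h1 : StronglyMeasurable g₁) {c₁ c₂ : ℝ≥0}
    (H : ∀ p, ‖h p‖ₑ ≤ c₁ * ‖g₁ p‖ₑ + c₂ * ‖g₂ p‖ₑ) (μ : Measure (ℝ × Space d))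
    {w : ℝ × Space d → ℝ≥0∞} (hw : Measurable w) :
    ∫⁻ p, w p * ‖h p‖ₑ ∂μ ≤ c₁ * ∫⁻ p, w p * ‖g₁ p‖ₑ ∂μ + c₂ * ∫⁻ p, w p * ‖g₂ p‖ₑ ∂μ := by
  rw [← lintegral_const_mul' _ _ ENNReal.coe_ne_top, ← lintegral_const_mul' _ _ ENNReal.coe_ne_top,
    ← lintegral_add_left (by have := h1.enorm; fun_prop)]
  refine lintegral_mono fun p => ?_
  calc w p * ‖h p‖ₑ ≤ w p * (c₁ * ‖g₁ p‖ₑ + c₂ * ‖g₂ p‖ₑ) := by gcongr; exact H p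
    _ = _ := by ring

lemma kN_le_add {h : ℝ × Space d → F} {g₁ : ℝ × Space d → F₁} {g₂ : ℝ × Space d → F₂}
    (h1 : StronglyMeasurable g₁) {c₁ c₂ : ℝ≥0}
    (H : ∀ p, ‖h p‖ₑ ≤ c₁ * ‖g₁ p‖ₑ + c₂ * ‖g₂ p‖ₑ) (T : ℝ) :
    kN h T ≤ c₁ * kN g₁ T + c₂ * kN g₂ T := by
  refine kN_le fun t ht x => ?_
  calc kI h T t x ≤ c₁ * kI g₁ T t x + c₂ * kI g₂ T t x :=
        lintegral_mul_enorm_le h1 H _ (by fun_prop)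
    _ ≤ _ := by gcongr <;> exact kI_le_kN _ _ ht x

/-- Functions to which the heat potential estimates on `[0, T]` apply. -/
structure Good (T : ℝ) (h : ℝ × Space d → F) : Prop where
  sm : StronglyMeasurable h
  fin : kN h T ≠ ⊤
  tend : Tendsto (kN h) (𝓝[>] 0) (𝓝 0)
  uli : ∃ M : ℝ≥0∞, M ≠ ⊤ ∧ ∀ x : Space d,
    ∫⁻ p in Ioc 0 T ×ˢ univ, ENNReal.ofReal (Real.exp (-‖x - p.2‖)) * ‖h p‖ₑ ≤ M

lemma Good.of_le {T : ℝ} {h : ℝ × Space d → F} {g₁ : ℝ × Space d → F₁} {g₂ : ℝ × Space d → F₂}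
    (h1 : Good T g₁) (h2 : Good T g₂) (hm : StronglyMeasurable h) {c₁ c₂ : ℝ≥0}
    (H : ∀ p, ‖h p‖ₑ ≤ c₁ * ‖g₁ p‖ₑ + c₂ * ‖g₂ p‖ₑ) : Good T h where
  sm := hm
  fin := ne_top_of_le_ne_top (ENNReal.add_ne_top.2 ⟨ENNReal.mul_ne_top ENNReal.coe_ne_top h1.fin,
    ENNReal.mul_ne_top ENNReal.coe_ne_top h2.fin⟩) (kN_le_add h1.sm H T)
  tend := by
    have : Tendsto (fun S => c₁ * kN g₁ S + c₂ * kN g₂ S) (𝓝[>] 0) (𝓝 (c₁ * 0 + c₂ * 0)) :=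
      (ENNReal.Tendsto.const_mul h1.tend (Or.inr ENNReal.coe_ne_top)).add
        (ENNReal.Tendsto.const_mul h2.tend (Or.inr ENNReal.coe_ne_top))
    simp only [mul_zero, add_zero] at this
    exact tendsto_of_tendsto_of_tendsto_of_le_of_le tendsto_const_nhds this (fun _ => zero_le)
      fun S => kN_le_add h1.sm H S
  uli := by
    obtain ⟨M₁, hM₁, H₁⟩ := h1.uli
    obtain ⟨M₂, hM₂, H₂⟩ := h2.uli
    refine ⟨c₁ * M₁ + c₂ * M₂, ENNReal.add_ne_top.2 ⟨ENNReal.mul_ne_top ENNReal.coe_ne_top hM₁,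
      ENNReal.mul_ne_top ENNReal.coe_ne_top hM₂⟩, fun x => ?_⟩
    refine (lintegral_mul_enorm_le h1.sm H _ (by fun_prop)).trans ?_
    gcongr
    · exact H₁ x
    · exact H₂ x

/-- The constant in the one-dimensional form of the Kato kernel. -/
def cK (d : ℕ) : ℝ := (4 * Real.pi) ^ ((d : ℝ) / 2)

lemma lintegral_kap {τ : ℝ} (hτ : 0 < τ) (x : Space d) :
    ∫⁻ y, ENNReal.ofReal (kap τ (x - y)) = ENNReal.ofReal (cK d * τ ^ (-(1 / 2 : ℝ))) := by
  have : ∀ y, ENNReal.ofReal (kap τ (x - y)) =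
      ENNReal.ofReal (cK d * τ ^ (-(1 / 2 : ℝ))) * ENNReal.ofReal (gk (2 * τ) (x - y)) := by
    intro y
    rw [kap_eq hτ, ENNReal.ofReal_mul (by positivity), cK]
  simp_rw [this]
  rw [lintegral_const_mul _ (by fun_prop),
    lintegral_sub_left_eq_self (fun z => ENNReal.ofReal (gk (2 * τ) z)) x,
    lintegral_gk (by positivity), mul_one]

lemma setLIntegral_rpow {T : ℝ} (hT : 0 < T) :
    ∫⁻ s in Ioo 0 T, ENNReal.ofReal (cK d * s ^ (-(1 / 2 : ℝ)))
      = ENNReal.ofReal (cK d * (2 * √T)) := by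
  have hc : 0 ≤ cK d := by unfold cK; positivity
  rw [← ofReal_integral_eq_lintegral_ofReal]
  · rw [integral_const_mul, ← integral_Ioc_eq_integral_Ioo,
      ← intervalIntegral.integral_of_le hT.le, integral_rpow (by left; norm_num)]
    congr 2
    rw [Real.sqrt_eq_rpow]
    norm_num
    ring
  · refine Integrable.const_mul ?_ _
    exact (intervalIntegral.integrableOn_Ioo_rpow_iff hT).2 (by norm_num)
  · refine (ae_restrict_mem measurableSet_Ioo).mono fun s hs => ?_
    have : 0 < s := hs.1
    positivity

lemma setLIntegral_comp_sub (f : ℝ → ℝ≥0∞) (a b t : ℝ) :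
    ∫⁻ s in Ioo (t + a) (t + b), f (s - t) = ∫⁻ s in Ioo a b, f s := by
  rw [← lintegral_indicator measurableSet_Ioo, ← lintegral_indicator measurableSet_Ioo,
    ← lintegral_sub_right_eq_self (indicator (Ioo a b) _) t]
  congr 1
  ext s
  simp only [indicator, mem_Ioo]
  congr 1
  apply propext
  constructor <;> rintro ⟨h1, h2⟩ <;> constructor <;> linarith

lemma setLIntegral_strip {s : Set ℝ} {f : ℝ × Space d → ℝ≥0∞} (hf : Measurable f) :
    ∫⁻ p in s ×ˢ univ, f p = ∫⁻ r in s, ∫⁻ y, f (r, y) := by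
  rw [Measure.volume_eq_prod, ← Measure.prod_restrict, Measure.restrict_univ,
    lintegral_prod _ hf.aemeasurable]

/-- The spatial mass of the Kato kernel is a multiple of s^{-1/2}, whose integral over (0,T) is 2√T.
-/
lemma kN_bounded_le {h : ℝ × Space d → F} {c : ℝ≥0∞} (H : ∀ p, ‖h p‖ₑ ≤ c)
    {T : ℝ} (hT : 0 < T) : kN h T ≤ c * ENNReal.ofReal (cK d * (2 * √T)) := by
  refine kN_le fun t ht x => ?_
  calc kI h T t x ≤ ∫⁻ p in Ioo t (t + T) ×ˢ univ, ENNReal.ofReal (kap (p.1 - t) (x - p.2)) * c :=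
        lintegral_mono fun p => by gcongr; exact H p
    _ = c * ∫⁻ p in Ioo t (t + T) ×ˢ univ, ENNReal.ofReal (kap (p.1 - t) (x - p.2)) := by
        rw [lintegral_mul_const _ (by fun_prop), mul_comm]
    _ = c * ∫⁻ s in Ioo (t + 0) (t + T), ENNReal.ofReal (cK d * (s - t) ^ (-(1 / 2 : ℝ))) := by
        rw [setLIntegral_strip (by fun_prop), add_zero]
        congr 1
        refine setLIntegral_congr_fun measurableSet_Ioo fun s hs => ?_
        exact lintegral_kap (sub_pos.2 hs.1) x
    _ = _ := by
        rw [setLIntegral_comp_sub (fun s => ENNReal.ofReal (cK d * s ^ (-(1 / 2 : ℝ)))) 0 T t,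
          setLIntegral_rpow hT]

/-- Comparison with (1+|z|)^{-(d+1)}, using one term of the series of e^{1+|z|}. -/
lemma integrable_exp_neg_norm : Integrable (fun z : Space d => Real.exp (-‖z‖)) := by
  have h := integrable_one_add_norm (E := Space d) (μ := volume) (r := ((d + 1 : ℕ) : ℝ))
    (by simp)
  refine (h.const_mul ((Nat.factorial (d + 1) : ℝ) * Real.exp 1)).mono'
    (by fun_prop) (ae_of_all _ fun z => ?_)
  rw [Real.norm_of_nonneg (Real.exp_pos _).le, Real.rpow_neg (by positivity), Real.rpow_natCast,
    ← div_eq_mul_inv, le_div_iff₀ (by positivity)]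
  have h2 := Real.pow_div_factorial_le_exp (1 + ‖z‖) (by positivity) (d + 1)
  rw [div_le_iff₀ (by positivity), Real.exp_add] at h2
  have h3 : Real.exp (-‖z‖) * Real.exp ‖z‖ = 1 := by rw [← Real.exp_add]; simp
  calc Real.exp (-‖z‖) * (1 + ‖z‖) ^ (d + 1)
      ≤ Real.exp (-‖z‖) * (Real.exp 1 * Real.exp ‖z‖ * (Nat.factorial (d + 1) : ℝ)) := by gcongr
    _ = (Real.exp (-‖z‖) * Real.exp ‖z‖) * (Real.exp 1 * (Nat.factorial (d + 1) : ℝ)) := by ring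
    _ = _ := by rw [h3]; ring

lemma lintegral_exp_neg_norm_sub (x : Space d) :
    ∫⁻ y, ENNReal.ofReal (Real.exp (-‖x - y‖)) = ∫⁻ z : Space d, ENNReal.ofReal (Real.exp (-‖z‖)) :=
  lintegral_sub_left_eq_self (fun z => ENNReal.ofReal (Real.exp (-‖z‖))) x

lemma lintegral_exp_neg_norm_ne_top :
    ∫⁻ z : Space d, ENNReal.ofReal (Real.exp (-‖z‖)) ≠ ⊤ := by
  have := (integrable_exp_neg_norm (d := d)).lintegral_lt_top
  exact this.ne

lemma uli_bounded {h : ℝ × Space d → F} {c : ℝ≥0} {T : ℝ}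
    (H : ∀ p : ℝ × Space d, p.1 ∈ Ioc 0 T → ‖h p‖ₑ ≤ c) :
    ∃ M : ℝ≥0∞, M ≠ ⊤ ∧ ∀ x : Space d,
      ∫⁻ p in Ioc 0 T ×ˢ univ, ENNReal.ofReal (Real.exp (-‖x - p.2‖)) * ‖h p‖ₑ ≤ M := by
  refine ⟨c * ((∫⁻ z : Space d, ENNReal.ofReal (Real.exp (-‖z‖))) * ENNReal.ofReal T),
    ENNReal.mul_ne_top ENNReal.coe_ne_top
      (ENNReal.mul_ne_top lintegral_exp_neg_norm_ne_top ENNReal.ofReal_ne_top), fun x => ?_⟩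
  calc _ ≤ ∫⁻ p in Ioc 0 T ×ˢ univ, ENNReal.ofReal (Real.exp (-‖x - p.2‖)) * c := by
        refine setLIntegral_mono (by fun_prop) fun p hp => ?_
        gcongr; exact H p hp.1
    _ = _ := by
        rw [lintegral_mul_const _ (by fun_prop), mul_comm, setLIntegral_strip (by fun_prop)]
        simp only [lintegral_exp_neg_norm_sub]
        rw [lintegral_const]
        simp

lemma Good.of_bounded {T : ℝ} (hT : 0 < T) {h : ℝ × Space d → F} (hm : StronglyMeasurable h)
    {c : ℝ≥0} (H : ∀ p, ‖h p‖ₑ ≤ c) : Good T h where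
  sm := hm
  fin := ne_top_of_le_ne_top (ENNReal.mul_ne_top ENNReal.coe_ne_top ENNReal.ofReal_ne_top)
    (kN_bounded_le H hT)
  tend := by
    have h1 : Tendsto (fun S : ℝ => (c : ℝ≥0∞) * ENNReal.ofReal (cK d * (2 * √S))) (𝓝[>] 0)
        (𝓝 (c * ENNReal.ofReal (cK d * (2 * √0)))) := by
      refine ENNReal.Tendsto.const_mul ?_ (Or.inr ENNReal.coe_ne_top)
      refine tendsto_nhdsWithin_of_tendsto_nhds (Continuous.tendsto ?_ 0)
      exact ENNReal.continuous_ofReal.comp (by fun_prop)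
    simp only [Real.sqrt_zero, mul_zero, ENNReal.ofReal_zero] at h1
    exact tendsto_of_tendsto_of_tendsto_of_le_of_le' tendsto_const_nhds h1
      (Eventually.of_forall fun _ => zero_le)
      (eventually_mem_nhdsWithin.mono fun S hS => kN_bounded_le H hS)
  uli := uli_bounded fun p _ => H p

/-- For functions vanishing at nonpositive times, starting times may be negative. -/
lemma kI_le_kN_of_zero {h : ℝ × Space d → F} (hm : StronglyMeasurable h)
    (h0 : ∀ p : ℝ × Space d, p.1 ≤ 0 → h p = 0) (T t : ℝ) (x : Space d) :
    kI h T t x ≤ kN h T := by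
  rcases le_or_gt 0 t with ht | ht
  · exact kI_le_kN h T ht x
  have hm' := hm.enorm
  have hσ : 0 < 2 * (-t) := by linarith
  -- For t < 0 < s the Kato kernel started at time t is dominated by an average of Kato kernels
  -- started at time 0, the starting point being Gaussian of variance 2(-t). This is
  -- Chapman–Kolmogorov for times 2(-t) and 2s, and (s-t)^{-1/2} ≤ s^{-1/2}.
  have key : ∀ p : ℝ × Space d, (Ioo t (t + T) ×ˢ univ).indicator
      (fun p => ENNReal.ofReal (kap (p.1 - t) (x - p.2)) * ‖h p‖ₑ) p ≤
      (Ioo 0 (0 + T) ×ˢ univ).indicator (fun p => ∫⁻ z, ENNReal.ofReal (gk (2 * (-t)) (x - z)) *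
        (ENNReal.ofReal (kap (p.1 - 0) (z - p.2)) * ‖h p‖ₑ)) p := by
    rintro ⟨s, y⟩
    rcases le_or_gt s 0 with hs | hs
    · simp [indicator, h0 (s, y) hs]
    by_cases hs2 : s < t + T
    · rw [indicator_of_mem (by simp; constructor <;> linarith),
        indicator_of_mem (by simp; constructor <;> linarith)]
      simp only [sub_zero]
      have e : ∀ z, ENNReal.ofReal (gk (2 * (-t)) (x - z)) *
          (ENNReal.ofReal (kap s (z - y)) * ‖h (s, y)‖ₑ) =
          (ENNReal.ofReal (cK d * s ^ (-(1 / 2 : ℝ))) * ‖h (s, y)‖ₑ) *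
          (ENNReal.ofReal (gk (2 * (-t)) (x - z)) * ENNReal.ofReal (gk (2 * s) (z - y))) := by
        intro z
        rw [kap_eq hs, ENNReal.ofReal_mul (by positivity), cK]; ring
      simp_rw [e]
      rw [lintegral_const_mul _ (by fun_prop), lintegral_gk_mul_gk hσ (by positivity),
        kap_eq (by linarith), ENNReal.ofReal_mul (by
          have : 0 < s - t := by linarith
          positivity), cK]
      rw [show 2 * -t + 2 * s = 2 * (s - t) by ring, mul_right_comm]
      gcongr ENNReal.ofReal (_ * ?_) * _ * _
      apply Real.rpow_le_rpow_of_nonpos <;> [exact hs; linarith; norm_num]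
    · rw [indicator_of_notMem]
      · exact zero_le
      · simp only [mem_prod, mem_Ioo, mem_univ, and_true]
        intro h
        exact hs2 h.2
  unfold kI
  rw [← lintegral_indicator (measurableSet_strip measurableSet_Ioo)]
  refine (lintegral_mono key).trans ?_
  rw [lintegral_indicator (measurableSet_strip measurableSet_Ioo), lintegral_lintegral_swap]
  · calc _ = ∫⁻ z, ENNReal.ofReal (gk (2 * (-t)) (x - z)) * kI h T 0 z := by
          congr 1; ext z
          rw [lintegral_const_mul _ (by fun_prop)]
          rfl
      _ ≤ ∫⁻ z, ENNReal.ofReal (gk (2 * (-t)) (x - z)) * kN h T := by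
          gcongr with z
          exact kI_le_kN h T le_rfl z
      _ = _ := by
          rw [lintegral_mul_const _ (by fun_prop),
            lintegral_sub_left_eq_self (fun z => ENNReal.ofReal (gk (2 * (-t)) z)),
            lintegral_gk hσ, one_mul]
  · apply Measurable.aemeasurable
    have : Measurable (fun q : (ℝ × Space d) × Space d => ‖h q.1‖ₑ) := hm'.comp measurable_fst
    unfold Function.uncurry
    fun_prop

/-- Space-time mollification with the kernel `ψ`. -/
def moll [NormedSpace ℝ F] (ψ : ℝ × Space d → ℝ) (h : ℝ × Space d → F) (X : ℝ × Space d) : F :=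
  ∫ p, ψ (X - p) • h p

lemma enorm_moll_le [NormedSpace ℝ F] (ψ : ℝ × Space d → ℝ) (h : ℝ × Space d → F)
    (X : ℝ × Space d) : ‖moll ψ h X‖ₑ ≤ ∫⁻ r, ‖ψ r‖ₑ * ‖h (X - r)‖ₑ := by
  refine (enorm_integral_le_lintegral_enorm _).trans ?_
  rw [← lintegral_sub_left_eq_self _ X]
  simp [enorm_smul]

/-- A mollification is an average of translates, and translating the function amounts to translating
the starting point (t,x). The new starting time t - r may be negative, which is why
`kI_le_kN_of_zero` is needed. -/
lemma kN_moll_le [NormedSpace ℝ F] {ψ : ℝ × Space d → ℝ} (hψ : Measurable ψ)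
    (hψ1 : ∫⁻ p, ‖ψ p‖ₑ ≤ 1) {h : ℝ × Space d → F} (hm : StronglyMeasurable h)
    (h0 : ∀ p : ℝ × Space d, p.1 ≤ 0 → h p = 0) (T : ℝ) : kN (moll ψ h) T ≤ kN h T := by
  refine kN_le fun t ht x => ?_
  have hm' := hm.enorm
  have hψ' := hψ.enorm
  have hm2 : Measurable (fun q : (ℝ × Space d) × (ℝ × Space d) => ‖h (q.1 - q.2)‖ₑ) :=
    hm'.comp (measurable_fst.sub measurable_snd)
  have hψ2 : Measurable (fun q : (ℝ × Space d) × (ℝ × Space d) => ‖ψ q.2‖ₑ) :=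
    hψ'.comp measurable_snd
  have hm3 (r : ℝ × Space d) : Measurable (fun p : ℝ × Space d => ‖h (p - r)‖ₑ) :=
    hm'.comp (measurable_id.sub_const r)
  have hm4 (r : ℝ × Space d) : Measurable (fun p : ℝ × Space d => ‖h (r - p)‖ₑ) :=
    hm'.comp (measurable_id.const_sub r)
  calc kI (moll ψ h) T t x
      ≤ ∫⁻ p in Ioo t (t + T) ×ˢ univ, ∫⁻ r, ‖ψ r‖ₑ *
          (ENNReal.ofReal (kap (p.1 - t) (x - p.2)) * ‖h (p - r)‖ₑ) := by
        refine lintegral_mono fun p => ?_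
        calc _ ≤ ENNReal.ofReal (kap (p.1 - t) (x - p.2)) * ∫⁻ r, ‖ψ r‖ₑ * ‖h (p - r)‖ₑ := by
              gcongr; exact enorm_moll_le _ _ _
          _ = _ := by
              rw [← lintegral_const_mul' _ _ ENNReal.ofReal_ne_top]
              congr 1; ext r; ring
    _ = ∫⁻ r, ‖ψ r‖ₑ * kI h T (t - r.1) (x - r.2) := by
        rw [lintegral_lintegral_swap]
        · congr 1; ext r
          rw [lintegral_const_mul _ (by have := hm3 r; fun_prop)]
          congr 1
          unfold kI
          rw [← lintegral_indicator (measurableSet_strip measurableSet_Ioo),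
            ← lintegral_indicator (measurableSet_strip measurableSet_Ioo),
            ← lintegral_add_right_eq_self _ r]
          congr 1; ext p
          have e : (p + r ∈ Ioo t (t + T) ×ˢ (univ : Set (Space d))) ↔
              (p ∈ Ioo (t - r.1) (t - r.1 + T) ×ˢ (univ : Set (Space d))) := by
            simp only [mem_prod, mem_Ioo, mem_univ, and_true, Prod.fst_add]
            constructor <;> rintro ⟨h1, h2⟩ <;> constructor <;> linarith
          by_cases hp : p + r ∈ Ioo t (t + T) ×ˢ (univ : Set (Space d))
          · rw [indicator_of_mem hp, indicator_of_mem (e.1 hp), add_sub_cancel_right]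
            simp only [Prod.fst_add, Prod.snd_add]
            congr 3
            · ring_nf
            · abel
          · rw [indicator_of_notMem hp, indicator_of_notMem (fun h => hp (e.2 h))]
        · apply Measurable.aemeasurable
          unfold Function.uncurry
          fun_prop
    _ ≤ ∫⁻ r, ‖ψ r‖ₑ * kN h T := by
        gcongr with r
        exact kI_le_kN_of_zero hm h0 _ _ _
    _ ≤ _ := by
        rw [lintegral_mul_const _ hψ']
        exact mul_le_of_le_one_left zero_le hψ1

end KatoPDE
end


/-! ### Potentials with kernels of Kato type: bounds, continuity, differentiation in space. -/

open Set Filter Topology MeasureTheory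
open scoped ENNReal NNReal

noncomputable section

namespace KatoPDE

variable {d : ℕ} {F F' F₁ : Type*} [NormedAddCommGroup F] [NormedSpace ℝ F]
  [NormedAddCommGroup F'] [NormedSpace ℝ F'] [NormedAddCommGroup F₁]

/-- The constant of the kernel estimates. -/
def CE : ℝ≥0 := ⟨Real.exp 4, (Real.exp_pos _).le⟩

/-- Operator-valued kernels dominated by the Kato kernel. -/
structure IsKer (k : ℝ → Space d → F →L[ℝ] F') : Prop where
  cont : ContinuousOn (fun p : ℝ × Space d => k p.1 p.2) (Ioi 0 ×ˢ univ)
  bound : ∀ τ, 0 < τ → τ ≤ 1 → ∀ z, ‖k τ z‖ ≤ Real.exp 4 * kap τ z * Real.exp (-‖z‖)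

/-- The potential of `g` with kernel `k` on `[t, T]`. -/
def Iop (k : ℝ → Space d → F →L[ℝ] F') (T : ℝ) (g : ℝ × Space d → F) (t : ℝ) (x : Space d) : F' :=
  ∫ p in Ioc t T ×ˢ univ, k (p.1 - t) (x - p.2) (g p)

lemma strip_ae_eq (a b : ℝ) :
    (Ioc a b ×ˢ (univ : Set (Space d)) : Set (ℝ × Space d)) =ᵐ[volume] Ioo a b ×ˢ univ :=
  Measure.set_prod_ae_eq Ioo_ae_eq_Ioc.symm .rfl

section

variable {k : ℝ → Space d → F →L[ℝ] F'}

lemma IsKer.aesm (hk : IsKer k) {g : ℝ × Space d → F} (hg : StronglyMeasurable g) (t T : ℝ)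
    (x : Space d) : AEStronglyMeasurable (fun p : ℝ × Space d => k (p.1 - t) (x - p.2) (g p))
      (volume.restrict (Ioc t T ×ˢ univ)) := by
  have h1 : ContinuousOn (fun p : ℝ × Space d => k (p.1 - t) (x - p.2)) (Ioc t T ×ˢ univ) :=
    hk.cont.comp (f := fun p : ℝ × Space d => (p.1 - t, x - p.2)) (by fun_prop)
      (fun p hp => ⟨sub_pos.2 hp.1.1, mem_univ _⟩)
  exact isBoundedBilinearMap_apply.continuous.comp_aestronglyMeasurable₂
    (h1.aestronglyMeasurable (measurableSet_strip measurableSet_Ioc)) hg.aestronglyMeasurable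

lemma IsKer.enorm_le (hk : IsKer k) {τ : ℝ} (h0 : 0 < τ) (h1 : τ ≤ 1) (z : Space d) (v : F) :
    ‖k τ z v‖ₑ ≤ CE * ENNReal.ofReal (kap τ z) * ENNReal.ofReal (Real.exp (-‖z‖)) * ‖v‖ₑ := by
  have h2 : ‖k τ z‖ₑ ≤ CE * ENNReal.ofReal (kap τ z) * ENNReal.ofReal (Real.exp (-‖z‖)) := by
    have e : (CE : ℝ≥0∞) = ENNReal.ofReal (Real.exp 4) := by
      rw [ENNReal.ofReal_eq_coe_nnreal (Real.exp_pos _).le]; rfl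
    rw [e, ← ENNReal.ofReal_mul (Real.exp_pos _).le,
      ← ENNReal.ofReal_mul (mul_nonneg (Real.exp_pos _).le (kap_nonneg h0 z)), ← ofReal_norm]
    exact ENNReal.ofReal_le_ofReal (hk.bound τ h0 h1 z)
  refine ((k τ z).le_opENorm v).trans ?_
  gcongr

/-- The spare factor e^{-|x-y|} of the kernel converts the weight at y into the weight at x. The
weight 1 gives the plain bound; exponential weights give decay from far sources and contraction in
the weighted norm. -/
lemma IsKer.lintegral_le_weight (hk : IsKer k) {T t : ℝ} (ht : 0 ≤ t) (hT : T ≤ 1)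
    {g : ℝ × Space d → F} {b : ℝ × Space d → F₁} {W : Space d → ℝ≥0∞} (x : Space d)
    (hg : ∀ p : ℝ × Space d, p.1 ∈ Ioc 0 T → ‖g p‖ₑ ≤ W p.2 * ‖b p‖ₑ)
    (hW : ∀ y, ENNReal.ofReal (Real.exp (-‖x - y‖)) * W y ≤ W x) (hWx : W x ≠ ⊤) :
    ∫⁻ p in Ioc t T ×ˢ univ, ‖k (p.1 - t) (x - p.2) (g p)‖ₑ ≤ CE * W x * kN b T := by
  rw [setLIntegral_congr (strip_ae_eq t T)]
  calc _ ≤ ∫⁻ p in Ioo t T ×ˢ univ,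
        CE * W x * (ENNReal.ofReal (kap (p.1 - t) (x - p.2)) * ‖b p‖ₑ) := by
        refine setLIntegral_mono' (measurableSet_strip measurableSet_Ioo) fun p hp => ?_
        have hp0 : t < p.1 := hp.1.1
        have hp1 : p.1 < T := hp.1.2
        refine (hk.enorm_le (sub_pos.2 hp0) (by linarith) _ _).trans ?_
        calc _ ≤ CE * ENNReal.ofReal (kap (p.1 - t) (x - p.2)) *
              ENNReal.ofReal (Real.exp (-‖x - p.2‖)) * (W p.2 * ‖b p‖ₑ) := by
                gcongr; exact hg p ⟨by linarith, hp1.le⟩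
          _ = CE * (ENNReal.ofReal (kap (p.1 - t) (x - p.2)) *
              (ENNReal.ofReal (Real.exp (-‖x - p.2‖)) * W p.2) * ‖b p‖ₑ) := by ring
          _ ≤ CE * (ENNReal.ofReal (kap (p.1 - t) (x - p.2)) * W x * ‖b p‖ₑ) := by
              gcongr; exact hW _
          _ = _ := by ring
    _ = CE * W x * ∫⁻ p in Ioo t T ×ˢ univ,
        ENNReal.ofReal (kap (p.1 - t) (x - p.2)) * ‖b p‖ₑ :=
        lintegral_const_mul' _ _ (ENNReal.mul_ne_top ENNReal.coe_ne_top hWx)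
    _ ≤ CE * W x * kN b T := by
        gcongr
        refine le_trans ?_ (kI_le_kN b T ht x)
        exact lintegral_mono_set (prod_mono (Ioo_subset_Ioo_right (by linarith)) le_rfl)

lemma IsKer.lintegral_le (hk : IsKer k) {T t : ℝ} (ht : 0 ≤ t) (hT : T ≤ 1)
    (g : ℝ × Space d → F) (x : Space d) :
    ∫⁻ p in Ioc t T ×ˢ univ, ‖k (p.1 - t) (x - p.2) (g p)‖ₑ ≤ CE * kN g T := by
  have := hk.lintegral_le_weight (g := g) (b := g) (W := fun _ => 1) ht hT x
    (fun p _ => by simp) (fun y => by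
      rw [mul_one, ENNReal.ofReal_le_one, Real.exp_le_one_iff]; simp) (by simp)
  simpa using this

/-- Only the Kato functional over a window of length δ enters, so this part is small uniformly in
(t,x). -/
lemma IsKer.lintegral_short_le (hk : IsKer k) {T t δ : ℝ} (ht : 0 ≤ t) (hT : T ≤ 1)
    (g : ℝ × Space d → F) (x : Space d) :
    ∫⁻ p in Ioc t T ×ˢ univ, (if p.1 - t < δ then ‖k (p.1 - t) (x - p.2) (g p)‖ₑ else 0)
      ≤ CE * kN g δ := by
  calc _ ≤ ∫⁻ p in Ioo t (t + δ) ×ˢ univ,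
        CE * (ENNReal.ofReal (kap (p.1 - t) (x - p.2)) * ‖g p‖ₑ) := by
        rw [← lintegral_indicator (measurableSet_strip measurableSet_Ioc),
          ← lintegral_indicator (measurableSet_strip measurableSet_Ioo)]
        refine lintegral_mono fun p => ?_
        by_cases hp : p ∈ Ioc t T ×ˢ (univ : Set (Space d))
        · rw [indicator_of_mem hp]
          have hp0 : t < p.1 := hp.1.1
          have hp1 : p.1 ≤ T := hp.1.2
          split_ifs with hδ
          · rw [indicator_of_mem (by simp; constructor <;> linarith)]
            refine (hk.enorm_le (sub_pos.2 hp0) (by linarith) _ _).trans ?_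
            calc _ ≤ CE * ENNReal.ofReal (kap (p.1 - t) (x - p.2)) * 1 * ‖g p‖ₑ := by
                  gcongr
                  rw [ENNReal.ofReal_le_one, Real.exp_le_one_iff]; simp
              _ = _ := by ring
          · exact zero_le
        · rw [indicator_of_notMem hp]; exact zero_le
    _ = CE * kI g δ t x := lintegral_const_mul' _ _ ENNReal.coe_ne_top
    _ ≤ _ := by gcongr; exact kI_le_kN g δ ht x

lemma IsKer.integrable (hk : IsKer k) {T t : ℝ} (ht : 0 ≤ t) (hT : T ≤ 1)
    {g : ℝ × Space d → F} (hg : StronglyMeasurable g) (hf : kN g T ≠ ⊤) (x : Space d) :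
    IntegrableOn (fun p : ℝ × Space d => k (p.1 - t) (x - p.2) (g p)) (Ioc t T ×ˢ univ) :=
  ⟨hk.aesm hg t T x, lt_of_le_of_lt (hk.lintegral_le ht hT g x)
    (ENNReal.mul_lt_top ENNReal.coe_lt_top (lt_top_iff_ne_top.2 hf))⟩

lemma IsKer.enorm_Iop_le (hk : IsKer k) {T t : ℝ} (ht : 0 ≤ t) (hT : T ≤ 1)
    (g : ℝ × Space d → F) (x : Space d) : ‖Iop k T g t x‖ₑ ≤ CE * kN g T :=
  (enorm_integral_le_lintegral_enorm _).trans (hk.lintegral_le ht hT g x)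

end

/-- A continuous cutoff, `0` on `(-∞, ε]` and `1` on `[2ε, ∞)`. -/
def chi (ε τ : ℝ) : ℝ := max 0 (min 1 (τ / ε - 1))

lemma chi_nonneg (ε τ : ℝ) : 0 ≤ chi ε τ := le_max_left _ _

lemma chi_le_one (ε τ : ℝ) : chi ε τ ≤ 1 := max_le zero_le_one (min_le_left _ _)

lemma chi_eq_zero {ε τ : ℝ} (hε : 0 < ε) (h : τ ≤ ε) : chi ε τ = 0 := by
  have : τ / ε ≤ 1 := (div_le_one hε).2 h
  exact max_eq_left ((min_le_right _ _).trans (by linarith))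

lemma chi_eq_one {ε τ : ℝ} (hε : 0 < ε) (h : 2 * ε ≤ τ) : chi ε τ = 1 := by
  have : 2 ≤ τ / ε := (le_div_iff₀ hε).2 h
  rw [chi, min_eq_left (by linarith), max_eq_right zero_le_one]

lemma continuous_chi (ε : ℝ) : Continuous (chi ε) := by
  unfold chi; fun_prop

/-- The kernel `k` cut off near the diagonal. -/
def cut (ε : ℝ) (k : ℝ → Space d → F →L[ℝ] F') (τ : ℝ) (z : Space d) : F →L[ℝ] F' :=
  chi ε τ • k τ z

section

variable {k : ℝ → Space d → F →L[ℝ] F'}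

lemma norm_cut_le (ε : ℝ) (k : ℝ → Space d → F →L[ℝ] F') (τ : ℝ) (z : Space d) :
    ‖cut ε k τ z‖ ≤ ‖k τ z‖ := by
  rw [cut, norm_smul, Real.norm_of_nonneg (chi_nonneg _ _)]
  exact mul_le_of_le_one_left (norm_nonneg _) (chi_le_one _ _)

lemma IsKer.cut (hk : IsKer k) (ε : ℝ) : IsKer (cut ε k) where
  cont := ((continuous_chi ε).comp continuous_fst).continuousOn.smul hk.cont
  bound τ h0 h1 z := (norm_cut_le ε k τ z).trans (hk.bound τ h0 h1 z)

/-- The cut kernel vanishes for τ below ε, negative τ included, so the singularity at τ = 0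
disappears. -/
lemma IsKer.continuous_cut (hk : IsKer k) {ε : ℝ} (hε : 0 < ε) :
    Continuous (fun p : ℝ × Space d => KatoPDE.cut ε k p.1 p.2) := by
  rw [continuous_iff_continuousAt]
  rintro ⟨τ, z⟩
  rcases lt_or_ge 0 τ with h | h
  · exact (hk.cut ε).cont.continuousAt ((isOpen_Ioi.prod isOpen_univ).mem_nhds ⟨h, mem_univ _⟩)
  · have h1 : (fun p : ℝ × Space d => KatoPDE.cut ε k p.1 p.2) =ᶠ[𝓝 (τ, z)] fun _ => 0 := by
      have : Iio ε ×ˢ (univ : Set (Space d)) ∈ 𝓝 (τ, z) :=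
        (isOpen_Iio.prod isOpen_univ).mem_nhds ⟨lt_of_le_of_lt h hε, mem_univ _⟩
      filter_upwards [this] with p hp
      rw [KatoPDE.cut, chi_eq_zero hε (le_of_lt hp.1), zero_smul]
    exact continuousAt_const.congr h1.symm

/-- The bound of a kernel cut off at `ε`. -/
def cutBound (d : ℕ) (ε : ℝ) : ℝ := Real.exp 4 * ε ^ (-(((d : ℝ) + 1) / 2))

lemma cutBound_nonneg {ε : ℝ} (hε : 0 < ε) : 0 ≤ cutBound d ε := by
  unfold cutBound; positivity

lemma kap_le {ε τ : ℝ} (hε : 0 < ε) (h : ε ≤ τ) (z : Space d) :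
    kap τ z ≤ ε ^ (-(((d : ℝ) + 1) / 2)) := by
  have h0 : 0 < τ := hε.trans_le h
  unfold kap
  calc _ ≤ τ ^ (-(((d : ℝ) + 1) / 2)) * 1 := by
        gcongr
        rw [Real.exp_le_one_iff]
        have : 0 ≤ ‖z‖ ^ 2 / (4 * τ) := by positivity
        linarith
    _ ≤ _ := by
        rw [mul_one]
        exact Real.rpow_le_rpow_of_nonpos hε h (by
          have : (0 : ℝ) ≤ d := Nat.cast_nonneg d
          linarith)

lemma IsKer.norm_cut_le (hk : IsKer k) {ε : ℝ} (hε : 0 < ε) {τ : ℝ} (h1 : τ ≤ 1) (z : Space d) :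
    ‖KatoPDE.cut ε k τ z‖ ≤ cutBound d ε * Real.exp (-‖z‖) := by
  rcases le_or_gt τ ε with h | h
  · rw [KatoPDE.cut, chi_eq_zero hε h, zero_smul, norm_zero]
    exact mul_nonneg (cutBound_nonneg hε) (Real.exp_pos _).le
  · refine ((hk.cut ε).bound τ (hε.trans h) h1 z).trans ?_
    unfold cutBound
    gcongr
    exact kap_le hε h.le z

lemma Good.integrable_exp {T : ℝ} {g : ℝ × Space d → F} (hg : Good T g) (x : Space d) :
    IntegrableOn (fun p : ℝ × Space d => Real.exp (-‖x - p.2‖) * ‖g p‖) (Ioc 0 T ×ˢ univ) := by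
  obtain ⟨M, hM, h⟩ := hg.uli
  refine ⟨?_, lt_of_le_of_lt (le_of_eq ?_) (lt_of_le_of_lt (h x) (lt_top_iff_ne_top.2 hM))⟩
  · exact (Continuous.aestronglyMeasurable (by fun_prop)).mul hg.sm.norm.aestronglyMeasurable
  · congr 1; ext p
    rw [enorm_mul, enorm_norm, Real.enorm_eq_ofReal (Real.exp_pos _).le]

/-- Since the cut kernel is zero for s ≤ t + ε, the domain of integration can be taken independent
of t, as dominated convergence in t requires. -/
lemma Iop_cut {T : ℝ} {g : ℝ × Space d → F} {ε : ℝ} (hε : 0 < ε) {t : ℝ} (ht : 0 ≤ t)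
    (x : Space d) : Iop (cut ε k) T g t x
      = ∫ p in Ioc 0 T ×ˢ univ, cut ε k (p.1 - t) (x - p.2) (g p) := by
  symm
  refine setIntegral_eq_of_subset_of_forall_sdiff_eq_zero (measurableSet_strip measurableSet_Ioc)
    (Set.prod_mono (Ioc_subset_Ioc_left ht) le_rfl) ?_
  rintro p ⟨⟨⟨h1, h2⟩, -⟩, h3⟩
  have h4 : p.1 ≤ t := by
    by_contra h5
    exact h3 ⟨⟨not_le.1 h5, h2⟩, mem_univ _⟩
  rw [cut, chi_eq_zero hε (by linarith), zero_smul]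
  rfl

lemma exp_neg_norm_le {x x₀ : Space d} (h : ‖x - x₀‖ ≤ 1) (y : Space d) :
    Real.exp (-‖x - y‖) ≤ Real.exp 1 * Real.exp (-‖x₀ - y‖) := by
  rw [← Real.exp_add]
  apply Real.exp_le_exp.2
  have : ‖x₀ - y‖ ≤ ‖x₀ - x‖ + ‖x - y‖ := norm_sub_le_norm_sub_add_norm_sub _ _ _
  rw [norm_sub_rev x₀ x] at this
  linarith

lemma IsKer.norm_cut_apply_le (hk : IsKer k) {ε : ℝ} (hε : 0 < ε) {T t : ℝ} (ht : 0 ≤ t)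
    (hT : T ≤ 1) (g : ℝ × Space d → F) {x x₀ : Space d} (hx : ‖x - x₀‖ ≤ 1) {p : ℝ × Space d}
    (hp : p.1 ≤ T) : ‖KatoPDE.cut ε k (p.1 - t) (x - p.2) (g p)‖
      ≤ cutBound d ε * Real.exp 1 * (Real.exp (-‖x₀ - p.2‖) * ‖g p‖) := by
  calc _ ≤ ‖KatoPDE.cut ε k (p.1 - t) (x - p.2)‖ * ‖g p‖ := ContinuousLinearMap.le_opNorm _ _
    _ ≤ cutBound d ε * (Real.exp 1 * Real.exp (-‖x₀ - p.2‖)) * ‖g p‖ := by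
        gcongr
        refine (hk.norm_cut_le hε (by linarith) _).trans ?_
        gcongr
        · exact cutBound_nonneg hε
        · exact exp_neg_norm_le hx _
    _ = _ := by ring

lemma IsKer.aesm_cut (hk : IsKer k) {ε : ℝ} (hε : 0 < ε) {g : ℝ × Space d → F}
    (hg : StronglyMeasurable g) (t : ℝ) (x : Space d) (μ : Measure (ℝ × Space d)) :
    AEStronglyMeasurable (fun p : ℝ × Space d => KatoPDE.cut ε k (p.1 - t) (x - p.2) (g p)) μ := by
  have h1 : Continuous (fun p : ℝ × Space d => KatoPDE.cut ε k (p.1 - t) (x - p.2)) :=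
    (hk.continuous_cut hε).comp (f := fun p : ℝ × Space d => (p.1 - t, x - p.2)) (by fun_prop)
  exact isBoundedBilinearMap_apply.continuous.comp_aestronglyMeasurable₂
    h1.aestronglyMeasurable hg.aestronglyMeasurable

lemma IsKer.continuousOn_Iop_cut (hk : IsKer k) {ε : ℝ} (hε : 0 < ε) {T : ℝ} (hT : T ≤ 1)
    {g : ℝ × Space d → F} (hg : Good T g) :
    ContinuousOn (fun X : ℝ × Space d => Iop (KatoPDE.cut ε k) T g X.1 X.2) (Icc 0 T ×ˢ univ) := by
  have h1 : ContinuousOn (fun X : ℝ × Space d => ∫ p in Ioc 0 T ×ˢ univ,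
      KatoPDE.cut ε k (p.1 - X.1) (X.2 - p.2) (g p)) (Icc 0 T ×ˢ univ) := by
    rintro ⟨t₀, x₀⟩ -
    refine continuousWithinAt_of_dominated (bound := fun p => cutBound d ε * Real.exp 1 *
      (Real.exp (-‖x₀ - p.2‖) * ‖g p‖)) ?_ ?_ ((hg.integrable_exp x₀).const_mul _) ?_
    · exact Eventually.of_forall fun X => hk.aesm_cut hε hg.sm _ _ _
    · have : ∀ᶠ X : ℝ × Space d in 𝓝 (t₀, x₀), ‖X.2 - x₀‖ ≤ 1 := by
        have h2 : Tendsto (fun X : ℝ × Space d => ‖X.2 - x₀‖) (𝓝 (t₀, x₀)) (𝓝 ‖x₀ - x₀‖) :=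
          Continuous.tendsto (f := fun X : ℝ × Space d => ‖X.2 - x₀‖) (by fun_prop) (t₀, x₀)
        rw [sub_self, norm_zero] at h2
        exact h2.eventually_le_const one_pos
      filter_upwards [nhdsWithin_le_nhds this, self_mem_nhdsWithin] with X hX hX2
      refine (ae_restrict_mem (measurableSet_strip measurableSet_Ioc)).mono fun p hp => ?_
      exact hk.norm_cut_apply_le hε hX2.1.1 hT g hX hp.1.2
    · refine ae_of_all _ fun p => Continuous.continuousWithinAt ?_
      have h2 : Continuous (fun X : ℝ × Space d => KatoPDE.cut ε k (p.1 - X.1) (X.2 - p.2)) :=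
        (hk.continuous_cut hε).comp (f := fun X : ℝ × Space d => (p.1 - X.1, X.2 - p.2))
          (by fun_prop)
      exact h2.clm_apply continuous_const
  refine h1.congr fun X hX => ?_
  exact Iop_cut hε hX.1.1 _

/-- The cutoff equals 1 from 2ε on, so the difference only sees sources less than 2ε ahead in time.
-/
lemma IsKer.enorm_Iop_sub_cut_le (hk : IsKer k) {ε : ℝ} (hε : 0 < ε) {T : ℝ} (hT : T ≤ 1)
    {g : ℝ × Space d → F} (hg : Good T g) {t : ℝ} (ht : 0 ≤ t) (x : Space d) :
    ‖Iop k T g t x - Iop (KatoPDE.cut ε k) T g t x‖ₑ ≤ CE * kN g (2 * ε) := by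
  unfold Iop
  rw [← integral_sub (hk.integrable ht hT hg.sm hg.fin x)
    ((hk.cut ε).integrable ht hT hg.sm hg.fin x)]
  refine (enorm_integral_le_lintegral_enorm _).trans (le_trans ?_
    (hk.lintegral_short_le (δ := 2 * ε) ht hT g x))
  refine lintegral_mono fun p => ?_
  have e : k (p.1 - t) (x - p.2) (g p) - KatoPDE.cut ε k (p.1 - t) (x - p.2) (g p)
      = (1 - chi ε (p.1 - t)) • k (p.1 - t) (x - p.2) (g p) := by
    rw [KatoPDE.cut, sub_smul, one_smul]; rfl
  simp only [e]
  split_ifs with h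
  · rw [enorm_smul]
    refine mul_le_of_le_one_left zero_le ?_
    have h0 := chi_nonneg ε (p.1 - t)
    have h1 := chi_le_one ε (p.1 - t)
    rw [Real.enorm_eq_ofReal (by linarith), ENNReal.ofReal_le_one]
    linarith
  · rw [chi_eq_one hε (not_lt.1 h), sub_self, zero_smul]
    simp

/-- A sequence of cutoff levels. -/
def eps (n : ℕ) : ℝ := 1 / 2 * (1 / ((n : ℝ) + 1))

lemma eps_pos (n : ℕ) : 0 < eps n := by unfold eps; positivity

lemma Good.tendsto_eps {T : ℝ} {g : ℝ × Space d → F} (hg : Good T g) :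
    Tendsto (fun n => CE * kN g (2 * eps n)) atTop (𝓝 0) := by
  have h1 : Tendsto (fun n => 2 * eps n) atTop (𝓝[>] 0) := by
    refine tendsto_nhdsWithin_iff.2 ⟨?_, Eventually.of_forall fun n => ?_⟩
    · simpa [eps] using tendsto_one_div_add_atTop_nhds_zero_nat (𝕜 := ℝ)
    · have := eps_pos n
      simp only [mem_Ioi]; positivity
  have := ENNReal.Tendsto.const_mul (a := CE) (hg.tend.comp h1) (Or.inr ENNReal.coe_ne_top)
  simpa using this

lemma IsKer.tendstoUniformlyOn_cut (hk : IsKer k) {T : ℝ} (hT : T ≤ 1)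
    {g : ℝ × Space d → F} (hg : Good T g) :
    TendstoUniformlyOn (fun n (X : ℝ × Space d) => Iop (KatoPDE.cut (eps n) k) T g X.1 X.2)
      (fun X => Iop k T g X.1 X.2) atTop (Icc 0 T ×ˢ univ) := by
  rw [EMetric.tendstoUniformlyOn_iff]
  intro ε hε
  filter_upwards [hg.tendsto_eps.eventually_lt_const hε] with n hn X hX
  rw [edist_eq_enorm_sub]
  exact (hk.enorm_Iop_sub_cut_le (eps_pos n) hT hg hX.1.1 X.2).trans_lt hn

lemma IsKer.continuousOn_Iop (hk : IsKer k) {T : ℝ} (hT : T ≤ 1)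
    {g : ℝ × Space d → F} (hg : Good T g) :
    ContinuousOn (fun X : ℝ × Space d => Iop k T g X.1 X.2) (Icc 0 T ×ˢ univ) :=
  (hk.tendstoUniformlyOn_cut hT hg).continuousOn
    (Frequently.of_forall fun n => hk.continuousOn_Iop_cut (eps_pos n) hT hg)

/-- Differentiation of a potential in the space variable, with the derivative on the kernel. -/
lemma IsKer.hasFDerivAt_Iop (hk : IsKer k) {k' : ℝ → Space d → F →L[ℝ] (Space d →L[ℝ] F')}
    (hk' : IsKer k') (hkk : ∀ τ, 0 < τ → ∀ z v, HasFDerivAt (fun z => k τ z v) (k' τ z v) z)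
    {T : ℝ} (hT : T ≤ 1) {g : ℝ × Space d → F} (hg : Good T g) {t : ℝ} (ht : t ∈ Icc 0 T)
    (x : Space d) : HasFDerivAt (Iop k T g t) (Iop k' T g t x) x := by
  -- The cut-off potentials are differentiated under the integral sign. They and their derivatives
  -- converge uniformly on the slab, so the derivative passes to the limit.
  have key : ∀ n x, HasFDerivAt (Iop (KatoPDE.cut (eps n) k) T g t)
      (Iop (KatoPDE.cut (eps n) k') T g t x) x := by
    intro n x
    have hε := eps_pos n
    have h0 : Iop (KatoPDE.cut (eps n) k) T g t = fun x => ∫ p in Ioc 0 T ×ˢ univ,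
      KatoPDE.cut (eps n) k (p.1 - t) (x - p.2) (g p) := by
      ext x; exact Iop_cut hε ht.1 x
    rw [h0, Iop_cut hε ht.1 x]
    refine hasFDerivAt_integral_of_dominated_of_fderiv_le (s := Metric.ball x 1)
      (F' := fun x (p : ℝ × Space d) => KatoPDE.cut (eps n) k' (p.1 - t) (x - p.2) (g p))
      (bound := fun p => cutBound d (eps n) * Real.exp 1 * (Real.exp (-‖x - p.2‖) * ‖g p‖))
      (Metric.ball_mem_nhds _ one_pos) ?_ ?_ ?_ ?_ ((hg.integrable_exp x).const_mul _) ?_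
    · exact Eventually.of_forall fun x => hk.aesm_cut hε hg.sm _ _ _
    · refine ((hg.integrable_exp x).const_mul (cutBound d (eps n) * Real.exp 1)).mono'
        (hk.aesm_cut hε hg.sm _ _ _) ?_
      refine (ae_restrict_mem (measurableSet_strip measurableSet_Ioc)).mono fun p hp => ?_
      exact hk.norm_cut_apply_le hε ht.1 hT g (by simp) hp.1.2
    · exact hk'.aesm_cut hε hg.sm _ _ _
    · refine (ae_restrict_mem (measurableSet_strip measurableSet_Ioc)).mono fun p hp x' hx' => ?_
      exact hk'.norm_cut_apply_le hε ht.1 hT g (mem_ball_iff_norm.1 hx').le hp.1.2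
    · refine ae_of_all _ fun p x' _ => ?_
      rcases le_or_gt (p.1 - t) (eps n) with h | h
      · simp only [KatoPDE.cut, chi_eq_zero hε h, zero_smul]
        exact hasFDerivAt_const _ _
      · have h1 := hkk (p.1 - t) (hε.trans h) (x' - p.2) (g p)
        have h2 := h1.comp x' ((hasFDerivAt_id x').sub_const p.2)
        exact (h2.const_smul (chi (eps n) (p.1 - t))).congr_fderiv (by
          ext; simp [KatoPDE.cut])
  refine hasFDerivAt_of_tendstoUniformly (l := atTop)
    (f' := fun n x => Iop (KatoPDE.cut (eps n) k') T g t x) ?_ key ?_ x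
  · have := hk'.tendstoUniformlyOn_cut hT hg
    rw [← tendstoUniformlyOn_univ]
    intro u hu
    filter_upwards [this u hu] with n hn x _
    exact hn (t, x) ⟨ht, mem_univ _⟩
  · intro x
    exact (hk.tendstoUniformlyOn_cut hT hg).tendsto_at (x := (t, x)) ⟨ht, mem_univ _⟩

end

/-- The kernel of composition with `k`. -/
def compKer (k : ℝ → Space d → F →L[ℝ] F') (τ : ℝ) (z : Space d) :
    (Space d →L[ℝ] F) →L[ℝ] (Space d →L[ℝ] F') :=
  ContinuousLinearMap.compL ℝ (Space d) F F' (k τ z)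

lemma IsKer.compKer {k : ℝ → Space d → F →L[ℝ] F'} (hk : IsKer k) : IsKer (KatoPDE.compKer k) where
  cont := (ContinuousLinearMap.compL ℝ (Space d) F F').continuous.comp_continuousOn hk.cont
  bound τ h0 h1 z := by
    refine le_trans ?_ (hk.bound τ h0 h1 z)
    refine ContinuousLinearMap.opNorm_le_bound _ (norm_nonneg _) fun v => ?_
    exact ContinuousLinearMap.opNorm_comp_le _ _

lemma measurePreserving_reflect (a b : ℝ) (x : Space d) :
    MeasurePreserving ((MeasurableEquiv.refl ℝ).prodCongr (MeasurableEquiv.subLeft x))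
      (volume.restrict (Ioc a b ×ˢ univ)) (volume.restrict (Ioc a b ×ˢ univ)) := by
  rw [Measure.volume_eq_prod, ← Measure.prod_restrict, Measure.restrict_univ]
  exact (MeasurePreserving.id _).prod (Measure.measurePreserving_sub_left volume x)

/-- The substitution y ↦ x - y moves the dependence on x from the kernel to the density. -/
lemma Iop_reflect (k : ℝ → Space d → F →L[ℝ] F') (T : ℝ) (g : ℝ × Space d → F) (t : ℝ)
    (x : Space d) :
    Iop k T g t x = ∫ p in Ioc t T ×ˢ univ, k (p.1 - t) p.2 (g (p.1, x - p.2)) := by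
  rw [Iop, ← (measurePreserving_reflect t T x).integral_comp']
  refine integral_congr_ae (ae_of_all _ fun p => ?_)
  change k (p.1 - t) (x - (x - p.2)) (g (p.1, x - p.2)) = _
  rw [sub_sub_cancel]

/-- Differentiation of a potential in the space variable, with the derivative on the density. -/
lemma IsKer.hasFDerivAt_Iop_density {k : ℝ → Space d → F →L[ℝ] F'} (hk : IsKer k)
    {T : ℝ} (hT0 : 0 < T) (hT : T ≤ 1) {g : ℝ × Space d → F} (hg : Good T g)
    {g' : ℝ × Space d → Space d →L[ℝ] F} (hg' : StronglyMeasurable g') {A : ℝ}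
    (hA : ∀ p, ‖g' p‖ ≤ A)
    (hgg : ∀ s ∈ Ioc 0 T, ∀ y, HasFDerivAt (fun y => g (s, y)) (g' (s, y)) y)
    {t : ℝ} (ht : t ∈ Icc 0 T) (x : Space d) :
    HasFDerivAt (Iop k T g t) (Iop (KatoPDE.compKer k) T g' t x) x := by
  have hcomp (x : Space d) : Measurable (fun p : ℝ × Space d => (p.1, x - p.2)) := by fun_prop
  have hkc : AEStronglyMeasurable (fun p : ℝ × Space d => k (p.1 - t) p.2)
      (volume.restrict (Ioc t T ×ˢ univ)) := by
    have h1 : ContinuousOn (fun p : ℝ × Space d => k (p.1 - t) p.2) (Ioc t T ×ˢ univ) :=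
      hk.cont.comp (f := fun p : ℝ × Space d => (p.1 - t, p.2)) (by fun_prop)
        (fun p hp => ⟨sub_pos.2 hp.1.1, mem_univ _⟩)
    exact h1.aestronglyMeasurable (measurableSet_strip measurableSet_Ioc)
  have h0 : Iop k T g t = fun x => ∫ p in Ioc t T ×ˢ univ, k (p.1 - t) p.2 (g (p.1, x - p.2)) := by
    ext x; exact Iop_reflect k T g t x
  rw [h0, Iop_reflect]
  -- Applied to the constant density 1, the Kato bound yields the integrability of the kernel
  -- itself, which dominates the differentiated integrand.
  have hone : Good T (fun _ : ℝ × Space d => (1 : ℝ)) :=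
    Good.of_bounded hT0 stronglyMeasurable_const (c := 1) (by simp)
  refine hasFDerivAt_integral_of_dominated_of_fderiv_le (s := univ) univ_mem
    (F' := fun x (p : ℝ × Space d) => KatoPDE.compKer k (p.1 - t) p.2 (g' (p.1, x - p.2)))
    (bound := fun p => ‖k (p.1 - t) p.2‖ * A) ?_ ?_ ?_ ?_ ?_ ?_
  · exact Eventually.of_forall fun x =>
      isBoundedBilinearMap_apply.continuous.comp_aestronglyMeasurable₂ hkc
      (hg.sm.comp_measurable (hcomp x)).aestronglyMeasurable
  · have h1 := hk.integrable ht.1 hT hg.sm hg.fin x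
    have h2 := ((measurePreserving_reflect t T x).integrable_comp_emb
      (MeasurableEquiv.measurableEmbedding _)).2 h1
    refine h2.congr (ae_of_all _ fun p => ?_)
    change k (p.1 - t) (x - (x - p.2)) (g (p.1, x - p.2)) = _
    rw [sub_sub_cancel]
  · exact isBoundedBilinearMap_apply.continuous.comp_aestronglyMeasurable₂
      ((ContinuousLinearMap.compL ℝ (Space d) F F').continuous.comp_aestronglyMeasurable hkc)
      (hg'.comp_measurable (hcomp x)).aestronglyMeasurable
  · refine ae_of_all _ fun p x' _ => ?_
    refine (ContinuousLinearMap.opNorm_comp_le _ _).trans ?_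
    gcongr
    exact hA _
  · refine Integrable.mul_const ⟨hkc.norm, ?_⟩ A
    have h3 : ∫⁻ p : ℝ × Space d in Ioc t T ×ˢ univ, CE * (ENNReal.ofReal (kap (p.1 - t) (0 - p.2)) *
        ‖(1 : ℝ)‖ₑ) < ⊤ := by
      rw [setLIntegral_congr (strip_ae_eq t T), lintegral_const_mul' _ _ ENNReal.coe_ne_top]
      refine ENNReal.mul_lt_top ENNReal.coe_lt_top (lt_of_le_of_lt ?_
        (lt_top_iff_ne_top.2 hone.fin))
      refine le_trans ?_ (kI_le_kN _ T ht.1 (0 : Space d))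
      exact lintegral_mono_set (prod_mono (Ioo_subset_Ioo_right (by linarith [ht.1])) le_rfl)
    refine lt_of_le_of_lt ?_ h3
    refine setLIntegral_mono' (measurableSet_strip measurableSet_Ioc) fun p hp => ?_
    have hp0 : t < p.1 := hp.1.1
    have hp1 : p.1 ≤ T := hp.1.2
    have h4 := hk.bound (p.1 - t) (sub_pos.2 hp0) (by linarith [ht.1]) p.2
    have h5 := kap_nonneg (sub_pos.2 hp0) p.2
    have e : (CE : ℝ≥0∞) = ENNReal.ofReal (Real.exp 4) := by
      rw [ENNReal.ofReal_eq_coe_nnreal (Real.exp_pos _).le]; rfl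
    rw [enorm_norm, enorm_one, mul_one, e, ← ENNReal.ofReal_mul (Real.exp_pos _).le, ← ofReal_norm]
    apply ENNReal.ofReal_le_ofReal
    have h6 : kap (p.1 - t) (0 - p.2) = kap (p.1 - t) p.2 := by simp [kap]
    rw [h6]
    refine h4.trans (mul_le_of_le_one_right (by positivity) ?_)
    rw [Real.exp_le_one_iff]; simp
  · refine (ae_restrict_mem (measurableSet_strip measurableSet_Ioc)).mono fun p hp x' _ => ?_
    have h1 := hgg p.1 ⟨lt_of_le_of_lt ht.1 hp.1.1, hp.1.2⟩ (x' - p.2)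
    have h2 := h1.comp x' ((hasFDerivAt_id x').sub_const p.2)
    exact ((k (p.1 - t) p.2).hasFDerivAt.comp x' h2).congr_fderiv (by
      ext; simp [KatoPDE.compKer])

/-- The heat kernel acting on `F`-valued functions. -/
def kerq (F : Type*) [NormedAddCommGroup F] [NormedSpace ℝ F] (τ : ℝ) (z : Space d) : F →L[ℝ] F :=
  gk τ z • ContinuousLinearMap.id ℝ F

/-- The gradient of the heat kernel acting on `F`-valued functions. -/
def kerd (F : Type*) [NormedAddCommGroup F] [NormedSpace ℝ F] (τ : ℝ) (z : Space d) :
    F →L[ℝ] (Space d →L[ℝ] F) :=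
  ContinuousLinearMap.smulRightL ℝ (Space d) F (dgk τ z)

lemma isKer_kerq : IsKer (kerq F : ℝ → Space d → F →L[ℝ] F) where
  cont := continuousOn_gk.smul continuousOn_const
  bound τ h0 h1 z := by
    refine le_trans ?_ (gk_le h0 h1 z)
    rw [kerq, norm_smul, Real.norm_of_nonneg (gk_pos h0 z).le]
    exact mul_le_of_le_one_right (gk_pos h0 z).le ContinuousLinearMap.norm_id_le

lemma isKer_kerd : IsKer (kerd F : ℝ → Space d → F →L[ℝ] (Space d →L[ℝ] F)) where
  cont := (ContinuousLinearMap.smulRightL ℝ (Space d) F).continuous.comp_continuousOn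
    continuousOn_dgk
  bound τ h0 h1 z := by
    refine le_trans ?_ (norm_dgk_le h0 h1 z)
    refine ContinuousLinearMap.opNorm_le_bound _ (norm_nonneg _) fun v => ?_
    exact (ContinuousLinearMap.norm_smulRight_apply _ _).le

lemma hasFDerivAt_kerq (τ : ℝ) (z : Space d) (v : F) :
    HasFDerivAt (fun z => kerq F τ z v) (kerd F τ z v) z := by
  refine ((hasFDerivAt_gk τ z).smul_const v).congr_fderiv ?_
  rfl

lemma hasFDerivAt_Iop_kerq {T : ℝ} (hT : T ≤ 1) {g : ℝ × Space d → F} (hg : Good T g) {t : ℝ}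
    (ht : t ∈ Icc 0 T) (x : Space d) :
    HasFDerivAt (Iop (kerq F) T g t) (Iop (kerd F) T g t x) x :=
  isKer_kerq.hasFDerivAt_Iop isKer_kerd (fun τ _ z v => hasFDerivAt_kerq τ z v) hT hg ht x

end KatoPDE
end


/-! ### The fixed-point equation for the gradient, and mild solutions. -/

open Set Filter Topology MeasureTheory
open scoped ENNReal NNReal BoundedContinuousFunction

noncomputable section

namespace KatoPDE

variable {d : ℕ} {F F' A : Type*} [NormedAddCommGroup F] [NormedSpace ℝ F]
  [NormedAddCommGroup F'] [NormedSpace ℝ F'] [NormedAddCommGroup A]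

/-- The closed slab `[0, T] × ℝ^d`. -/
abbrev Slab (d : ℕ) (T : ℝ) : Type := Icc (0 : ℝ) T × Space d

lemma enorm_apply_le {T : ℝ} (V : Slab d T →ᵇ A) (X : Slab d T) : ‖V X‖ₑ ≤ ‖V‖ₑ :=
  enorm_le_iff_norm_le.2 (V.norm_coe_le_norm X)

lemma enorm_le_of_forall {T : ℝ} {V : Slab d T →ᵇ A} {c : ℝ≥0∞} (h : ∀ X, ‖V X‖ₑ ≤ c) :
    ‖V‖ₑ ≤ c := by
  rcases eq_or_ne c ⊤ with rfl | hc
  · exact le_top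
  lift c to ℝ≥0 using hc
  rw [enorm_le_coe, ← NNReal.coe_le_coe, coe_nnnorm]
  refine (V.norm_le c.2).2 fun X => ?_
  have := h X
  rwa [enorm_le_coe, ← NNReal.coe_le_coe, coe_nnnorm] at this

/-- Finiteness of a is what allows a/4 to be absorbed. The factor obtained is 4/3, rounded up to 2.
-/
lemma ennreal_absorb {a m : ℝ≥0∞} (ha : a ≠ ⊤) (h : a ≤ 1 / 4 * a + m) : a ≤ 2 * m := by
  rcases eq_or_ne m ⊤ with rfl | hm
  · simp
  lift a to ℝ≥0 using ha
  lift m to ℝ≥0 using hm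
  have e : (1 / 4 : ℝ≥0∞) = ((1 / 4 : ℝ≥0) : ℝ≥0∞) := by
    rw [ENNReal.coe_div (by norm_num)]; norm_num
  rw [e] at h
  norm_cast at h ⊢
  have h2 : (a : ℝ) ≤ 1 / 4 * a + m := by exact_mod_cast h
  have h3 : (0 : ℝ) ≤ m := m.2
  rw [← NNReal.coe_le_coe]
  push_cast
  linarith

lemma Iop_sub {k : ℝ → Space d → F →L[ℝ] F'} (hk : IsKer k) {T t : ℝ} (ht : 0 ≤ t) (hT : T ≤ 1)
    {g₁ g₂ : ℝ × Space d → F} (h1 : Good T g₁) (h2 : Good T g₂) (x : Space d) :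
    Iop k T g₁ t x - Iop k T g₂ t x = Iop k T (fun p => g₁ p - g₂ p) t x := by
  unfold Iop
  rw [← integral_sub (hk.integrable ht hT h1.sm h1.fin x) (hk.integrable ht hT h2.sm h2.fin x)]
  simp

/-- A potential as a bounded continuous function on the slab. -/
def potB {k : ℝ → Space d → F →L[ℝ] F'} (hk : IsKer k) {T : ℝ} (hT : T ≤ 1)
    {g : ℝ × Space d → F} (hg : Good T g) : Slab d T →ᵇ F' :=
  BoundedContinuousFunction.ofNormedAddCommGroup (fun X => Iop k T g X.1 X.2)
    ((hk.continuousOn_Iop hT hg).comp_continuous (f := fun X : Slab d T => ((X.1 : ℝ), X.2))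
      (by fun_prop) (fun X => ⟨X.1.2, mem_univ _⟩))
    (CE * kN g T).toReal (fun X => by
      have h := hk.enorm_Iop_le X.1.2.1 hT g X.2
      have h' := ENNReal.toReal_mono (ENNReal.mul_ne_top ENNReal.coe_ne_top hg.fin) h
      rwa [toReal_enorm] at h')

/-- Extension of a function on the slab to all times. -/
def lift {T : ℝ} (hT : 0 ≤ T) (V : Slab d T →ᵇ A) (p : ℝ × Space d) : A :=
  V (projIcc 0 T hT p.1, p.2)

lemma continuous_lift {T : ℝ} (hT : 0 ≤ T) (V : Slab d T →ᵇ A) : Continuous (lift hT V) :=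
  V.continuous.comp ((continuous_projIcc.comp continuous_fst).prodMk continuous_snd)

lemma lift_of_mem {T : ℝ} (hT : 0 ≤ T) (V : Slab d T →ᵇ A) {t : ℝ} (ht : t ∈ Icc 0 T)
    (x : Space d) : lift hT V (t, x) = V (⟨t, ht⟩, x) := by
  rw [lift, projIcc_of_mem hT ht]

lemma enorm_lift_le {T : ℝ} (hT : 0 ≤ T) (V : Slab d T →ᵇ A) (p : ℝ × Space d) :
    ‖lift hT V p‖ₑ ≤ ‖V‖ₑ := enorm_apply_le V _

/-- The source term `⟨b, V⟩ - f`. -/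
def src {T : ℝ} (hT : 0 ≤ T) (b : ℝ × Space d → Space d) (f : ℝ × Space d → F)
    (V : Slab d T →ᵇ (Space d →L[ℝ] F)) (p : ℝ × Space d) : F := lift hT V p (b p) - f p

section

variable {T : ℝ} {b : ℝ × Space d → Space d} {f : ℝ × Space d → F}

lemma enorm_src_le (hT : 0 ≤ T) (V : Slab d T →ᵇ (Space d →L[ℝ] F)) (p : ℝ × Space d) :
    ‖src hT b f V p‖ₑ ≤ ‖V‖₊ * ‖b p‖ₑ + (1 : ℝ≥0) * ‖f p‖ₑ := by
  rw [src, ENNReal.coe_one, one_mul]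
  refine enorm_sub_le.trans ?_
  gcongr
  refine ((lift hT V p).le_opENorm (b p)).trans ?_
  gcongr
  exact enorm_lift_le hT V p

lemma Good.src (hT : 0 ≤ T) (hb : Good T b) (hf : Good T f)
    (V : Slab d T →ᵇ (Space d →L[ℝ] F)) : Good T (src hT b f V) :=
  Good.of_le hb hf ((isBoundedBilinearMap_apply.continuous.comp_stronglyMeasurable
    ((continuous_lift hT V).stronglyMeasurable.prodMk hb.sm)).sub hf.sm) (enorm_src_le hT V)

variable {k : ℝ → Space d → F →L[ℝ] F'}

lemma enorm_Iop_src_le (hk : IsKer k) (hT0 : 0 ≤ T) (hT : T ≤ 1) (hb : Good T b)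
    (hb4 : CE * kN b T ≤ 1 / 4) (V : Slab d T →ᵇ (Space d →L[ℝ] F)) {t : ℝ} (ht : 0 ≤ t)
    (x : Space d) :
    ‖Iop k T (src hT0 b f V) t x‖ₑ ≤ 1 / 4 * ‖V‖ₑ + CE * kN f T := by
  refine (hk.enorm_Iop_le ht hT _ x).trans ?_
  calc CE * kN (src hT0 b f V) T ≤ CE * (‖V‖₊ * kN b T + (1 : ℝ≥0) * kN f T) := by
        gcongr; exact kN_le_add hb.sm (enorm_src_le hT0 V) T
    _ = (CE * kN b T) * ‖V‖ₑ + CE * kN f T := by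
        rw [ENNReal.coe_one, one_mul, enorm_eq_nnnorm]; ring
    _ ≤ _ := by gcongr

/-- In the difference f cancels and what remains is the potential of ⟨b, V - W⟩, so the contraction
constant is e⁴ N_b(T). -/
lemma enorm_Iop_src_sub_le (hk : IsKer k) (hT0 : 0 ≤ T) (hT : T ≤ 1) (hb : Good T b)
    (hf : Good T f) (hb4 : CE * kN b T ≤ 1 / 4) (V W : Slab d T →ᵇ (Space d →L[ℝ] F)) {t : ℝ}
    (ht : 0 ≤ t) (x : Space d) :
    ‖Iop k T (src hT0 b f V) t x - Iop k T (src hT0 b f W) t x‖ₑ ≤ 1 / 4 * ‖V - W‖ₑ := by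
  rw [Iop_sub hk ht hT (hb.src hT0 hf V) (hb.src hT0 hf W)]
  refine (hk.enorm_Iop_le ht hT _ x).trans ?_
  have : ∀ p, ‖src hT0 b f V p - src hT0 b f W p‖ₑ ≤ ‖V - W‖₊ * ‖b p‖ₑ + (0 : ℝ≥0) * ‖b p‖ₑ := by
    intro p
    have e : src hT0 b f V p - src hT0 b f W p = lift hT0 (V - W) p (b p) := by
      simp [src, lift]
    rw [e, ENNReal.coe_zero, zero_mul, add_zero]
    refine ((lift hT0 (V - W) p).le_opENorm (b p)).trans ?_
    gcongr
    exact enorm_lift_le hT0 _ p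
  calc CE * kN (fun p => src hT0 b f V p - src hT0 b f W p) T
      ≤ CE * (‖V - W‖₊ * kN b T + (0 : ℝ≥0) * kN b T) := by
        gcongr; exact kN_le_add hb.sm this T
    _ = (CE * kN b T) * ‖V - W‖ₑ := by
        rw [ENNReal.coe_zero, zero_mul, add_zero, enorm_eq_nnnorm]; ring
    _ ≤ _ := by gcongr

end

lemma contractingWith_of_enorm {B : Type*} [NormedAddCommGroup B] {Φ : B → B} {K : ℝ≥0}
    (hK : K < 1) (h : ∀ V W, ‖Φ V - Φ W‖ₑ ≤ K * ‖V - W‖ₑ) : ContractingWith K Φ :=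
  ⟨hK, fun V W => by rw [edist_eq_enorm_sub, edist_eq_enorm_sub]; exact h V W⟩

lemma ennreal_quarter : (1 / 4 : ℝ≥0∞) = ((1 / 4 : ℝ≥0) : ℝ≥0∞) := by
  rw [ENNReal.coe_div (by norm_num)]; norm_num

/-- `V` is the gradient of the mild solution with coefficients `b`, `f`. -/
def IsFix {T : ℝ} (hT : 0 ≤ T) (b f : ℝ × Space d → Space d)
    (V : Slab d T →ᵇ (Space d →L[ℝ] Space d)) : Prop :=
  ∀ X : Slab d T, V X = Iop (kerd (Space d)) T (src hT b f V) X.1 X.2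

section

variable {T : ℝ} {b f : ℝ × Space d → Space d} {V W : Slab d T →ᵇ (Space d →L[ℝ] Space d)}

lemma exists_isFix (hT0 : 0 ≤ T) (hT : T ≤ 1) (hb : Good T b) (hf : Good T f)
    (hb4 : CE * kN b T ≤ 1 / 4) : ∃ V, IsFix hT0 b f V := by
  let Φ : (Slab d T →ᵇ (Space d →L[ℝ] Space d)) → (Slab d T →ᵇ (Space d →L[ℝ] Space d)) :=
    fun V => potB isKer_kerd hT (hb.src hT0 hf V)
  have hΦ : ContractingWith (1 / 4) Φ := by
    refine contractingWith_of_enorm (Φ := Φ) (K := 1 / 4)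
      (by rw [← NNReal.coe_lt_coe]; push_cast; norm_num) fun V W => ?_
    rw [← ennreal_quarter]
    exact enorm_le_of_forall fun X =>
      enorm_Iop_src_sub_le isKer_kerd hT0 hT hb hf hb4 V W X.1.2.1 X.2
  refine ⟨hΦ.fixedPoint, fun X => ?_⟩
  exact (DFunLike.congr_fun hΦ.fixedPoint_isFixedPt X).symm

lemma IsFix.unique {hT0 : 0 ≤ T} (hT : T ≤ 1) (hb : Good T b) (hf : Good T f)
    (hb4 : CE * kN b T ≤ 1 / 4) (hV : IsFix hT0 b f V) (hW : IsFix hT0 b f W) : V = W := by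
  have h : ‖V - W‖ₑ ≤ 1 / 4 * ‖V - W‖ₑ + 0 := by
    rw [add_zero]
    refine enorm_le_of_forall fun X => ?_
    rw [BoundedContinuousFunction.sub_apply, hV X, hW X]
    exact enorm_Iop_src_sub_le isKer_kerd hT0 hT hb hf hb4 V W X.1.2.1 X.2
  have h2 := ennreal_absorb enorm_ne_top h
  rw [mul_zero, nonpos_iff_eq_zero, enorm_eq_nnnorm, ENNReal.coe_eq_zero] at h2
  have h3 : ‖V - W‖ = 0 := congrArg NNReal.toReal h2
  exact sub_eq_zero.1 (norm_eq_zero.1 h3)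

lemma IsFix.enorm_le {hT0 : 0 ≤ T} (hT : T ≤ 1) (hb : Good T b)
    (hb4 : CE * kN b T ≤ 1 / 4) (hV : IsFix hT0 b f V) : ‖V‖ₑ ≤ 2 * (CE * kN f T) := by
  refine ennreal_absorb enorm_ne_top (enorm_le_of_forall fun X => ?_)
  rw [hV X]
  exact enorm_Iop_src_le isKer_kerd hT0 hT hb hb4 V X.1.2.1 X.2

/-- Inserting the gradient bound gives the factor 1/4 · 2 + 1 ≤ 2: u obeys the same bound as V, and
the two add up to 4e⁴ N_f(T). -/
lemma IsFix.enorm_sol_le {hT0 : 0 ≤ T} (hT : T ≤ 1) (hb : Good T b)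
    (hb4 : CE * kN b T ≤ 1 / 4) (hV : IsFix hT0 b f V) {t : ℝ} (ht : 0 ≤ t) (x : Space d) :
    ‖Iop (kerq (Space d)) T (src hT0 b f V) t x‖ₑ ≤ 2 * (CE * kN f T) := by
  refine (enorm_Iop_src_le isKer_kerq hT0 hT hb hb4 V ht x).trans ?_
  have h := hV.enorm_le hT hb hb4
  calc 1 / 4 * ‖V‖ₑ + CE * kN f T ≤ 1 / 4 * (2 * (CE * kN f T)) + CE * kN f T := by gcongr
    _ ≤ 1 * (CE * kN f T) + CE * kN f T := by
        rw [← mul_assoc]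
        gcongr
        rw [ennreal_quarter]
        norm_cast
        rw [← NNReal.coe_le_coe]; push_cast; norm_num
    _ = _ := by ring

lemma IsFix.hasFDerivAt {hT0 : 0 ≤ T} (hT : T ≤ 1) (hb : Good T b) (hf : Good T f)
    (hV : IsFix hT0 b f V) {t : ℝ} (ht : t ∈ Icc 0 T) (x : Space d) :
    HasFDerivAt (Iop (kerq (Space d)) T (src hT0 b f V) t) (V (⟨t, ht⟩, x)) x := by
  rw [hV]
  exact hasFDerivAt_Iop_kerq hT (hb.src hT0 hf V) ht x

lemma c01Norm_le {u : ℝ → Space d → Space d} {S : Set (Space d)} {c₁ c₂ : ℝ≥0∞}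
    (h1 : ∀ t ∈ Icc 0 T, ∀ x ∈ S, ‖u t x‖ₑ ≤ c₁)
    (h2 : ∀ t ∈ Icc 0 T, ∀ x ∈ S, ‖fderiv ℝ (u t) x‖ₑ ≤ c₂) : c01Norm T S u ≤ c₁ + c₂ :=
  add_le_add (iSup₂_le fun t ht => iSup₂_le fun x hx => h1 t ht x hx)
    (iSup₂_le fun t ht => iSup₂_le fun x hx => h2 t ht x hx)

lemma IsFix.c01Norm_le {hT0 : 0 ≤ T} (hT : T ≤ 1) (hb : Good T b) (hf : Good T f)
    (hb4 : CE * kN b T ≤ 1 / 4) (hV : IsFix hT0 b f V) :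
    c01Norm T univ (Iop (kerq (Space d)) T (src hT0 b f V)) ≤ (4 * CE : ℝ≥0) * kN f T := by
  refine (KatoPDE.c01Norm_le (c₁ := 2 * (CE * kN f T)) (c₂ := 2 * (CE * kN f T)) ?_ ?_).trans ?_
  · exact fun t ht x _ => hV.enorm_sol_le hT hb hb4 ht.1 x
  · intro t ht x _
    rw [(hV.hasFDerivAt hT hb hf ht x).fderiv]
    exact (enorm_apply_le V _).trans (hV.enorm_le hT hb hb4)
  · rw [ENNReal.coe_mul]
    apply le_of_eq
    push_cast
    ring

lemma IsFix.isCb01 {hT0 : 0 ≤ T} (hT : T ≤ 1) (hb : Good T b) (hf : Good T f)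
    (hb4 : CE * kN b T ≤ 1 / 4) (hV : IsFix hT0 b f V) :
    IsCb01 T (Iop (kerq (Space d)) T (src hT0 b f V)) where
  continuousOn := isKer_kerq.continuousOn_Iop hT (hb.src hT0 hf V)
  differentiable t ht x := (hV.hasFDerivAt hT hb hf ht x).differentiableAt
  continuousOn_fderiv := by
    refine (isKer_kerd.continuousOn_Iop hT (hb.src hT0 hf V)).congr fun X hX => ?_
    exact (hasFDerivAt_Iop_kerq hT (hb.src hT0 hf V) hX.1 X.2).fderiv
  norm_lt_top := lt_of_le_of_lt (hV.c01Norm_le hT hb hf hb4)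
    (ENNReal.mul_lt_top ENNReal.coe_lt_top (lt_top_iff_ne_top.2 hf.fin))

/-- Smallness of f gives |∇u| ≤ 2 · 1/4, and the mean value inequality concludes. -/
lemma IsFix.lipschitz {hT0 : 0 ≤ T} (hT : T ≤ 1) (hb : Good T b) (hf : Good T f)
    (hb4 : CE * kN b T ≤ 1 / 4) (hf4 : CE * kN f T ≤ 1 / 4) (hV : IsFix hT0 b f V) {t : ℝ}
    (ht : t ∈ Icc 0 T) (x y : Space d) :
    ‖Iop (kerq (Space d)) T (src hT0 b f V) t y - Iop (kerq (Space d)) T (src hT0 b f V) t x‖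
      ≤ 1 / 2 * ‖x - y‖ := by
  rw [norm_sub_rev x y]
  refine Convex.norm_image_sub_le_of_norm_hasFDerivWithin_le (𝕜 := ℝ) (s := univ)
    (fun z _ => (hV.hasFDerivAt hT hb hf ht z).hasFDerivWithinAt) (fun z _ => ?_) convex_univ
    (mem_univ _) (mem_univ _)
  have h : ‖V (⟨t, ht⟩, z)‖ₑ ≤ 2 * (1 / 4) :=
    (enorm_apply_le V _).trans ((hV.enorm_le hT hb hb4).trans (by gcongr))
  have h' := ENNReal.toReal_mono (by finiteness) h
  rw [toReal_enorm] at h'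
  refine h'.trans ?_
  rw [ENNReal.toReal_mul, ENNReal.toReal_div]
  norm_num

end

section

variable {T : ℝ} {b f : ℝ → Space d → Space d}

lemma zeroExt_of_pos {G : Type*} [Zero G] (h : ℝ → Space d → G) {t : ℝ} (ht : 0 < t)
    (x : Space d) : zeroExt h t x = h t x := by simp [zeroExt, ht]

lemma mildIntegrand_eq {hT0 : 0 ≤ T} {u : ℝ → Space d → Space d}
    {V : Slab d T →ᵇ (Space d →L[ℝ] Space d)}
    (hu : ∀ t (ht : t ∈ Icc 0 T) x, fderiv ℝ (u t) x = V (⟨t, ht⟩, x)) {t : ℝ} (ht : 0 ≤ t)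
    (x : Space d) {p : ℝ × Space d} (hp : p.1 ∈ Ioc t T) :
    mildIntegrand b f u t x p.1 p.2 = kerq (Space d) (p.1 - t) (x - p.2)
      (src hT0 (Function.uncurry (zeroExt b)) (Function.uncurry (zeroExt f)) V p) := by
  have h0 : 0 < p.1 := lt_of_le_of_lt ht hp.1
  have h1 : lift hT0 V p = V (⟨p.1, h0.le, hp.2⟩, p.2) := lift_of_mem hT0 V ⟨h0.le, hp.2⟩ p.2
  rw [src, h1, ← hu p.1 ⟨h0.le, hp.2⟩ p.2]
  simp only [Function.uncurry, zeroExt_of_pos _ h0]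
  rfl

lemma IsFix.isMildSolution {hT0 : 0 ≤ T} (hT : T ≤ 1)
    (hb : Good T (Function.uncurry (zeroExt b))) (hf : Good T (Function.uncurry (zeroExt f)))
    (hb4 : CE * kN (Function.uncurry (zeroExt b)) T ≤ 1 / 4)
    {V : Slab d T →ᵇ (Space d →L[ℝ] Space d)}
    (hV : IsFix hT0 (Function.uncurry (zeroExt b)) (Function.uncurry (zeroExt f)) V) :
    IsMildSolution b f T (Iop (kerq (Space d)) T
      (src hT0 (Function.uncurry (zeroExt b)) (Function.uncurry (zeroExt f)) V)) := by
  have hu : ∀ t (ht : t ∈ Icc 0 T) x, fderiv ℝ (Iop (kerq (Space d)) T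
      (src hT0 (Function.uncurry (zeroExt b)) (Function.uncurry (zeroExt f)) V) t) x
        = V (⟨t, ht⟩, x) :=
    fun t ht x => (hV.hasFDerivAt hT hb hf ht x).fderiv
  have hint : ∀ t ∈ Icc 0 T, ∀ x : Space d,
      IntegrableOn (Function.uncurry (mildIntegrand b f (Iop (kerq (Space d)) T
      (src hT0 (Function.uncurry (zeroExt b)) (Function.uncurry (zeroExt f)) V)) t x))
        (Ioc t T ×ˢ univ) := fun t ht x =>
    (isKer_kerq.integrable ht.1 hT (hb.src hT0 hf V).sm (hb.src hT0 hf V).fin x).congr_fun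
      (fun p hp => (mildIntegrand_eq hu ht.1 x hp.1).symm) (measurableSet_strip measurableSet_Ioc)
  refine ⟨hV.isCb01 hT hb hf hb4, hint, fun t ht x => ?_⟩
  have h1 := setIntegral_prod _ (hint t ht x)
  simp only [Measure.restrict_univ] at h1
  rw [intervalIntegral.integral_of_le ht.2]
  refine Eq.trans ?_ h1
  exact setIntegral_congr_fun (measurableSet_strip measurableSet_Ioc)
    fun p hp => (mildIntegrand_eq hu ht.1 x hp.1).symm

lemma IsCb01.exists_gradient {u : ℝ → Space d → Space d} (hu : IsCb01 T u) :
    ∃ V : Slab d T →ᵇ (Space d →L[ℝ] Space d),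
      ∀ t (ht : t ∈ Icc 0 T) x, fderiv ℝ (u t) x = V (⟨t, ht⟩, x) := by
  have hfin := hu.norm_lt_top
  refine ⟨BoundedContinuousFunction.ofNormedAddCommGroup
    (fun X : Slab d T => fderiv ℝ (u X.1) X.2)
    (hu.continuousOn_fderiv.comp_continuous (f := fun X : Slab d T => ((X.1 : ℝ), X.2))
      (by fun_prop) (fun X => ⟨X.1.2, mem_univ _⟩))
    (c01Norm T univ u).toReal (fun X => ?_), fun t ht x => rfl⟩
  have h1 : ‖fderiv ℝ (u X.1) X.2‖ₑ ≤ c01Norm T univ u := by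
    refine le_trans ?_ le_add_self
    exact le_trans (le_iSup₂ (f := fun x (_ : x ∈ (univ : Set (Space d))) =>
        ‖fderiv ℝ (u X.1) x‖ₑ) X.2 (mem_univ _))
      (le_iSup₂ (f := fun t (_ : t ∈ Icc 0 T) => ⨆ x ∈ (univ : Set (Space d)),
        ‖fderiv ℝ (u t) x‖ₑ) X.1.1 X.1.2)
  have h' := ENNReal.toReal_mono hfin.ne h1
  rwa [toReal_enorm] at h'

/-- Differentiating the mild identity in x shows that ∇u solves the fixed-point equation, which
reduces uniqueness of mild solutions to uniqueness of V. -/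
lemma IsMildSolution.exists_isFix {u : ℝ → Space d → Space d} (hT0 : 0 ≤ T) (hT : T ≤ 1)
    (hb : Good T (Function.uncurry (zeroExt b))) (hf : Good T (Function.uncurry (zeroExt f)))
    (hu : IsMildSolution b f T u) : ∃ V : Slab d T →ᵇ (Space d →L[ℝ] Space d),
      IsFix hT0 (Function.uncurry (zeroExt b)) (Function.uncurry (zeroExt f)) V ∧
      ∀ t ∈ Icc 0 T, ∀ x, u t x = Iop (kerq (Space d)) T
        (src hT0 (Function.uncurry (zeroExt b)) (Function.uncurry (zeroExt f)) V) t x := by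
  obtain ⟨V, hV⟩ := hu.isCb01.exists_gradient
  have key : ∀ t ∈ Icc 0 T, ∀ x, u t x = Iop (kerq (Space d)) T
        (src hT0 (Function.uncurry (zeroExt b)) (Function.uncurry (zeroExt f)) V) t x := by
    intro t ht x
    rw [hu.eq_integral t ht x, intervalIntegral.integral_of_le ht.2]
    have h1 := setIntegral_prod _ (hu.integrableOn t ht x)
    simp only [Measure.restrict_univ] at h1
    refine h1.symm.trans ?_
    exact setIntegral_congr_fun (measurableSet_strip measurableSet_Ioc)
      fun p hp => mildIntegrand_eq hV ht.1 x hp.1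
  refine ⟨V, fun X => ?_, key⟩
  have h2 := hasFDerivAt_Iop_kerq hT (hb.src hT0 hf V) X.1.2 X.2
  rw [← h2.fderiv, ← hV X.1.1 X.1.2 X.2]
  congr 1
  ext1 x
  exact key X.1.1 X.1.2 x

end

end KatoPDE
end


/-! ### What membership in the Kato class provides. -/

open Set Filter Topology MeasureTheory
open scoped ENNReal NNReal BoundedContinuousFunction

noncomputable section

namespace KatoPDE

variable {d : ℕ} {F : Type*} [NormedAddCommGroup F]

lemma setLIntegral_add_left (f : ℝ → ℝ≥0∞) {s s' : Set ℝ} (hs : MeasurableSet s)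
    (hs' : MeasurableSet s') (t : ℝ) (h : ∀ r, t + r ∈ s' ↔ r ∈ s) :
    ∫⁻ r in s, f (t + r) = ∫⁻ r in s', f r := by
  rw [← lintegral_indicator hs, ← lintegral_indicator hs',
    ← lintegral_add_left_eq_self (indicator s' f) t]
  congr 1; ext r
  by_cases hr : r ∈ s
  · rw [indicator_of_mem hr, indicator_of_mem ((h r).2 hr)]
  · rw [indicator_of_notMem hr, indicator_of_notMem (fun h' => hr ((h r).1 h'))]

lemma setLIntegral_sub_left (f : ℝ → ℝ≥0∞) {s s' : Set ℝ} (hs : MeasurableSet s)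
    (hs' : MeasurableSet s') (t : ℝ) (h : ∀ r, t - r ∈ s' ↔ r ∈ s) :
    ∫⁻ r in s, f (t - r) = ∫⁻ r in s', f r := by
  rw [← lintegral_indicator hs, ← lintegral_indicator hs',
    ← lintegral_sub_left_eq_self (indicator s' f) t]
  congr 1; ext r
  by_cases hr : r ∈ s
  · rw [indicator_of_mem hr, indicator_of_mem ((h r).2 hr)]
  · rw [indicator_of_notMem hr, indicator_of_notMem (fun h' => hr ((h r).1 h'))]

section

variable {b : ℝ → Space d → F}

lemma kI_eq (hb : StronglyMeasurable (Function.uncurry (zeroExt b))) (T t : ℝ) (x : Space d) :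
    kI (Function.uncurry (zeroExt b)) T t x
      = ∫⁻ s in Ioo t (t + T), ∫⁻ y, ENNReal.ofReal (kap (s - t) (x - y)) * ‖zeroExt b s y‖ₑ := by
  unfold kI
  have := hb.enorm
  rw [setLIntegral_strip (by fun_prop)]
  rfl

lemma katoN_eq_kN (hb : StronglyMeasurable (Function.uncurry (zeroExt b))) :
    katoN 1 b = kN (Function.uncurry (zeroExt b)) := by
  ext T
  unfold katoN kN
  refine iSup_congr fun t => iSup_congr fun ht => iSup_congr fun x => ?_
  rw [kI_eq hb]
  refine setLIntegral_congr_fun measurableSet_Ioo fun s hs => ?_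
  have h0 : 0 < s := lt_of_le_of_lt ht hs.1
  simp only [zeroExt_of_pos _ h0, kap, one_mul]

lemma enorm_zeroExt_norm (b : ℝ → Space d → F) (s : ℝ) (y : Space d) :
    ‖zeroExt (fun t x => ‖b t x‖) s y‖ₑ = ‖zeroExt b s y‖ₑ := by
  unfold zeroExt
  split_ifs
  · exact enorm_norm _
  · simp

/-- The choice λ = 1/2 turns λ|z|²/(2s) into |z|²/(4s). -/
lemma katoForward_eq_kN (hb : StronglyMeasurable (Function.uncurry (zeroExt b))) :
    katoForward 1 (1 / 2) (fun t x => ‖b t x‖) = kN (Function.uncurry (zeroExt b)) := by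
  ext T
  unfold katoForward kN
  refine iSup_congr fun t => iSup_congr fun ht => iSup_congr fun x => ?_
  rw [kI_eq hb, ← setLIntegral_add_left _ (s := Ioo 0 T) (s' := Ioo t (t + T))
    measurableSet_Ioo measurableSet_Ioo t (by simp)]
  refine setLIntegral_congr_fun measurableSet_Ioo fun s hs => ?_
  simp only [enorm_zeroExt_norm, add_sub_cancel_left]
  congr 1; ext y
  congr 2
  unfold kap
  congr 2
  · ring
  · congr 1
    have : s ≠ 0 := hs.1.ne'
    field_simp
    norm_num
    ring

/-- The Gaussian mass of `h` at time `s` around `x`. -/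
def gaussMass (c : ℝ) (b : ℝ → Space d → F) (x : Space d) (s : ℝ) : ℝ≥0∞ :=
  ∫⁻ y, ENNReal.ofReal (Real.exp (-(c * ‖x - y‖ ^ 2))) * ‖zeroExt b s y‖ₑ

/-- Away from its singular time the Kato weight dominates one fixed Gaussian: the power of s is at
least 1 because s ≤ 1, and 1/(2s) ≤ 2/S because s ≥ S/4. -/
lemma gaussMass_le {S s : ℝ} (hs : S / 4 ≤ s) (hS : 0 < S) (hs1 : s ≤ 1) (b : ℝ → Space d → F)
    (x : Space d) (r : ℝ) : gaussMass (2 / S) b x r ≤ ∫⁻ y : Space d,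
      ENNReal.ofReal (s ^ (-((d + 2 - 1 : ℝ) / 2)) * Real.exp (-(1 * ‖x - y‖ ^ 2 / (2 * s)))) *
      ‖zeroExt (fun t x => ‖b t x‖) r y‖ₑ := by
  refine lintegral_mono fun y => ?_
  simp only [enorm_zeroExt_norm]
  gcongr
  have hs0 : 0 < s := by linarith
  have h1 : 1 ≤ s ^ (-((d + 2 - 1 : ℝ) / 2)) :=
    Real.one_le_rpow_of_pos_of_le_one_of_nonpos hs0 hs1 (by
      have : (0 : ℝ) ≤ d := Nat.cast_nonneg d
      linarith)
  have h2 : Real.exp (-(2 / S * ‖x - y‖ ^ 2)) ≤ Real.exp (-(1 * ‖x - y‖ ^ 2 / (2 * s))) := by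
    apply Real.exp_le_exp.2
    rw [neg_le_neg_iff, one_mul, div_le_iff₀ (by positivity)]
    have : 1 ≤ 2 / S * (2 * s) := by
      rw [div_mul_eq_mul_div, le_div_iff₀ hS]; linarith
    nlinarith [sq_nonneg ‖x - y‖]
  calc _ ≤ Real.exp (-(1 * ‖x - y‖ ^ 2 / (2 * s))) := h2
    _ ≤ _ := le_mul_of_one_le_left (Real.exp_pos _).le h1

/-- The forward integral started at jS/2, restricted to s in (S/4, 3S/4], covers one window of
length S/2 at cost 1. Forward integrals started at t ≥ 0 never cover (0, S/4] in this way; that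
window is reached by the backward integral from time S with s in [3S/4, S). -/
lemma lintegral_gaussMass_le {S : ℝ} (hS : 0 < S) (hS1 : S ≤ 1)
    (hF : katoForward 1 1 (fun t x => ‖b t x‖) S ≤ 1)
    (hB : katoBackward 1 1 (fun t x => ‖b t x‖) S ≤ 1) (x : Space d) (j : ℕ) :
    ∫⁻ s in Ioc 0 (S / 4 + j * (S / 2)), gaussMass (2 / S) b x s ≤ 1 + j := by
  induction j with
  | zero =>
    simp only [Nat.cast_zero, zero_mul, add_zero]
    refine le_trans ?_ hB
    refine le_trans ?_ (le_iSup₂ (f := fun t (_ : t ∈ Ici (0 : ℝ)) => ⨆ x : Space d,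
      ∫⁻ s in Ioo 0 S, ∫⁻ y : Space d, ENNReal.ofReal (s ^ (-((d + 2 - 1 : ℝ) / 2)) *
        Real.exp (-(1 * ‖x - y‖ ^ 2 / (2 * s)))) * ‖zeroExt (fun t x => ‖b t x‖) (t - s) y‖ₑ)
      S hS.le)
    refine le_trans ?_ (le_iSup _ x)
    rw [← setLIntegral_sub_left (gaussMass (2 / S) b x) (s := Ico (3 * S / 4) S)
      measurableSet_Ico measurableSet_Ioc S (by
        intro r; simp only [mem_Ioc, mem_Ico]
        constructor <;> rintro ⟨h1, h2⟩ <;> constructor <;> linarith)]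
    refine le_trans (setLIntegral_mono' measurableSet_Ico fun s hs => ?_)
      (lintegral_mono_set (fun s hs => ⟨by linarith [hs.1], hs.2⟩))
    exact gaussMass_le (by linarith [hs.1]) hS (by linarith [hs.2]) b x _
  | succ j ih =>
    have hj : 0 ≤ (j : ℝ) * (S / 2) := by positivity
    have h1 : Ioc 0 (S / 4 + ((j + 1 : ℕ) : ℝ) * (S / 2)) ⊆ Ioc 0 (S / 4 + j * (S / 2)) ∪
        Ioc (S / 4 + j * (S / 2)) (S / 4 + ((j + 1 : ℕ) : ℝ) * (S / 2)) := by
      rintro s ⟨h1, h2⟩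
      rcases le_or_gt s (S / 4 + j * (S / 2)) with h | h
      · exact Or.inl ⟨h1, h⟩
      · exact Or.inr ⟨h, h2⟩
    refine (lintegral_mono_set h1).trans ((lintegral_union_le _ _ _).trans ?_)
    push_cast
    rw [← add_assoc]
    refine add_le_add ih ?_
    refine le_trans ?_ hF
    refine le_trans ?_ (le_iSup₂ (f := fun t (_ : t ∈ Ici (0 : ℝ)) => ⨆ x : Space d,
      ∫⁻ s in Ioo 0 S, ∫⁻ y : Space d, ENNReal.ofReal (s ^ (-((d + 2 - 1 : ℝ) / 2)) *
        Real.exp (-(1 * ‖x - y‖ ^ 2 / (2 * s)))) * ‖zeroExt (fun t x => ‖b t x‖) (t + s) y‖ₑ)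
      ((j : ℝ) * (S / 2)) hj)
    refine le_trans ?_ (le_iSup _ x)
    rw [← setLIntegral_add_left (gaussMass (2 / S) b x) (s := Ioc (S / 4) (3 * S / 4))
      measurableSet_Ioc measurableSet_Ioc ((j : ℝ) * (S / 2)) (by
        intro r; simp only [mem_Ioc]
        constructor <;> rintro ⟨h1, h2⟩ <;> constructor <;> linarith)]
    refine le_trans (setLIntegral_mono' measurableSet_Ioc fun s hs => ?_)
      (lintegral_mono_set (fun s hs => ⟨by linarith [hs.1], by linarith [hs.2]⟩))
    exact gaussMass_le (by linarith [hs.1]) hS (by linarith [hs.2]) b x _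

/-- Uniform local integrability follows from uniform Gaussian integrability. -/
lemma lintegral_exp_le_of_gauss {h : ℝ × Space d → F} (hm : StronglyMeasurable h) {c : ℝ}
    (hc : 0 ≤ c) {s : Set ℝ} {M : ℝ≥0∞} (hM : M ≠ ⊤)
    (H : ∀ z : Space d, ∫⁻ p in s ×ˢ univ,
      ENNReal.ofReal (Real.exp (-(c * ‖z - p.2‖ ^ 2))) * ‖h p‖ₑ ≤ M) :
    ∃ M' : ℝ≥0∞, M' ≠ ⊤ ∧ ∀ x : Space d,
      ∫⁻ p in s ×ˢ univ, ENNReal.ofReal (Real.exp (-‖x - p.2‖)) * ‖h p‖ₑ ≤ M' := by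
  have hm' := hm.enorm
  set κ : ℝ≥0∞ := ∫⁻ z : Space d,
    ENNReal.ofReal (Real.exp (-‖z‖)) * ENNReal.ofReal (Real.exp (-(c * ‖z‖ ^ 2))) with hκ
  set I : ℝ≥0∞ := ∫⁻ z : Space d, ENNReal.ofReal (Real.exp (-‖z‖)) with hI
  have hI' : I ≠ ⊤ := lintegral_exp_neg_norm_ne_top
  have hκ0 : κ ≠ 0 := by
    rw [hκ, ← pos_iff_ne_zero, lintegral_pos_iff_support (by fun_prop)]
    have : (Function.support fun z : Space d =>
        ENNReal.ofReal (Real.exp (-‖z‖)) * ENNReal.ofReal (Real.exp (-(c * ‖z‖ ^ 2)))) = univ := by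
      ext z
      simp [Real.exp_pos]
    rw [this]
    exact Measure.measure_univ_pos.2 (NeZero.ne _)
  have hκt : κ ≠ ⊤ := by
    refine ne_top_of_le_ne_top hI' (lintegral_mono fun z => ?_)
    refine mul_le_of_le_one_right zero_le ?_
    rw [ENNReal.ofReal_le_one, Real.exp_le_one_iff, neg_nonpos]
    positivity
  -- By the triangle inequality, the convolution of e^{-|·|} with the Gaussian dominates a multiple
  -- of e^{-|·|}. Averaging the Gaussian bounds over z then gives the exponential one.
  have key : ∀ x y : Space d, κ * ENNReal.ofReal (Real.exp (-‖x - y‖)) ≤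
      ∫⁻ z, ENNReal.ofReal (Real.exp (-‖x - z‖)) *
        ENNReal.ofReal (Real.exp (-(c * ‖z - y‖ ^ 2))) := by
    intro x y
    rw [← lintegral_add_right_eq_self _ y, hκ, ← lintegral_mul_const _ (by fun_prop)]
    refine lintegral_mono fun z => ?_
    rw [add_sub_cancel_right, mul_right_comm]
    gcongr
    rw [← ENNReal.ofReal_mul (Real.exp_pos _).le, ← Real.exp_add]
    apply ENNReal.ofReal_le_ofReal (Real.exp_le_exp.2 _)
    have : ‖x - (z + y)‖ ≤ ‖z‖ + ‖x - y‖ := by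
      rw [show x - (z + y) = (x - y) - z by abel, add_comm]; exact norm_sub_le _ _
    linarith
  refine ⟨κ⁻¹ * (I * M), ENNReal.mul_ne_top (ENNReal.inv_ne_top.2 hκ0)
    (ENNReal.mul_ne_top hI' hM), fun x => ?_⟩
  rw [← ENNReal.mul_le_iff_le_inv hκ0 hκt, ← lintegral_const_mul' _ _ hκt]
  calc _ ≤ ∫⁻ p in s ×ˢ univ, ∫⁻ z, ENNReal.ofReal (Real.exp (-‖x - z‖)) *
        (ENNReal.ofReal (Real.exp (-(c * ‖z - p.2‖ ^ 2))) * ‖h p‖ₑ) := by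
        refine lintegral_mono fun p => ?_
        rw [← mul_assoc]
        refine (mul_le_mul_left (key x p.2) ‖h p‖ₑ).trans ?_
        rw [← lintegral_mul_const _ (by fun_prop)]
        simp only [mul_assoc]
        exact le_rfl
    _ = ∫⁻ z, ENNReal.ofReal (Real.exp (-‖x - z‖)) * ∫⁻ p in s ×ˢ univ,
        ENNReal.ofReal (Real.exp (-(c * ‖z - p.2‖ ^ 2))) * ‖h p‖ₑ := by
        rw [lintegral_lintegral_swap]
        · congr 1; ext z
          rw [lintegral_const_mul _ (by fun_prop)]
        · apply Measurable.aemeasurable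
          unfold Function.uncurry
          have : Measurable (fun q : (ℝ × Space d) × Space d => ‖h q.1‖ₑ) :=
            hm'.comp measurable_fst
          fun_prop
    _ ≤ ∫⁻ z, ENNReal.ofReal (Real.exp (-‖x - z‖)) * M := by
        gcongr with z
        exact H z
    _ = _ := by
        rw [lintegral_mul_const _ (by fun_prop), lintegral_exp_neg_norm_sub]

lemma IsKato.uli (hb : StronglyMeasurable (Function.uncurry (zeroExt b)))
    (hk : IsKato 1 (fun t x => ‖b t x‖)) :
    ∃ M : ℝ≥0∞, M ≠ ⊤ ∧ ∀ x : Space d, ∫⁻ p in Ioc 0 1 ×ˢ univ,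
      ENNReal.ofReal (Real.exp (-‖x - p.2‖)) * ‖Function.uncurry (zeroExt b) p‖ₑ ≤ M := by
  obtain ⟨h1, h2⟩ := hk.2 1 one_pos
  have e1 := h1.eventually_le_const zero_lt_one
  have e2 := h2.eventually_le_const zero_lt_one
  have e3 : ∀ᶠ S : ℝ in 𝓝[>] 0, S ∈ Ioc (0 : ℝ) 1 := Ioc_mem_nhdsGT one_pos
  obtain ⟨S, hF, hB, hS0, hS1⟩ := (e1.and (e2.and e3)).exists
  -- With j ≥ 2/S the windows reach S/4 + jS/2 ≥ 1 and cover (0,1].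
  obtain ⟨j, hj⟩ := exists_nat_ge (2 / S)
  have hm := hb.enorm
  refine lintegral_exp_le_of_gauss hb (c := 2 / S) (M := 1 + j) (by positivity)
    (by finiteness) fun z => ?_
  rw [setLIntegral_strip (by fun_prop)]
  refine le_trans (lintegral_mono_set (Ioc_subset_Ioc_right ?_))
    (lintegral_gaussMass_le hS0 hS1 hF hB z j)
  rw [div_le_iff₀ hS0] at hj
  linarith

lemma IsKato.tendsto_kN (hb : StronglyMeasurable (Function.uncurry (zeroExt b)))
    (hk : IsKato 1 (fun t x => ‖b t x‖)) :
    Tendsto (kN (Function.uncurry (zeroExt b))) (𝓝[>] 0) (𝓝 0) := by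
  rw [← katoForward_eq_kN hb]
  exact (hk.2 (1 / 2) (by norm_num)).1

lemma IsKato.good (hb : StronglyMeasurable (Function.uncurry (zeroExt b)))
    (hk : IsKato 1 (fun t x => ‖b t x‖)) {T : ℝ} (hT : T ≤ 1)
    (hfin : kN (Function.uncurry (zeroExt b)) T ≠ ⊤) :
    Good T (Function.uncurry (zeroExt b)) where
  sm := hb
  fin := hfin
  tend := hk.tendsto_kN hb
  uli := by
    obtain ⟨M, hM, h⟩ := hk.uli hb
    exact ⟨M, hM, fun x => (lintegral_mono_set
      (prod_mono (Ioc_subset_Ioc_right hT) le_rfl)).trans (h x)⟩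

end

end KatoPDE
end


/-! ### Mollified coefficients: smoothness, boundedness, local convergence in L¹. -/

open Set Filter Topology MeasureTheory
open scoped ENNReal NNReal BoundedContinuousFunction

noncomputable section

namespace KatoPDE

variable {d : ℕ} {F : Type*} [NormedAddCommGroup F] [NormedSpace ℝ F]

/-- Mollification kernels supported at positive times within distance `δ` of the origin. -/
structure IsMollKer (δ : ℝ) (ψ : ℝ × Space d → ℝ) : Prop where
  contDiff : ContDiff ℝ 1 ψ
  compact : HasCompactSupport ψ
  supp : ∀ p, ψ p ≠ 0 → 0 < p.1 ∧ ‖p‖ ≤ δ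
  lint : ∫⁻ p, ‖ψ p‖ₑ = 1
  int : ∫ p, ψ p = 1

lemma IsMollifier.scaled {φ : ℝ × Space d → ℝ} (hφ : IsMollifier φ) (n : ℕ) :
    IsMollKer ((1 / 2) ^ n) (scaled φ n) := by
  have h2 : (0 : ℝ) < 2 ^ n := by positivity
  have hint : ∫ p, KatoPDE.scaled φ n p = 1 := by
    unfold KatoPDE.scaled
    rw [integral_const_mul, Measure.integral_comp_smul, hφ.integral_eq_one, smul_eq_mul, mul_one,
      abs_of_pos (by positivity)]
    have : Module.finrank ℝ (ℝ × Space d) = d + 1 := by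
      simp [Module.finrank_prod, add_comm]
    rw [this, ← pow_mul, mul_add, mul_one]
    exact mul_inv_cancel₀ (by positivity)
  have hnn : ∀ p, 0 ≤ KatoPDE.scaled φ n p := fun p =>
    mul_nonneg (by positivity) (hφ.nonneg _)
  refine ⟨?_, ?_, ?_, ?_, hint⟩
  · have := hφ.contDiff.of_le (m := 1) (by norm_cast)
    unfold KatoPDE.scaled
    fun_prop
  · exact (hφ.hasCompactSupport.comp_smul h2.ne').mul_left
  · intro p hp
    have h3 : (2 : ℝ) ^ n • p ∈ tsupport φ := subset_tsupport _ (right_ne_zero_of_mul hp)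
    obtain ⟨⟨h4, h5⟩, h6⟩ := hφ.tsupport_subset h3
    rw [mem_ball_zero_iff] at h6
    simp only [Prod.smul_fst, Prod.smul_snd, smul_eq_mul, norm_smul, norm_pow, Real.norm_ofNat]
      at h4 h5 h6
    have h7 : 0 < p.1 := pos_of_mul_pos_right h4 h2.le
    refine ⟨h7, ?_⟩
    rw [one_div, inv_pow, Prod.norm_def, Real.norm_of_nonneg h7.le]
    refine max_le ?_ ?_
    · rw [← one_div, le_div_iff₀ h2]; linarith
    · rw [← one_div, le_div_iff₀ h2]; linarith
  · have : Integrable (KatoPDE.scaled φ n) := by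
      by_contra h
      rw [integral_undef h] at hint
      exact zero_ne_one hint
    have h3 := ofReal_integral_eq_lintegral_ofReal this (ae_of_all _ hnn)
    rw [hint, ENNReal.ofReal_one] at h3
    rw [h3]
    congr 1; ext p
    exact Real.enorm_eq_ofReal (hnn p)

/-- Restriction of a space-time function to times in `(0, 1]`. -/
def trunc (h : ℝ × Space d → F) : ℝ × Space d → F := indicator (Ioc 0 1 ×ˢ univ) h

lemma trunc_of_mem {h : ℝ × Space d → F} {p : ℝ × Space d} (hp : p.1 ∈ Ioc (0 : ℝ) 1) :
    trunc h p = h p := indicator_of_mem (s := Ioc 0 1 ×ˢ univ) ⟨hp, mem_univ _⟩ h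

lemma enorm_trunc_le (h : ℝ × Space d → F) (p : ℝ × Space d) : ‖trunc h p‖ₑ ≤ ‖h p‖ₑ := by
  unfold trunc
  exact enorm_indicator_le_enorm_self _ _

lemma trunc_sm {h : ℝ × Space d → F} (hm : StronglyMeasurable h) : StronglyMeasurable (trunc h) :=
  hm.indicator (measurableSet_strip measurableSet_Ioc)

lemma kN_trunc_le {h : ℝ × Space d → F} (hm : StronglyMeasurable h) (T : ℝ) :
    kN (trunc h) T ≤ kN h T := by
  have := kN_le_add (h := trunc h) (g₁ := h) (g₂ := h) hm (c₁ := 1) (c₂ := 0)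
    (fun p => by simpa using enorm_trunc_le h p) T
  simpa using this

/-- The mollifier lives at positive times, so a mollification at time at most 1 only uses earlier
values. Truncation changes nothing there, and it allows bounds on all of space-time. -/
lemma moll_trunc {δ : ℝ} {ψ : ℝ × Space d → ℝ} (hψ : IsMollKer δ ψ) {h : ℝ × Space d → F}
    (h0 : ∀ p : ℝ × Space d, p.1 ≤ 0 → h p = 0) {X : ℝ × Space d} (hX : X.1 ≤ 1) :
    moll ψ (trunc h) X = moll ψ h X := by
  unfold moll
  congr 1; ext1 p
  by_cases hp : ψ (X - p) = 0
  · rw [hp, zero_smul, zero_smul]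
  · have h1 := (hψ.supp _ hp).1
    simp only [Prod.fst_sub] at h1
    rcases le_or_gt p.1 0 with h2 | h2
    · rw [h0 p h2, trunc, indicator_of_notMem]
      rintro ⟨⟨h3, -⟩, -⟩
      exact absurd h3 (not_lt.2 h2)
    · rw [trunc_of_mem ⟨h2, by linarith⟩]

/-- Uniform local integrability of a space-time function supported in times `(0, 1]`. -/
structure UnifLoc (β : ℝ × Space d → F) (M : ℝ≥0∞) : Prop where
  sm : StronglyMeasurable β
  ne_top : M ≠ ⊤
  near : ∀ x : Space d, ∫⁻ p in {p : ℝ × Space d | ‖x - p.2‖ ≤ 2}, ‖β p‖ₑ ≤ M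

lemma measurableSet_near (x : Space d) (r : ℝ) :
    MeasurableSet {p : ℝ × Space d | ‖x - p.2‖ ≤ r} :=
  measurableSet_le (by fun_prop) measurable_const

/-- On |x-y| ≤ 2 the exponential weight is at least e^{-2}. The radius 2 leaves room for a mollifier
of radius 1 whose centre moves by less than 1. -/
lemma unifLoc_trunc {h : ℝ × Space d → F} (hm : StronglyMeasurable h) {M : ℝ≥0∞} (hM : M ≠ ⊤)
    (H : ∀ x : Space d, ∫⁻ p in Ioc 0 1 ×ˢ univ,
      ENNReal.ofReal (Real.exp (-‖x - p.2‖)) * ‖h p‖ₑ ≤ M) :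
    UnifLoc (trunc h) (ENNReal.ofReal (Real.exp 2) * M) where
  sm := trunc_sm hm
  ne_top := ENNReal.mul_ne_top ENNReal.ofReal_ne_top hM
  near x := by
    refine le_trans ?_ (mul_le_mul_right (H x) _)
    rw [← lintegral_const_mul' _ _ ENNReal.ofReal_ne_top,
      ← lintegral_indicator (measurableSet_near x 2),
      ← lintegral_indicator (measurableSet_strip measurableSet_Ioc)]
    refine lintegral_mono fun p => ?_
    by_cases hp : p ∈ Ioc (0 : ℝ) 1 ×ˢ (univ : Set (Space d))
    · by_cases hp2 : p ∈ {p : ℝ × Space d | ‖x - p.2‖ ≤ 2}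
      · rw [indicator_of_mem hp, indicator_of_mem hp2, trunc, indicator_of_mem hp, ← mul_assoc,
          ← ENNReal.ofReal_mul (Real.exp_pos _).le, ← Real.exp_add]
        refine le_mul_of_one_le_left zero_le ?_
        rw [ENNReal.one_le_ofReal]
        apply Real.one_le_exp
        have : ‖x - p.2‖ ≤ 2 := hp2
        linarith
      · rw [indicator_of_notMem hp2]; exact zero_le
    · have : ({p : ℝ × Space d | ‖x - p.2‖ ≤ 2}.indicator (fun p => ‖trunc h p‖ₑ)) p = 0 := by
        rw [indicator_apply]
        split_ifs
        · rw [trunc, indicator_of_notMem hp, enorm_zero]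
        · rfl
      rw [this]; exact zero_le

section

variable {β : ℝ × Space d → F} {M : ℝ≥0∞} {δ : ℝ} {ψ : ℝ × Space d → ℝ}

lemma UnifLoc.integrableOn (hβ : UnifLoc β M) (x : Space d) :
    IntegrableOn β {p : ℝ × Space d | ‖x - p.2‖ ≤ 2} :=
  ⟨hβ.sm.aestronglyMeasurable, lt_of_le_of_lt (hβ.near x) (lt_top_iff_ne_top.2 hβ.ne_top)⟩

lemma UnifLoc.locallyIntegrable (hβ : UnifLoc β M) : LocallyIntegrable β := by
  intro X
  refine ⟨_, ?_, hβ.integrableOn X.2⟩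
  have h2 : Tendsto (fun p : ℝ × Space d => ‖X.2 - p.2‖) (𝓝 X) (𝓝 ‖X.2 - X.2‖) :=
    Continuous.tendsto (f := fun p : ℝ × Space d => ‖X.2 - p.2‖) (by fun_prop) X
  rw [sub_self, norm_zero] at h2
  exact h2.eventually_le_const two_pos

lemma integrable_moll (hβ : LocallyIntegrable β) (hψ : IsMollKer δ ψ) (X : ℝ × Space d) :
    Integrable (fun p => ψ (X - p) • β p) :=
  HasCompactSupport.convolutionExists_right (ContinuousLinearMap.lsmul ℝ ℝ).flip
    hψ.compact hβ hψ.contDiff.continuous X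

lemma UnifLoc.contDiff_moll (hβ : UnifLoc β M) (hψ : IsMollKer δ ψ) :
    ContDiff ℝ 1 (moll ψ β) :=
  HasCompactSupport.contDiff_convolution_right (ContinuousLinearMap.lsmul ℝ ℝ).flip
    hψ.compact hβ.locallyIntegrable hψ.contDiff

lemma UnifLoc.lintegral_near_le (hβ : UnifLoc β M) (x : Space d) (c : ℝ≥0) :
    ∫⁻ p, indicator {p : ℝ × Space d | ‖x - p.2‖ ≤ 2} (fun p => c * ‖β p‖ₑ) p ≤ c * M := by
  rw [lintegral_indicator (measurableSet_near x 2), lintegral_const_mul' _ _ ENNReal.coe_ne_top]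
  gcongr
  exact hβ.near x

lemma IsMollKer.eq_zero (hψ : IsMollKer δ ψ) (hδ : δ ≤ 1) {p : ℝ × Space d} (hp : 1 < ‖p.2‖) :
    ψ p = 0 := by
  by_contra h
  have h1 := (hψ.supp p h).2
  have h2 := norm_snd_le p
  linarith

lemma UnifLoc.moll_bounded (hβ : UnifLoc β M) (hψ : IsMollKer δ ψ) (hδ : δ ≤ 1) :
    ∃ c : ℝ≥0, ∀ X, ‖moll ψ β X‖ₑ ≤ c := by
  obtain ⟨C, hC⟩ := hψ.contDiff.continuous.bounded_above_of_compact_support hψ.compact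
  have hC0 : 0 ≤ C := (norm_nonneg _).trans (hC 0)
  lift C to ℝ≥0 using hC0
  have hfin : C * M ≠ ⊤ := ENNReal.mul_ne_top ENNReal.coe_ne_top hβ.ne_top
  refine ⟨(C * M).toNNReal, fun X => ?_⟩
  rw [ENNReal.coe_toNNReal hfin]
  refine (enorm_integral_le_lintegral_enorm _).trans
    (le_trans (lintegral_mono fun p => ?_) (hβ.lintegral_near_le X.2 C))
  by_cases hp : p ∈ {p : ℝ × Space d | ‖X.2 - p.2‖ ≤ 2}
  · rw [indicator_of_mem hp, enorm_smul]
    gcongr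
    rw [enorm_le_coe]
    exact hC _
  · have h1 : 1 < ‖(X - p).2‖ := by
      simp only [mem_ofPred_eq, not_le] at hp
      simp only [Prod.snd_sub]; linarith
    rw [hψ.eq_zero hδ h1]; simp

/-- The kernel is Lipschitz, and for Y within 1 of X both translated kernels are supported over the
ball of radius 2 around X, where β has mass at most M. -/
lemma UnifLoc.fderiv_moll_bounded (hβ : UnifLoc β M) (hψ : IsMollKer δ ψ) (hδ : δ ≤ 1) :
    ∃ c : ℝ, ∀ X, ‖fderiv ℝ (moll ψ β) X‖ ≤ c := by
  obtain ⟨L, hL⟩ := hψ.contDiff.lipschitzWith_of_hasCompactSupport hψ.compact one_ne_zero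
  refine ⟨L * M.toReal, fun X => ?_⟩
  refine norm_fderiv_le_of_lip' ℝ (by positivity) ?_
  filter_upwards [Metric.ball_mem_nhds X one_pos] with Y hY
  have e : moll ψ β Y - moll ψ β X = ∫ p, (ψ (Y - p) - ψ (X - p)) • β p := by
    unfold moll
    rw [← integral_sub (integrable_moll hβ.locallyIntegrable hψ Y)
      (integrable_moll hβ.locallyIntegrable hψ X)]
    simp only [sub_smul]
  have h1 : ‖moll ψ β Y - moll ψ β X‖ₑ ≤ (L * ‖Y - X‖₊ : ℝ≥0) * M := by
    rw [e]
    refine (enorm_integral_le_lintegral_enorm _).trans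
      (le_trans (lintegral_mono fun p => ?_) (hβ.lintegral_near_le X.2 _))
    by_cases hp : p ∈ {p : ℝ × Space d | ‖X.2 - p.2‖ ≤ 2}
    · rw [indicator_of_mem hp, enorm_smul]
      gcongr
      rw [enorm_le_coe, ← NNReal.coe_le_coe]
      push_cast
      have := hL.norm_sub_le (Y - p) (X - p)
      rwa [sub_sub_sub_cancel_right] at this
    · simp only [mem_ofPred_eq, not_le] at hp
      have h2 : 1 < ‖(X - p).2‖ := by
        simp only [Prod.snd_sub]; linarith
      have h3 : 1 < ‖(Y - p).2‖ := by
        have h4 : ‖(Y - X).2‖ < 1 := (norm_snd_le _).trans_lt (mem_ball_iff_norm.1 hY)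
        have h5 : ‖X.2 - p.2‖ ≤ ‖X.2 - Y.2‖ + ‖Y.2 - p.2‖ :=
          norm_sub_le_norm_sub_add_norm_sub _ _ _
        rw [norm_sub_rev X.2 Y.2] at h5
        simp only [Prod.snd_sub] at h4 ⊢
        linarith
      rw [hψ.eq_zero hδ h2, hψ.eq_zero hδ h3]; simp
  have h2 := ENNReal.toReal_mono (ENNReal.mul_ne_top ENNReal.coe_ne_top hβ.ne_top) h1
  rw [toReal_enorm, ENNReal.toReal_mul, ENNReal.coe_toReal] at h2
  push_cast at h2
  linarith

end

/-- Continuity of translation in `L¹`. -/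
lemma tendsto_lintegral_translate {β : ℝ × Space d → F} (hβ : Integrable β) :
    Tendsto (fun r => ∫⁻ X, ‖β (X - r) - β X‖ₑ) (𝓝 0) (𝓝 0) := by
  -- Translations form a continuous family of measure-preserving maps, and composition with such a
  -- family is continuous in L¹.
  let g : C(ℝ × Space d, C(ℝ × Space d, ℝ × Space d)) :=
    ContinuousMap.curry ⟨fun q : (ℝ × Space d) × (ℝ × Space d) => q.2 - q.1, by fun_prop⟩
  have hg : ∀ r X, g r X = X - r := fun _ _ => rfl
  have hgm : ∀ r, MeasurePreserving (g r) (volume : Measure (ℝ × Space d)) volume := fun r =>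
    measurePreserving_sub_right volume r
  have hL : MemLp β 1 volume := memLp_one_iff_integrable.2 hβ
  have h1 := Filter.Tendsto.compMeasurePreservingLp (p := 1) (tendsto_const_nhds (x := hL.toLp β))
    (g.continuous.tendsto 0) hgm (hgm 0) (by simp)
  have h2 := tendsto_iff_edist_tendsto_0.1 h1
  refine h2.congr fun r => ?_
  rw [Lp.edist_def, eLpNorm_one_eq_lintegral_enorm]
  refine lintegral_congr_ae ?_
  have e1 := Lp.coeFn_compMeasurePreserving (hL.toLp β) (hgm r)
  have e2 := Lp.coeFn_compMeasurePreserving (hL.toLp β) (hgm 0)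
  have e3 := hL.coeFn_toLp
  have e4 := (hgm r).quasiMeasurePreserving.ae_eq_comp e3
  have e5 := (hgm 0).quasiMeasurePreserving.ae_eq_comp e3
  filter_upwards [e1, e2, e4, e5] with X h1 h2 h4 h5
  rw [Pi.sub_apply, h1, h2, h4, h5]
  simp [hg]

/-- As the kernel has integral 1, the error is the ψ-average of the increments β(X - r) - β(X);
Tonelli then exchanges the integrals. -/
lemma lintegral_moll_sub_le {β : ℝ × Space d → F} (hm : StronglyMeasurable β)
    (hβ : Integrable β) {δ : ℝ} {ψ : ℝ × Space d → ℝ} (hψ : IsMollKer δ ψ) [CompleteSpace F] :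
    ∫⁻ X, ‖moll ψ β X - β X‖ₑ ≤ ∫⁻ r, ‖ψ r‖ₑ * ∫⁻ X, ‖β (X - r) - β X‖ₑ := by
  have hψi : Integrable ψ := hψ.contDiff.continuous.integrable_of_hasCompactSupport hψ.compact
  have e : ∀ X, moll ψ β X - β X = ∫ r, ψ r • (β (X - r) - β X) := by
    intro X
    have h1 : moll ψ β X = ∫ r, ψ r • β (X - r) := by
      unfold moll
      rw [← integral_sub_left_eq_self _ volume X]
      simp
    have h2 : Integrable (fun r => ψ r • β (X - r)) := by
      have := (integrable_moll hβ.locallyIntegrable hψ X).comp_sub_left X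
      simpa using this
    simp only [smul_sub]
    rw [integral_sub h2 (hψi.smul_const _), integral_smul_const, hψ.int, one_smul, h1]
  have hm1 : Measurable (fun q : (ℝ × Space d) × (ℝ × Space d) => ‖ψ q.2‖ₑ) :=
    hψ.contDiff.continuous.measurable.enorm.comp measurable_snd
  have hm2 : Measurable (fun q : (ℝ × Space d) × (ℝ × Space d) => ‖β (q.1 - q.2) - β q.1‖ₑ) :=
    ((hm.comp_measurable (measurable_fst.sub measurable_snd)).sub
      (hm.comp_measurable measurable_fst)).enorm
  calc _ ≤ ∫⁻ X, ∫⁻ r, ‖ψ r‖ₑ * ‖β (X - r) - β X‖ₑ := by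
        refine lintegral_mono fun X => ?_
        rw [e X]
        refine (enorm_integral_le_lintegral_enorm _).trans (le_of_eq ?_)
        simp only [enorm_smul]
    _ = _ := by
        rw [lintegral_lintegral_swap (hm1.mul hm2).aemeasurable]
        congr 1; ext r
        rw [lintegral_const_mul' _ _ enorm_ne_top]

lemma tendsto_lintegral_moll_sub {β : ℝ × Space d → F} (hm : StronglyMeasurable β)
    (hβ : Integrable β) [CompleteSpace F] {ψ : ℕ → ℝ × Space d → ℝ}
    (hψ : ∀ n, IsMollKer ((1 / 2) ^ n) (ψ n)) :
    Tendsto (fun n => ∫⁻ X, ‖moll (ψ n) β X - β X‖ₑ) atTop (𝓝 0) := by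
  rw [ENNReal.tendsto_nhds_zero]
  intro ε hε
  have h1 := (tendsto_lintegral_translate hβ).eventually_le_const hε
  obtain ⟨ρ, hρ, h2⟩ := Metric.eventually_nhds_iff.1 h1
  have h3 : ∀ᶠ n : ℕ in atTop, ((1 / 2 : ℝ)) ^ n < ρ :=
    (tendsto_pow_atTop_nhds_zero_of_lt_one (by norm_num) (by norm_num)).eventually_lt_const hρ
  filter_upwards [h3] with n hn
  refine (lintegral_moll_sub_le hm hβ (hψ n)).trans ?_
  calc _ ≤ ∫⁻ r, ‖ψ n r‖ₑ * ε := by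
        refine lintegral_mono fun r => ?_
        by_cases hr : ψ n r = 0
        · simp [hr]
        · gcongr
          refine h2 ?_
          rw [dist_zero_right]
          exact ((hψ n).supp r hr).2.trans_lt hn
    _ = ε := by
        rw [lintegral_mul_const _ (hψ n).contDiff.continuous.measurable.enorm, (hψ n).lint, one_mul]

/-- Cutting β off at |y| ≤ R + 1 makes it integrable without affecting mollifications of radius at
most 1 on |x| ≤ R. -/
lemma UnifLoc.tendsto_moll {β : ℝ × Space d → F} {M : ℝ≥0∞} (hβ : UnifLoc β M)
    (hβ0 : ∀ p : ℝ × Space d, p.1 ∉ Ioc (0 : ℝ) 1 → β p = 0) [CompleteSpace F]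
    {ψ : ℕ → ℝ × Space d → ℝ} (hψ : ∀ n, IsMollKer ((1 / 2) ^ n) (ψ n)) (R : ℝ) :
    Tendsto (fun n => ∫⁻ X in {p : ℝ × Space d | ‖p.2‖ ≤ R}, ‖moll (ψ n) β X - β X‖ₑ)
      atTop (𝓝 0) := by
  have hms := measurableSet_near (0 : Space d) (R + 1)
  simp only [zero_sub, norm_neg] at hms
  set γ : ℝ × Space d → F := indicator {p : ℝ × Space d | ‖p.2‖ ≤ R + 1} β with hγ
  have hγm : StronglyMeasurable γ := hβ.sm.indicator hms
  have hγi : Integrable γ := by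
    rw [hγ, integrable_indicator_iff hms]
    have hc : IsCompact (Icc (0 : ℝ) 1 ×ˢ Metric.closedBall (0 : Space d) (R + 1)) :=
      isCompact_Icc.prod (isCompact_closedBall _ _)
    have h1 := hβ.locallyIntegrable.integrableOn_isCompact hc
    refine h1.of_forall_sdiff_eq_zero hms ?_
    rintro p ⟨hp1, hp2⟩
    apply hβ0
    intro hp3
    refine hp2 ⟨⟨hp3.1.le, hp3.2⟩, ?_⟩
    rw [mem_closedBall_zero_iff]
    exact hp1
  refine tendsto_of_tendsto_of_tendsto_of_le_of_le tendsto_const_nhds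
    (tendsto_lintegral_moll_sub hγm hγi hψ) (fun _ => zero_le) fun n => ?_
  refine le_trans ?_ (setLIntegral_le_lintegral {p : ℝ × Space d | ‖p.2‖ ≤ R} _)
  have hms' := measurableSet_near (0 : Space d) R
  simp only [zero_sub, norm_neg] at hms'
  refine le_of_eq (setLIntegral_congr_fun hms' fun X hX => ?_)
  have hX' : ‖X.2‖ ≤ R := hX
  have e1 : γ X = β X := indicator_of_mem (by simp only [mem_ofPred_eq]; linarith) _
  have e2 : moll (ψ n) γ X = moll (ψ n) β X := by
    unfold moll
    congr 1; ext1 p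
    by_cases hp : ψ n (X - p) = 0
    · rw [hp, zero_smul, zero_smul]
    · have h1 := ((hψ n).supp _ hp).2
      have h2 : ‖(X - p).2‖ ≤ 1 :=
        (norm_snd_le _).trans (h1.trans (pow_le_one₀ (by norm_num) (by norm_num)))
      have h3 : ‖p.2‖ ≤ ‖X.2‖ + ‖(X - p).2‖ := by
        have : p.2 = X.2 - (X - p).2 := by simp
        nth_rewrite 1 [this]
        exact norm_sub_le _ _
      rw [hγ, indicator_of_mem (by simp only [mem_ofPred_eq]; linarith)]
  simp only [e1, e2]

end KatoPDE
end


/-! ### Stability of solutions in an exponentially weighted norm. -/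

open Set Filter Topology MeasureTheory
open scoped ENNReal NNReal BoundedContinuousFunction

noncomputable section

namespace KatoPDE

variable {d : ℕ} {F F' F₁ : Type*} [NormedAddCommGroup F] [NormedSpace ℝ F]
  [NormedAddCommGroup F'] [NormedSpace ℝ F'] [NormedAddCommGroup F₁]

lemma CE_eq : (CE : ℝ≥0∞) = ENNReal.ofReal (Real.exp 4) := by
  rw [ENNReal.ofReal_eq_coe_nnreal (Real.exp_pos _).le]; rfl

/-- The part of a potential with densities far from the origin. -/
lemma IsKer.lintegral_far_le {k : ℝ → Space d → F →L[ℝ] F'} (hk : IsKer k) {T t : ℝ} (ht : 0 ≤ t)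
    (hT : T ≤ 1) (g : ℝ × Space d → F) (R : ℝ) (x : Space d) :
    ∫⁻ p in Ioc t T ×ˢ univ, (if R < ‖p.2‖ then ‖k (p.1 - t) (x - p.2) (g p)‖ₑ else 0)
      ≤ CE * ENNReal.ofReal (Real.exp (‖x‖ - R)) * kN g T := by
  -- The weight e^{|y|-R} is at least 1 on the far region.
  have h := hk.lintegral_le_weight (g := fun p => if R < ‖p.2‖ then g p else 0) (b := g)
    (W := fun y => ENNReal.ofReal (Real.exp (‖y‖ - R))) ht hT x ?_ ?_ ENNReal.ofReal_ne_top
  · refine le_trans (le_of_eq ?_) h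
    congr 1; ext p
    split_ifs <;> simp
  · intro p _
    split_ifs with hp
    · refine le_mul_of_one_le_left zero_le ?_
      rw [ENNReal.one_le_ofReal]
      exact Real.one_le_exp (by linarith)
    · simp
  · intro y
    rw [← ENNReal.ofReal_mul (Real.exp_pos _).le, ← Real.exp_add]
    apply ENNReal.ofReal_le_ofReal (Real.exp_le_exp.2 _)
    have : ‖y‖ ≤ ‖x‖ + ‖x - y‖ := by
      have e : y = x - (x - y) := by simp
      nth_rewrite 1 [e]
      exact norm_sub_le _ _
    linarith

/-- Once time is kept δ away from the singularity the kernel is bounded, and the local L¹ norm of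
the density suffices. -/
lemma IsKer.lintegral_core_le {k : ℝ → Space d → F →L[ℝ] F'} (hk : IsKer k) {T t : ℝ} (ht : 0 ≤ t)
    (hT : T ≤ 1) (g : ℝ × Space d → F) {δ : ℝ} (hδ : 0 < δ) (R : ℝ) (x : Space d) :
    ∫⁻ p in Ioc t T ×ˢ univ, (if δ ≤ p.1 - t ∧ ‖p.2‖ ≤ R then
        ‖k (p.1 - t) (x - p.2) (g p)‖ₑ else 0)
      ≤ ENNReal.ofReal (cutBound d δ) *
        ∫⁻ p in Ioc 0 T ×ˢ univ, (if ‖p.2‖ ≤ R then ‖g p‖ₑ else 0) := by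
  rw [← lintegral_const_mul' _ _ ENNReal.ofReal_ne_top]
  refine le_trans (setLIntegral_mono' (measurableSet_strip measurableSet_Ioc) fun p hp => ?_)
    (lintegral_mono_set (Set.prod_mono (Ioc_subset_Ioc_left ht) le_rfl))
  by_cases h1 : ‖p.2‖ ≤ R
  · by_cases h2 : δ ≤ p.1 - t
    · rw [if_pos ⟨h2, h1⟩, if_pos h1]
      have h3 : 0 < p.1 - t := hδ.trans_le h2
      refine (hk.enorm_le h3 (by linarith [hp.1.2]) _ _).trans ?_
      gcongr
      rw [CE_eq, ← ENNReal.ofReal_mul (Real.exp_pos _).le, ← ENNReal.ofReal_mul (mul_nonneg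
        (Real.exp_pos _).le (kap_nonneg h3 _))]
      apply ENNReal.ofReal_le_ofReal
      calc Real.exp 4 * kap (p.1 - t) (x - p.2) * Real.exp (-‖x - p.2‖)
          ≤ Real.exp 4 * kap (p.1 - t) (x - p.2) * 1 := by
            have := kap_nonneg h3 (x - p.2)
            gcongr
            rw [Real.exp_le_one_iff]; simp
        _ ≤ _ := by
            rw [mul_one, cutBound]
            gcongr
            exact kap_le hδ h2 _
    · rw [if_neg (fun h => h2 h.1)]; exact zero_le
  · rw [if_neg (fun h => h1 h.2)]; exact zero_le

/-- Potentials of densities which are uniformly of Kato type and vanish locally in `L¹`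
vanish in the weighted supremum norm. -/
lemma IsKer.eventually_Iop_le {k : ℝ → Space d → F →L[ℝ] F'} (hk : IsKer k) {T : ℝ}
    (hT : T ≤ 1) {g : ℕ → ℝ × Space d → F} (hm : ∀ n, StronglyMeasurable (g n)) {N : ℝ → ℝ≥0∞}
    (hg : ∀ n S, 0 < S → kN (g n) S ≤ N S) (hNT : N T ≠ ⊤) (hT0 : 0 < T)
    (hN : Tendsto N (𝓝[>] 0) (𝓝 0))
    (hloc : ∀ R : ℝ, Tendsto (fun n => ∫⁻ p in Ioc 0 T ×ˢ univ,
      (if ‖p.2‖ ≤ R then ‖g n p‖ₑ else 0)) atTop (𝓝 0)) {ε : ℝ≥0∞} (hε : 0 < ε) :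
    ∀ᶠ n in atTop, ∀ t ∈ Icc 0 T, ∀ x : Space d,
      ENNReal.ofReal (Real.exp (-‖x‖)) * ‖Iop k T (g n) t x‖ₑ ≤ ε := by
  have hε3 : 0 < ε / 3 := ENNReal.div_pos hε.ne' (by norm_num)
  have h1 : Tendsto (fun S => CE * N S) (𝓝[>] 0) (𝓝 0) := by
    simpa using ENNReal.Tendsto.const_mul (a := CE) hN (Or.inr ENNReal.coe_ne_top)
  -- Order of choices: δ for short times, then R for far points (the weight turns e^{|x|-R} into
  -- e^{-R}), then n for the remaining core. Each costs ε/3.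
  obtain ⟨δ, hδ1, hδ⟩ := ((h1.eventually_le_const hε3).and self_mem_nhdsWithin).exists
  have h2 : Tendsto (fun R : ℝ => ENNReal.ofReal (Real.exp (-R)) * (CE * N T)) atTop (𝓝 0) := by
    have : Tendsto (fun R : ℝ => ENNReal.ofReal (Real.exp (-R))) atTop (𝓝 0) := by
      have := ENNReal.tendsto_ofReal Real.tendsto_exp_neg_atTop_nhds_zero
      simpa using this
    have := ENNReal.Tendsto.mul_const (b := CE * N T) this
      (Or.inr (ENNReal.mul_ne_top ENNReal.coe_ne_top hNT))
    simpa using this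
  obtain ⟨R, hR⟩ := (h2.eventually_le_const hε3).exists
  have h3 : Tendsto (fun n => ENNReal.ofReal (cutBound d δ) * ∫⁻ p in Ioc 0 T ×ˢ univ,
      (if ‖p.2‖ ≤ R then ‖g n p‖ₑ else 0)) atTop (𝓝 0) := by
    simpa using ENNReal.Tendsto.const_mul (hloc R) (Or.inr ENNReal.ofReal_ne_top)
  filter_upwards [h3.eventually_le_const hε3] with n hn t ht x
  have hx1 : ENNReal.ofReal (Real.exp (-‖x‖)) ≤ 1 := by
    rw [ENNReal.ofReal_le_one, Real.exp_le_one_iff]; simp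
  have hcore := hk.lintegral_core_le ht.1 hT (g n) hδ R x
  have hfar := hk.lintegral_far_le ht.1 hT (g n) R x
  have hshort := hk.lintegral_short_le (δ := δ) ht.1 hT (g n) x
  have hmeas := (hk.aesm (hm n) t T x).enorm
  have hs1 : NullMeasurableSet {p : ℝ × Space d | p.1 - t < δ}
      (volume.restrict (Ioc t T ×ˢ univ)) :=
    (measurableSet_lt (by fun_prop) measurable_const).nullMeasurableSet
  have hs2 : NullMeasurableSet {p : ℝ × Space d | R < ‖p.2‖}
      (volume.restrict (Ioc t T ×ˢ univ)) :=
    (measurableSet_lt measurable_const (by fun_prop)).nullMeasurableSet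
  have hsplit : ‖Iop k T (g n) t x‖ₑ ≤
      (∫⁻ p in Ioc t T ×ˢ univ,
        (if p.1 - t < δ then ‖k (p.1 - t) (x - p.2) (g n p)‖ₑ else 0)) +
      ((∫⁻ p in Ioc t T ×ˢ univ, (if R < ‖p.2‖ then ‖k (p.1 - t) (x - p.2) (g n p)‖ₑ else 0)) +
      ∫⁻ p in Ioc t T ×ˢ univ, (if δ ≤ p.1 - t ∧ ‖p.2‖ ≤ R then
        ‖k (p.1 - t) (x - p.2) (g n p)‖ₑ else 0)) := by
    refine (enorm_integral_le_lintegral_enorm _).trans ?_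
    have hi1 : AEMeasurable (fun p : ℝ × Space d => if p.1 - t < δ then
        ‖k (p.1 - t) (x - p.2) (g n p)‖ₑ else 0) (volume.restrict (Ioc t T ×ˢ univ)) :=
      (hmeas.indicator₀ hs1).congr (ae_of_all _ fun p => by simp [indicator_apply])
    have hi2 : AEMeasurable (fun p : ℝ × Space d => if R < ‖p.2‖ then
        ‖k (p.1 - t) (x - p.2) (g n p)‖ₑ else 0) (volume.restrict (Ioc t T ×ˢ univ)) :=
      (hmeas.indicator₀ hs2).congr (ae_of_all _ fun p => by simp [indicator_apply])
    rw [← lintegral_add_left' hi2, ← lintegral_add_left' hi1]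
    refine lintegral_mono fun p => ?_
    by_cases h4 : p.1 - t < δ
    · simp [h4]
    · by_cases h5 : R < ‖p.2‖
      · simp [h4, h5]
      · simp [h4, h5, not_lt.1 h4, not_lt.1 h5]
  calc _ ≤ ENNReal.ofReal (Real.exp (-‖x‖)) * (CE * kN (g n) δ +
        (CE * ENNReal.ofReal (Real.exp (‖x‖ - R)) * kN (g n) T + ε / 3)) := by
        gcongr
        refine hsplit.trans ?_
        gcongr
        exact hcore.trans hn
    _ = ENNReal.ofReal (Real.exp (-‖x‖)) * (CE * kN (g n) δ) +
        (ENNReal.ofReal (Real.exp (-‖x‖)) * ENNReal.ofReal (Real.exp (‖x‖ - R)) *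
          (CE * kN (g n) T) + ENNReal.ofReal (Real.exp (-‖x‖)) * (ε / 3)) := by ring
    _ ≤ 1 * (CE * N δ) + (ENNReal.ofReal (Real.exp (-R)) * (CE * N T) + 1 * (ε / 3)) := by
        rw [← ENNReal.ofReal_mul (Real.exp_pos _).le, ← Real.exp_add,
          show -‖x‖ + (‖x‖ - R) = -R by ring]
        gcongr
        · exact hg n δ hδ
        · exact hg n T hT0
    _ ≤ ε / 3 + (ε / 3 + ε / 3) := by
        rw [one_mul, one_mul]; gcongr
    _ = ε := by rw [← add_assoc, ENNReal.add_thirds]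

/-- The weighted distance of two functions on the slab. -/
def wdist {T : ℝ} (V W : Slab d T →ᵇ F₁) : ℝ≥0∞ :=
  ⨆ X : Slab d T, ENNReal.ofReal (Real.exp (-‖X.2‖)) * ‖V X - W X‖ₑ

lemma wdist_ne_top {T : ℝ} (V W : Slab d T →ᵇ F₁) : wdist V W ≠ ⊤ := by
  refine ne_top_of_le_ne_top (b := ‖V - W‖ₑ) enorm_ne_top (iSup_le fun X => ?_)
  calc _ ≤ 1 * ‖V - W‖ₑ := by
        gcongr
        · rw [ENNReal.ofReal_le_one, Real.exp_le_one_iff]; simp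
        · exact enorm_apply_le (V - W) X
    _ = _ := one_mul _

lemma exp_mul_exp_neg (r : ℝ) :
    ENNReal.ofReal (Real.exp r) * ENNReal.ofReal (Real.exp (-r)) = 1 := by
  rw [← ENNReal.ofReal_mul (Real.exp_pos _).le, ← Real.exp_add, add_neg_cancel, Real.exp_zero,
    ENNReal.ofReal_one]

lemma enorm_sub_le_wdist {T : ℝ} (V W : Slab d T →ᵇ F₁) (X : Slab d T) :
    ‖V X - W X‖ₑ ≤ wdist V W * ENNReal.ofReal (Real.exp ‖X.2‖) := by
  have h : ENNReal.ofReal (Real.exp (-‖X.2‖)) * ‖V X - W X‖ₑ ≤ wdist V W :=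
    le_iSup (fun X : Slab d T => ENNReal.ofReal (Real.exp (-‖X.2‖)) * ‖V X - W X‖ₑ) X
  calc ‖V X - W X‖ₑ = (ENNReal.ofReal (Real.exp ‖X.2‖) * ENNReal.ofReal (Real.exp (-‖X.2‖))) *
        ‖V X - W X‖ₑ := by rw [exp_mul_exp_neg, one_mul]
    _ = (ENNReal.ofReal (Real.exp (-‖X.2‖)) * ‖V X - W X‖ₑ) *
        ENNReal.ofReal (Real.exp ‖X.2‖) := by ring
    _ ≤ _ := by gcongr

/-- Stability of the source potentials in the weighted norm. -/
lemma weighted_Iop_src_le {k : ℝ → Space d → F →L[ℝ] F'} (hk : IsKer k) {T : ℝ} (hT0 : 0 ≤ T)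
    (hT : T ≤ 1) {b b' : ℝ × Space d → Space d} {f f' : ℝ × Space d → F} (hb : Good T b)
    (hb' : Good T b') (hf : Good T f) (hf' : Good T f') (hb4 : CE * kN b T ≤ 1 / 4)
    (V W : Slab d T →ᵇ (Space d →L[ℝ] F)) {t : ℝ} (ht : t ∈ Icc 0 T) (x : Space d) :
    ENNReal.ofReal (Real.exp (-‖x‖)) *
        ‖Iop k T (src hT0 b f V) t x - Iop k T (src hT0 b' f' W) t x‖ₑ
      ≤ 1 / 4 * wdist V W + ENNReal.ofReal (Real.exp (-‖x‖)) *
        ‖Iop k T (fun p => src hT0 b f W p - src hT0 b' f' W p) t x‖ₑ := by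
  -- First the gradient is changed with the coefficients fixed, which is a contraction; then the
  -- coefficients with W fixed. In the application W is the limit gradient, so the second source is
  -- controlled by coefficient differences with a factor independent of n.
  have e : Iop k T (src hT0 b f V) t x - Iop k T (src hT0 b' f' W) t x =
      (Iop k T (src hT0 b f V) t x - Iop k T (src hT0 b f W) t x) +
      (Iop k T (src hT0 b f W) t x - Iop k T (src hT0 b' f' W) t x) := by abel
  rw [e, Iop_sub hk ht.1 hT (hb.src hT0 hf V) (hb.src hT0 hf W),
    Iop_sub hk ht.1 hT (hb.src hT0 hf W) (hb'.src hT0 hf' W)]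
  refine (mul_le_mul_right (enorm_add_le _ _) _).trans ?_
  rw [mul_add]
  refine add_le_add ?_ le_rfl
  have h := hk.lintegral_le_weight (g := fun p => src hT0 b f V p - src hT0 b f W p) (b := b)
    (W := fun y => wdist V W * ENNReal.ofReal (Real.exp ‖y‖)) ht.1 hT x ?_ ?_
    (ENNReal.mul_ne_top (wdist_ne_top V W) ENNReal.ofReal_ne_top)
  · calc _ ≤ ENNReal.ofReal (Real.exp (-‖x‖)) *
          (CE * (wdist V W * ENNReal.ofReal (Real.exp ‖x‖)) * kN b T) := by
          gcongr
          exact (enorm_integral_le_lintegral_enorm _).trans h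
      _ = (CE * kN b T) * wdist V W *
          (ENNReal.ofReal (Real.exp ‖x‖) * ENNReal.ofReal (Real.exp (-‖x‖))) := by ring
      _ ≤ _ := by
          rw [exp_mul_exp_neg, mul_one]
          gcongr
  · intro p hp
    have e : src hT0 b f V p - src hT0 b f W p = lift hT0 (V - W) p (b p) := by
      simp [src, lift]
    simp only [e]
    refine ((lift hT0 (V - W) p).le_opENorm (b p)).trans ?_
    gcongr
    exact enorm_sub_le_wdist V W _
  · intro y
    rw [mul_left_comm]
    gcongr
    rw [← ENNReal.ofReal_mul (Real.exp_pos _).le, ← Real.exp_add]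
    apply ENNReal.ofReal_le_ofReal (Real.exp_le_exp.2 _)
    have : ‖y‖ ≤ ‖x‖ + ‖x - y‖ := by
      have e : y = x - (x - y) := by simp
      nth_rewrite 1 [e]
      exact norm_sub_le _ _
    linarith

/-- Continuous dependence of the solutions on the coefficients. -/
lemma tendsto_c01Norm_sub {T : ℝ} (hT0 : 0 < T) (hT : T ≤ 1) {b f : ℝ × Space d → Space d}
    {bn fn : ℕ → ℝ × Space d → Space d} (hb : Good T b) (hf : Good T f)
    (hbn : ∀ n, Good T (bn n)) (hfn : ∀ n, Good T (fn n))
    (hb4 : ∀ n, CE * kN (bn n) T ≤ 1 / 4)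
    (hkb : ∀ n S, kN (bn n) S ≤ kN b S) (hkf : ∀ n S, kN (fn n) S ≤ kN f S)
    (hlb : ∀ R : ℝ, Tendsto (fun n => ∫⁻ p in Ioc 0 T ×ˢ univ,
      (if ‖p.2‖ ≤ R then ‖bn n p - b p‖ₑ else 0)) atTop (𝓝 0))
    (hlf : ∀ R : ℝ, Tendsto (fun n => ∫⁻ p in Ioc 0 T ×ˢ univ,
      (if ‖p.2‖ ≤ R then ‖fn n p - f p‖ₑ else 0)) atTop (𝓝 0))
    {V : Slab d T →ᵇ (Space d →L[ℝ] Space d)} (hV : IsFix hT0.le b f V)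
    {Vn : ℕ → Slab d T →ᵇ (Space d →L[ℝ] Space d)}
    (hVn : ∀ n, IsFix hT0.le (bn n) (fn n) (Vn n)) (R : ℝ) :
    Tendsto (fun n => c01Norm T (Metric.ball 0 R) (fun t x =>
      Iop (kerq (Space d)) T (src hT0.le (bn n) (fn n) (Vn n)) t x -
      Iop (kerq (Space d)) T (src hT0.le b f V) t x)) atTop (𝓝 0) := by
  set g : ℕ → ℝ × Space d → Space d := fun n p =>
    src hT0.le (bn n) (fn n) V p - src hT0.le b f V p with hg
  have hgle : ∀ n p, ‖g n p‖ₑ ≤ ‖V‖₊ * ‖bn n p - b p‖ₑ + (1 : ℝ≥0) * ‖fn n p - f p‖ₑ := by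
    intro n p
    have e : g n p = lift hT0.le V p (bn n p - b p) - (fn n p - f p) := by
      simp only [hg, src, map_sub]; abel
    rw [e, ENNReal.coe_one, one_mul]
    refine enorm_sub_le.trans ?_
    gcongr
    refine ((lift hT0.le V p).le_opENorm _).trans ?_
    gcongr
    exact enorm_lift_le _ V p
  have hsub : ∀ {h h' : ℝ × Space d → Space d} {h'' : ℝ → ℝ≥0∞}, Good T h →
      (∀ S, kN h S ≤ h'' S) → (∀ S, kN h' S ≤ h'' S) → ∀ S,
      kN (fun p => h p - h' p) S ≤ 2 * h'' S := by
    intro h h' h'' h1 h2 h3 S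
    have := kN_le_add (h := fun p => h p - h' p) (g₁ := h) (g₂ := h') h1.sm (c₁ := 1) (c₂ := 1)
      (fun p => by simpa using enorm_sub_le) S
    refine this.trans ?_
    rw [ENNReal.coe_one, one_mul, one_mul, two_mul]
    exact add_le_add (h2 S) (h3 S)
  -- A Kato modulus common to all source errors; it is uniform in n because the coefficients indexed
  -- by n do not exceed b and f in Kato functional.
  set N : ℝ → ℝ≥0∞ := fun S => ‖V‖₊ * (2 * kN b S) + 2 * kN f S with hN
  have hgN : ∀ n S, kN (g n) S ≤ N S := by
    intro n S
    refine (kN_le_add ((hbn n).sm.sub hb.sm) (hgle n) S).trans ?_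
    rw [ENNReal.coe_one, one_mul]
    have h1 := hsub (hbn n) (hkb n) (fun S => le_rfl) S
    have h2 := hsub (hfn n) (hkf n) (fun S => le_rfl) S
    simp only [hN]
    gcongr
    exact h1
  have hNT : N T ≠ ⊤ := ENNReal.add_ne_top.2 ⟨ENNReal.mul_ne_top ENNReal.coe_ne_top
    (ENNReal.mul_ne_top ENNReal.ofNat_ne_top hb.fin), ENNReal.mul_ne_top ENNReal.ofNat_ne_top hf.fin⟩
  have hN0 : Tendsto N (𝓝[>] 0) (𝓝 0) := by
    have h1 := ENNReal.Tendsto.const_mul (a := 2) hb.tend (Or.inr ENNReal.ofNat_ne_top)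
    have h2 := ENNReal.Tendsto.const_mul (a := 2) hf.tend (Or.inr ENNReal.ofNat_ne_top)
    have h3 := (ENNReal.Tendsto.const_mul (a := ‖V‖₊) h1 (Or.inr ENNReal.coe_ne_top)).add h2
    simpa using h3
  have hloc : ∀ R : ℝ, Tendsto (fun n => ∫⁻ p in Ioc 0 T ×ˢ univ,
      (if ‖p.2‖ ≤ R then ‖g n p‖ₑ else 0)) atTop (𝓝 0) := by
    intro R
    have h1 := (ENNReal.Tendsto.const_mul (a := ‖V‖₊) (hlb R) (Or.inr ENNReal.coe_ne_top)).add
      (hlf R)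
    simp only [mul_zero, add_zero] at h1
    refine tendsto_of_tendsto_of_tendsto_of_le_of_le tendsto_const_nhds h1 (fun _ => zero_le)
      fun n => ?_
    rw [← lintegral_const_mul' _ _ ENNReal.coe_ne_top, ← lintegral_add_left]
    · refine lintegral_mono fun p => ?_
      split_ifs with h
      · simpa using hgle n p
      · simp
    · have h2 : Measurable fun p => ‖bn n p - b p‖ₑ := ((hbn n).sm.sub hb.sm).enorm
      have h3 : MeasurableSet {p : ℝ × Space d | ‖p.2‖ ≤ R} :=
        measurableSet_le (by fun_prop) measurable_const
      exact (Measurable.ite h3 h2 measurable_const).const_mul _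
  rw [ENNReal.tendsto_nhds_zero]
  intro ε hε
  set c : ℝ≥0∞ := ENNReal.ofReal (Real.exp R) with hc
  have hc0 : c ≠ 0 := by simp [hc, Real.exp_pos]
  have hct : c ≠ ⊤ := ENNReal.ofReal_ne_top
  -- On the ball of radius R, removing the weight costs c = e^R and absorption costs 2, so the value
  -- and the gradient contribute 2ηc = ε/2 each.
  set η : ℝ≥0∞ := ε / 4 / c with hη
  have hη0 : 0 < η := ENNReal.div_pos (ENNReal.div_pos hε.ne' (by norm_num)).ne' hct
  have hgm : ∀ n, StronglyMeasurable (g n) := fun n =>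
    ((hbn n).src hT0.le (hfn n) V).sm.sub (hb.src hT0.le hf V).sm
  filter_upwards [isKer_kerd.eventually_Iop_le hT hgm (fun n S _ => hgN n S) hNT hT0 hN0 hloc hη0,
    isKer_kerq.eventually_Iop_le hT hgm (fun n S _ => hgN n S) hNT hT0 hN0 hloc hη0] with n h1 h2
  have hw : wdist (Vn n) V ≤ 2 * η := by
    refine ennreal_absorb (wdist_ne_top _ _) (iSup_le fun X => ?_)
    rw [hVn n X, hV X]
    refine (weighted_Iop_src_le isKer_kerd hT0.le hT (hbn n) hb (hfn n) hf (hb4 n) (Vn n) V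
      X.1.2 X.2).trans ?_
    gcongr
    exact h1 X.1 X.1.2 X.2
  have hexp : ∀ x ∈ Metric.ball (0 : Space d) R, ENNReal.ofReal (Real.exp ‖x‖) ≤ c := by
    intro x hx
    exact ENNReal.ofReal_le_ofReal (Real.exp_le_exp.2 (mem_ball_zero_iff.1 hx).le)
  have hcη : 2 * η * c = ε / 2 := by
    have h3 : η * c = ε / 4 := by rw [hη, ENNReal.div_mul_cancel hc0 hct]
    have h4 : (4 : ℝ≥0∞) = 2 * 2 := by norm_num
    rw [mul_assoc, h3, h4, ENNReal.div_eq_inv_mul,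
      ENNReal.mul_inv (Or.inl (by norm_num)) (Or.inl (by norm_num)), ← mul_assoc, ← mul_assoc,
      ENNReal.mul_inv_cancel (by norm_num) (by norm_num), one_mul, ENNReal.div_eq_inv_mul]
  refine (c01Norm_le (c₁ := ε / 2) (c₂ := ε / 2) ?_ ?_).trans (le_of_eq (ENNReal.add_halves ε))
  · intro t ht x hx
    have h3 := weighted_Iop_src_le isKer_kerq hT0.le hT (hbn n) hb (hfn n) hf (hb4 n) (Vn n) V ht x
    set D := Iop (kerq (Space d)) T (src hT0.le (bn n) (fn n) (Vn n)) t x -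
      Iop (kerq (Space d)) T (src hT0.le b f V) t x with hD
    have h4 : ENNReal.ofReal (Real.exp (-‖x‖)) * ‖D‖ₑ ≤ 2 * η := by
      refine h3.trans ?_
      calc 1 / 4 * wdist (Vn n) V + _ ≤ 1 / 4 * (2 * η) + η := by
            gcongr
            exact h2 t ht x
        _ ≤ 1 * η + η := by
            rw [← mul_assoc]
            gcongr
            rw [ennreal_quarter]
            norm_cast
            rw [← NNReal.coe_le_coe]; push_cast; norm_num
        _ = _ := by ring
    calc ‖D‖ₑ = (ENNReal.ofReal (Real.exp (-‖x‖)) * ‖D‖ₑ) * ENNReal.ofReal (Real.exp ‖x‖) := by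
          rw [mul_right_comm, mul_comm (ENNReal.ofReal (Real.exp (-‖x‖))), exp_mul_exp_neg, one_mul]
      _ ≤ 2 * η * c := by
          gcongr
          exact hexp x hx
      _ = _ := hcη
  · intro t ht x hx
    have h3 : HasFDerivAt (fun x => Iop (kerq (Space d)) T (src hT0.le (bn n) (fn n) (Vn n)) t x -
      Iop (kerq (Space d)) T (src hT0.le b f V) t x)
        (Vn n (⟨t, ht⟩, x) - V (⟨t, ht⟩, x)) x :=
      ((hVn n).hasFDerivAt hT (hbn n) (hfn n) ht x).sub (hV.hasFDerivAt hT hb hf ht x)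
    rw [h3.fderiv]
    calc _ ≤ wdist (Vn n) V * ENNReal.ofReal (Real.exp ‖x‖) := enorm_sub_le_wdist _ _ (⟨t, ht⟩, x)
      _ ≤ 2 * η * c := by
          gcongr
          exact hexp x hx
      _ = _ := hcη

end KatoPDE
end


/-! ### Second space derivatives for smooth coefficients. -/

open Set Filter Topology MeasureTheory
open scoped ENNReal NNReal BoundedContinuousFunction

noncomputable section

namespace KatoPDE

variable {d : ℕ} {F F' : Type*} [NormedAddCommGroup F] [NormedSpace ℝ F]
  [NormedAddCommGroup F'] [NormedSpace ℝ F']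

/-- Second derivatives of `ℝ^d`-valued functions. -/
def Hess (d : ℕ) : Type := Space d →L[ℝ] Space d →L[ℝ] Space d

instance : NormedAddCommGroup (Hess d) :=
  inferInstanceAs (NormedAddCommGroup (Space d →L[ℝ] Space d →L[ℝ] Space d))

instance : NormedSpace ℝ (Hess d) :=
  inferInstanceAs (NormedSpace ℝ (Space d →L[ℝ] Space d →L[ℝ] Space d))

instance : CompleteSpace (Hess d) :=
  inferInstanceAs (CompleteSpace (Space d →L[ℝ] Space d →L[ℝ] Space d))

/-- Exchange of the arguments of a second derivative. -/
def Hess.flip (W : Hess d) (v : Space d) : Space d →L[ℝ] Space d :=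
  ContinuousLinearMap.flip (E := Space d) (F := Space d) (G := Space d) W v

lemma Hess.enorm_flip_le (W : Hess d) (v : Space d) : ‖W.flip v‖ₑ ≤ ‖W‖ₑ * ‖v‖ₑ := by
  refine (ContinuousLinearMap.le_opENorm (ContinuousLinearMap.flip
    (E := Space d) (F := Space d) (G := Space d) W) v).trans (le_of_eq ?_)
  congr 1
  rw [← ofReal_norm, ← ofReal_norm]
  congr 1
  exact ContinuousLinearMap.opNorm_flip _

lemma Hess.continuous_flip {X : Type*} [TopologicalSpace X] {W : X → Hess d} {v : X → Space d}
    (hW : Continuous W) (hv : Continuous v) : Continuous fun x => (W x).flip (v x) := by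
  have h1 : Continuous fun x => ContinuousLinearMap.flipₗᵢ ℝ (Space d) (Space d) (Space d) (W x) :=
    (ContinuousLinearMap.flipₗᵢ ℝ (Space d) (Space d) (Space d)).continuous.comp hW
  exact h1.clm_apply hv

lemma Hess.flip_sub (W W' : Hess d) (v : Space d) : (W - W').flip v = W.flip v - W'.flip v := rfl

lemma Hess.flip_smul (c : ℝ) (W : Hess d) (v : Space d) : (c • W).flip v = c • W.flip v := rfl

/-- Bounded `C¹` functions on space-time with bounded derivative. -/
structure SmoothBdd (b : ℝ × Space d → F) : Prop where
  contDiff : ContDiff ℝ 1 b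
  bdd : ∃ c : ℝ≥0, ∀ p, ‖b p‖ₑ ≤ c
  fderiv_bdd : ∃ c : ℝ, ∀ p, ‖fderiv ℝ b p‖ ≤ c

/-- The spatial derivative of a space-time function. -/
def dx (b : ℝ × Space d → F) (p : ℝ × Space d) : Space d →L[ℝ] F :=
  (fderiv ℝ b p).comp (ContinuousLinearMap.inr ℝ ℝ (Space d))

section

variable {b : ℝ × Space d → F}

lemma SmoothBdd.hasFDerivAt (hb : SmoothBdd b) (s : ℝ) (y : Space d) :
    HasFDerivAt (fun y => b (s, y)) (dx b (s, y)) y := by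
  have h1 := (hb.contDiff.differentiable one_ne_zero (s, y)).hasFDerivAt
  have h2 : HasFDerivAt (fun y : Space d => (s, y)) (ContinuousLinearMap.inr ℝ ℝ (Space d)) y :=
    hasFDerivAt_prodMk_right s y
  exact h1.comp y h2

lemma SmoothBdd.continuous_dx (hb : SmoothBdd b) : Continuous (dx b) :=
  (hb.contDiff.continuous_fderiv one_ne_zero).clm_comp continuous_const

lemma SmoothBdd.dx_bdd (hb : SmoothBdd b) : ∃ c : ℝ≥0, ∀ p, ‖dx b p‖ₑ ≤ c := by
  obtain ⟨c, hc⟩ := hb.fderiv_bdd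
  have hc0 : 0 ≤ c := (norm_nonneg _).trans (hc 0)
  lift c to ℝ≥0 using hc0
  refine ⟨c, fun p => ?_⟩
  rw [enorm_le_coe, ← NNReal.coe_le_coe]
  refine (ContinuousLinearMap.opNorm_comp_le _ _).trans ?_
  refine (mul_le_mul (hc p) (ContinuousLinearMap.norm_inr_le_one ℝ ℝ (Space d))
    (norm_nonneg _) c.2).trans (mul_one _).le

lemma SmoothBdd.good (hb : SmoothBdd b) {T : ℝ} (hT : 0 < T) : Good T b := by
  obtain ⟨c, hc⟩ := hb.bdd
  exact Good.of_bounded hT hb.contDiff.continuous.stronglyMeasurable hc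

lemma SmoothBdd.good_dx (hb : SmoothBdd b) {T : ℝ} (hT : 0 < T) : Good T (dx b) := by
  obtain ⟨c, hc⟩ := hb.dx_bdd
  exact Good.of_bounded hT hb.continuous_dx.stronglyMeasurable hc

end

lemma Iop_smul (k : ℝ → Space d → F →L[ℝ] F') (T : ℝ) (g : ℝ × Space d → F) (c : ℝ) (t : ℝ)
    (x : Space d) : c • Iop k T g t x = Iop k T (fun p => c • g p) t x := by
  unfold Iop
  rw [← integral_smul]
  simp only [map_smul]

/-- The derivative of the source term, scaled by `δ`. -/
def src' {T : ℝ} (hT : 0 ≤ T) (δ : ℝ) (b f : ℝ × Space d → Space d)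
    (V : Slab d T →ᵇ (Space d →L[ℝ] Space d))
    (W : Slab d T →ᵇ Hess d) (p : ℝ × Space d) :
    Space d →L[ℝ] Space d :=
  (lift hT W p).flip (b p) + δ • ((lift hT V p).comp (dx b p) - dx f p)

section

variable {T : ℝ} {b f : ℝ × Space d → Space d}

lemma enorm_add_le_of_normed {A : Type*} [NormedAddCommGroup A] (a b : A) :
    ‖a + b‖ₑ ≤ ‖a‖ₑ + ‖b‖ₑ := enorm_add_le a b

lemma enorm_clm_comp_le {E₁ E₂ E₃ : Type*} [NormedAddCommGroup E₁] [NormedSpace ℝ E₁]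
    [NormedAddCommGroup E₂] [NormedSpace ℝ E₂] [NormedAddCommGroup E₃] [NormedSpace ℝ E₃]
    (V : E₂ →L[ℝ] E₃) (U : E₁ →L[ℝ] E₂) : ‖V.comp U‖ₑ ≤ ‖V‖ₑ * ‖U‖ₑ := by
  rw [← ofReal_norm, ← ofReal_norm, ← ofReal_norm, ← ENNReal.ofReal_mul (norm_nonneg _)]
  exact ENNReal.ofReal_le_ofReal (ContinuousLinearMap.opNorm_comp_le _ _)

lemma continuous_src' (hT : 0 ≤ T) (δ : ℝ) (hb : SmoothBdd b) (hf : SmoothBdd f)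
    (V : Slab d T →ᵇ (Space d →L[ℝ] Space d))
    (W : Slab d T →ᵇ Hess d) : Continuous (src' hT δ b f V W) := by
  unfold src'
  exact (Hess.continuous_flip (continuous_lift hT W) hb.contDiff.continuous).add
    ((((continuous_lift hT V).clm_comp hb.continuous_dx).sub hf.continuous_dx).const_smul δ)

lemma src'_bdd (hT : 0 ≤ T) (δ : ℝ) (hb : SmoothBdd b) (hf : SmoothBdd f)
    (V : Slab d T →ᵇ (Space d →L[ℝ] Space d))
    (W : Slab d T →ᵇ Hess d) :
    ∃ c : ℝ≥0, ∀ p, ‖src' hT δ b f V W p‖ₑ ≤ c := by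
  obtain ⟨c₀, h0⟩ := hb.bdd
  obtain ⟨c₁, h1⟩ := hb.dx_bdd
  obtain ⟨c₂, h2⟩ := hf.dx_bdd
  refine ⟨‖W‖₊ * c₀ + ‖δ‖₊ * (‖V‖₊ * c₁ + c₂), fun p => ?_⟩
  push_cast
  refine (enorm_add_le_of_normed (A := Space d →L[ℝ] Space d) _ _).trans ?_
  gcongr
  · refine (Hess.enorm_flip_le _ _).trans ?_
    gcongr
    · exact enorm_lift_le hT W p
    · exact h0 p
  · rw [enorm_smul, enorm_eq_nnnorm δ]
    gcongr
    refine enorm_sub_le.trans ?_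
    gcongr
    · refine (enorm_clm_comp_le _ _).trans ?_
      gcongr
      · exact enorm_lift_le hT V p
      · exact h1 p
    · exact h2 p

lemma good_src' (hT : 0 < T) (δ : ℝ) (hb : SmoothBdd b) (hf : SmoothBdd f)
    (V : Slab d T →ᵇ (Space d →L[ℝ] Space d))
    (W : Slab d T →ᵇ Hess d) : Good T (src' hT.le δ b f V W) := by
  obtain ⟨c, hc⟩ := src'_bdd hT.le δ hb hf V W
  exact Good.of_bounded hT (continuous_src' hT.le δ hb hf V W).stronglyMeasurable hc

lemma enorm_src'_sub_le (hT : 0 ≤ T) (δ : ℝ≥0)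
    (V V' : Slab d T →ᵇ (Space d →L[ℝ] Space d))
    (W W' : Slab d T →ᵇ Hess d) (p : ℝ × Space d) :
    ‖src' hT δ b f V W p - src' hT δ b f V' W' p‖ₑ
      ≤ ‖W - W'‖₊ * ‖b p‖ₑ + (δ * ‖V - V'‖₊ : ℝ≥0) * ‖dx b p‖ₑ := by
  have e : src' hT δ b f V W p - src' hT δ b f V' W' p
      = (lift hT (W - W') p).flip (b p) + (δ : ℝ) • ((lift hT (V - V') p).comp (dx b p)) := by
    have e1 : lift hT (W - W') p = lift hT W p - lift hT W' p := rfl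
    have e2 : lift hT (V - V') p = lift hT V p - lift hT V' p := rfl
    rw [e1, e2, Hess.flip_sub, ContinuousLinearMap.sub_comp, src', src']
    module
  rw [e]
  refine (enorm_add_le_of_normed (A := Space d →L[ℝ] Space d) _ _).trans ?_
  gcongr
  · refine (Hess.enorm_flip_le _ _).trans ?_
    gcongr
    exact enorm_lift_le hT (W - W') p
  · rw [enorm_smul, ENNReal.coe_mul, mul_assoc]
    gcongr
    · simp [enorm_eq_nnnorm]
    · refine (enorm_clm_comp_le _ _).trans ?_
      gcongr
      exact enorm_lift_le hT (V - V') p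

/-- The product rule for V(y)b(y) - f(y). Here W stands for δ times the Hessian, and the flip
appears because the direction of differentiation is the first argument of W while b occupies the
second. -/
lemma hasFDerivAt_src (hT : 0 ≤ T) {δ : ℝ} (hδ : δ ≠ 0) (hb : SmoothBdd b) (hf : SmoothBdd f)
    {V : Slab d T →ᵇ (Space d →L[ℝ] Space d)}
    {W : Slab d T →ᵇ Hess d}
    (hVW : ∀ t (ht : t ∈ Icc 0 T) x,
      HasFDerivAt (fun x => V (⟨t, ht⟩, x)) (δ⁻¹ • W (⟨t, ht⟩, x)) x) {s : ℝ}
    (hs : s ∈ Icc 0 T) (y : Space d) :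
    HasFDerivAt (fun y => src hT b f V (s, y)) (δ⁻¹ • src' hT δ b f V W (s, y)) y := by
  have h1 : HasFDerivAt (fun y => lift hT V (s, y)) (δ⁻¹ • lift hT W (s, y)) y := by
    simp only [lift_of_mem hT _ hs]
    exact hVW s hs y
  have h2 := (h1.clm_apply (hb.hasFDerivAt s y)).sub (hf.hasFDerivAt s y)
  refine h2.congr_fderiv ?_
  rw [src', smul_add, smul_smul, inv_mul_cancel₀ hδ, one_smul, ← Hess.flip_smul]
  refine ContinuousLinearMap.ext fun v => ?_
  rw [Hess.flip]
  simp only [_root_.add_apply, _root_.sub_apply,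
    ContinuousLinearMap.comp_apply]
  abel

/-- Convergence of the iterates is kept in the conclusion: differentiability is carried along the
iteration and passed to the limit. -/
lemma exists_fixedPoint_prod_tendsto {B B' : Type*} [NormedAddCommGroup B] [CompleteSpace B]
    [NormedAddCommGroup B'] [CompleteSpace B'] {Φ : B × B' → B × B'} {K : ℝ≥0} (hK : K < 1)
    (h : ∀ q q', max ‖(Φ q).1 - (Φ q').1‖ₑ ‖(Φ q).2 - (Φ q').2‖ₑ
      ≤ K * max ‖q.1 - q'.1‖ₑ ‖q.2 - q'.2‖ₑ) :
    ∃ q, Φ q = q ∧ Tendsto (fun n => (Φ^[n] 0).1) atTop (𝓝 q.1) ∧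
      Tendsto (fun n => (Φ^[n] 0).2) atTop (𝓝 q.2) := by
  have e : ∀ q : B × B', ‖q‖ₑ = max ‖q.1‖ₑ ‖q.2‖ₑ := fun q => by
    simp only [enorm_eq_nnnorm, Prod.nnnorm_def]
    exact ENNReal.coe_mono.map_max
  have hc : ContractingWith K Φ := contractingWith_of_enorm hK fun q q' => by
    rw [e, e]; exact h q q'
  refine ⟨hc.fixedPoint, hc.fixedPoint_isFixedPt, ?_, ?_⟩
  · exact (continuous_fst.tendsto _).comp (hc.tendsto_iterate_fixedPoint 0)
  · exact (continuous_snd.tendsto _).comp (hc.tendsto_iterate_fixedPoint 0)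

/-- The gradient of the solution with smooth coefficients is differentiable. -/
lemma exists_isFix_hasFDerivAt (hT0 : 0 < T) (hT : T ≤ 1) (hb : SmoothBdd b) (hf : SmoothBdd f)
    (hb4 : CE * kN b T ≤ 1 / 4) :
    ∃ (V : Slab d T →ᵇ (Space d →L[ℝ] Space d))
      (W : Slab d T →ᵇ Hess d), IsFix hT0.le b f V ∧
      ∀ t (ht : t ∈ Icc 0 T) x, HasFDerivAt (fun x => V (⟨t, ht⟩, x)) (W (⟨t, ht⟩, x)) x := by
  have gb := hb.good hT0
  have gf := hf.good hT0
  have gdb := hb.good_dx hT0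
  -- Db need not be small in the Kato sense. Scaling the Hessian by δ shrinks the influence of V on
  -- the Hessian equation, so that no further reduction of T is needed.
  obtain ⟨δ, hδ, hδ4⟩ : ∃ δ : ℝ≥0, 0 < δ ∧ δ * (CE * kN (dx b) T) ≤ 1 / 4 := by
    have hfin : CE * kN (dx b) T ≠ ⊤ := ENNReal.mul_ne_top ENNReal.coe_ne_top gdb.fin
    lift CE * kN (dx b) T to ℝ≥0 using hfin with a
    refine ⟨1 / (4 * (a + 1)), by positivity, ?_⟩
    rw [ennreal_quarter]
    norm_cast
    rw [← NNReal.coe_le_coe]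
    push_cast
    rw [div_mul_eq_mul_div, one_mul, div_le_div_iff₀ (by positivity) (by norm_num)]
    linarith
  have hδ0 : (δ : ℝ) ≠ 0 := by exact_mod_cast hδ.ne'
  -- The second component keeps the kernel ∇q and differentiates the source: a second derivative of
  -- q would be too singular for the Kato bound. The Lipschitz constant is 1/4 + 1/4.
  let Φ : (Slab d T →ᵇ (Space d →L[ℝ] Space d)) ×
      (Slab d T →ᵇ Hess d) →
      (Slab d T →ᵇ (Space d →L[ℝ] Space d)) ×
      (Slab d T →ᵇ Hess d) := fun q =>
    (potB isKer_kerd hT (gb.src hT0.le gf q.1),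
      potB isKer_kerd.compKer hT (good_src' hT0 δ hb hf q.1 q.2))
  obtain ⟨q, hfix, h1, h2⟩ : ∃ q, Φ q = q ∧ Tendsto (fun n => (Φ^[n] 0).1) atTop (𝓝 q.1) ∧
      Tendsto (fun n => (Φ^[n] 0).2) atTop (𝓝 q.2) := by
    refine exists_fixedPoint_prod_tendsto (Φ := Φ) (K := 1 / 2)
      (by rw [← NNReal.coe_lt_coe]; push_cast; norm_num) fun q q' => ?_
    set m := max ‖q.1 - q'.1‖ₑ ‖q.2 - q'.2‖ₑ with hm
    have h12 : (1 / 4 + 1 / 4 : ℝ≥0∞) = ((1 / 2 : ℝ≥0) : ℝ≥0∞) := by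
      rw [ennreal_quarter]
      norm_cast
      rw [← NNReal.coe_inj]; push_cast; norm_num
    refine max_le ?_ ?_
    · calc _ ≤ 1 / 4 * ‖q.1 - q'.1‖ₑ := enorm_le_of_forall fun X =>
            enorm_Iop_src_sub_le isKer_kerd hT0.le hT gb gf hb4 q.1 q'.1 X.1.2.1 X.2
        _ ≤ (1 / 4 + 1 / 4) * m := by
            gcongr
            · exact le_self_add
            · exact le_max_left _ _
        _ = _ := by rw [h12]
    · refine enorm_le_of_forall fun X => ?_
      have e : (Φ q).2 X - (Φ q').2 X = Iop (compKer (kerd (Space d))) T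
          (fun p => src' hT0.le δ b f q.1 q.2 p - src' hT0.le δ b f q'.1 q'.2 p) X.1 X.2 :=
        Iop_sub isKer_kerd.compKer X.1.2.1 hT (good_src' hT0 δ hb hf q.1 q.2)
          (good_src' hT0 δ hb hf q'.1 q'.2) X.2
      rw [BoundedContinuousFunction.sub_apply, e]
      refine (isKer_kerd.compKer.enorm_Iop_le X.1.2.1 hT _ X.2).trans ?_
      calc _ ≤ CE * (‖q.2 - q'.2‖₊ * kN b T + (δ * ‖q.1 - q'.1‖₊ : ℝ≥0) * kN (dx b) T) := by
            gcongr
            exact kN_le_add gb.sm (enorm_src'_sub_le hT0.le δ q.1 q'.1 q.2 q'.2) T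
        _ = (CE * kN b T) * ‖q.2 - q'.2‖ₑ + (δ * (CE * kN (dx b) T)) * ‖q.1 - q'.1‖ₑ := by
            rw [enorm_eq_nnnorm, enorm_eq_nnnorm, ENNReal.coe_mul]; ring
        _ ≤ 1 / 4 * m + 1 / 4 * m := by
            gcongr
            · exact le_max_right _ _
            · exact le_max_left _ _
        _ = _ := by rw [← add_mul, h12]
  -- The pairs whose second component is δ times the derivative of the first. The iteration
  -- preserves this relation, it holds for the starting pair 0, and uniform limits inherit it.
  let S : Set ((Slab d T →ᵇ (Space d →L[ℝ] Space d)) ×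
      (Slab d T →ᵇ Hess d)) :=
    {q | ∀ t (ht : t ∈ Icc 0 T) x,
      HasFDerivAt (fun x => q.1 (⟨t, ht⟩, x)) ((δ : ℝ)⁻¹ • q.2 (⟨t, ht⟩, x)) x}
  have hSΦ : MapsTo Φ S S := by
    intro q hq t ht x
    obtain ⟨c, hc⟩ := src'_bdd hT0.le δ hb hf q.1 q.2
    have h := isKer_kerd.hasFDerivAt_Iop_density hT0 hT (gb.src hT0.le gf q.1)
      (g' := fun p => (δ : ℝ)⁻¹ • src' hT0.le δ b f q.1 q.2 p)
      (Continuous.stronglyMeasurable (f := fun p => (δ : ℝ)⁻¹ • src' hT0.le δ b f q.1 q.2 p)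
        ((continuous_const (y := (δ : ℝ)⁻¹)).smul (continuous_src' hT0.le δ hb hf q.1 q.2)))
      (A := (δ : ℝ)⁻¹ * c) (fun p => by
        rw [norm_smul, Real.norm_of_nonneg (by positivity)]
        gcongr
        have := hc p
        rwa [enorm_le_coe, ← NNReal.coe_le_coe] at this)
      (fun s hs y => hasFDerivAt_src hT0.le hδ0 hb hf hq ⟨hs.1.le, hs.2⟩ y) ht x
    rw [← Iop_smul] at h
    exact h
  have hS0 : (0 : _ × _) ∈ S := by
    intro t ht x
    have h := hasFDerivAt_const (𝕜 := ℝ) (0 : Space d →L[ℝ] Space d) x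
    refine h.congr_fderiv (smul_zero (A := Hess d) (δ : ℝ)⁻¹).symm
  have hqS : q ∈ S := by
    intro t ht x
    rw [BoundedContinuousFunction.tendsto_iff_tendstoUniformly] at h1 h2
    have h3 : TendstoUniformly (fun n x => (Φ^[n] 0).2 (⟨t, ht⟩, x))
        (fun x => q.2 (⟨t, ht⟩, x)) atTop := h2.comp (fun x : Space d => ((⟨t, ht⟩ : Icc 0 T), x))
    have h4 : TendstoUniformly (fun n x => (δ : ℝ)⁻¹ • (Φ^[n] 0).2 (⟨t, ht⟩, x))
        (fun x => (δ : ℝ)⁻¹ • q.2 (⟨t, ht⟩, x)) atTop :=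
      (uniformContinuous_const_smul (δ : ℝ)⁻¹).comp_tendstoUniformly h3
    exact hasFDerivAt_of_tendstoUniformly h4 (fun n x => hSΦ.iterate n hS0 t ht x)
      (fun x => h1.tendsto_at _) x
  refine ⟨q.1, (δ : ℝ)⁻¹ • q.2, fun X => ?_, fun t ht x => hqS t ht x⟩
  have := congrArg (fun q => q.1 X) hfix
  exact this.symm

end

end KatoPDE
end


/-! ### The generator of the heat semigroup. -/

open Set Filter Topology MeasureTheory
open scoped ENNReal NNReal BoundedContinuousFunction

noncomputable section

namespace KatoPDE

variable {d : ℕ} {F : Type*} [NormedAddCommGroup F] [NormedSpace ℝ F]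

lemma gk_one_mul_sq_le (z : Space d) :
    gk 1 z * ‖z‖ ^ 2 ≤ 4 * Real.exp 1 * Real.exp (-‖z‖) := by
  have h1 : gk 1 z ≤ Real.exp (-(‖z‖ ^ 2 / 2)) := by
    unfold gk
    rw [mul_one, mul_one]
    exact mul_le_of_le_one_left (Real.exp_pos _).le rpow_half_neg_le_one
  have h2 : ‖z‖ ^ 2 ≤ 4 * Real.exp (‖z‖ ^ 2 / 4) := by
    have := Real.add_one_le_exp (‖z‖ ^ 2 / 4)
    linarith
  calc gk 1 z * ‖z‖ ^ 2 ≤ Real.exp (-(‖z‖ ^ 2 / 2)) * (4 * Real.exp (‖z‖ ^ 2 / 4)) := by gcongr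
    _ = 4 * Real.exp (-(‖z‖ ^ 2 / 4)) := by
        rw [mul_left_comm, ← Real.exp_add]; congr 2; ring
    _ ≤ 4 * Real.exp (1 + -‖z‖) := by
        gcongr
        nlinarith [sq_nonneg (‖z‖ / 2 - 1)]
    _ = _ := by rw [Real.exp_add]; ring

lemma integrable_gk_mul_sq : Integrable (fun z : Space d => gk 1 z * ‖z‖ ^ 2) := by
  refine (integrable_exp_neg_norm.const_mul (4 * Real.exp 1)).mono' ?_
    (ae_of_all _ fun z => ?_)
  · exact ((continuous_gk 1).mul (by fun_prop)).aestronglyMeasurable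
  · rw [Real.norm_of_nonneg (mul_nonneg (gk_pos one_pos z).le (by positivity))]
    exact gk_one_mul_sq_le z

lemma integrable_gk_smul_of_le {w : Space d → F} (hw : Continuous w) {c : ℝ}
    (h : ∀ z, ‖w z‖ ≤ c * (1 + ‖z‖ ^ 2)) : Integrable (fun z => gk 1 z • w z) := by
  refine (((integrable_gk one_pos).add integrable_gk_mul_sq).const_mul c).mono'
    ((continuous_gk 1).smul hw).aestronglyMeasurable (ae_of_all _ fun z => ?_)
  rw [norm_smul, Real.norm_of_nonneg (gk_pos one_pos z).le]
  calc gk 1 z * ‖w z‖ ≤ gk 1 z * (c * (1 + ‖z‖ ^ 2)) := by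
        gcongr
        · exact (gk_pos one_pos z).le
        · exact h z
    _ = _ := by simp only [Pi.add_apply]; ring

lemma integral_gk_smul_clm (L : Space d →L[ℝ] F) : ∫ z : Space d, gk 1 z • L z = 0 := by
  have h := integral_neg_eq_self (fun z : Space d => gk 1 z • L z) volume
  simp only [gk_neg, map_neg, smul_neg, integral_neg] at h
  have h2 : (2 : ℝ) • ∫ z : Space d, gk 1 z • L z = 0 := by
    rw [two_smul]
    nth_rewrite 1 [← h]
    exact neg_add_cancel _
  exact (smul_eq_zero.1 h2).resolve_left two_ne_zero

/-- The Laplacian associated with a second derivative. -/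
def tr (D : Space d →L[ℝ] Space d →L[ℝ] F) : F :=
  ∑ i : Fin d, D (EuclideanSpace.single i 1) (EuclideanSpace.single i 1)

lemma sum_smul_single (z : Space d) :
    ∑ i : Fin d, z i • (EuclideanSpace.single i 1 : Space d) = z := by
  have h := (EuclideanSpace.basisFun (Fin d) ℝ).sum_repr z
  simpa using h

lemma norm_le_one_add_sq (z : Space d) : ‖z‖ ≤ 1 + ‖z‖ ^ 2 := by
  nlinarith [sq_nonneg (‖z‖ - 1)]

/-- Gaussian integration by parts: since ∂_i gk = -z_i gk, the factor z_i becomes a derivative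
falling on D z e_i. -/
lemma integral_gk_smul_apply_apply [CompleteSpace F] (D : Space d →L[ℝ] Space d →L[ℝ] F) :
    ∫ z : Space d, gk 1 z • D z z = tr D := by
  have hcoord : ∀ i, ∀ z : Space d,
      fderiv ℝ (gk 1) z (EuclideanSpace.single i 1) = -(gk 1 z * z i) := fun i z => by
    rw [(hasFDerivAt_gk 1 z).fderiv, dgk]
    simp [innerSL_apply_apply, EuclideanSpace.inner_single_right]
  have hzi : ∀ i, ∀ z : Space d, |z i| ≤ ‖z‖ := fun i z => by
    simpa using EuclideanSpace.norm_eq z ▸ (PiLp.norm_apply_le z i)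
  have hfd : ∀ i : Fin d, ∀ z, HasFDerivAt (fun z => D z (EuclideanSpace.single i 1))
      (D.flip (EuclideanSpace.single i 1)) z := fun i z =>
    (D.flip (EuclideanSpace.single i 1)).hasFDerivAt
  have hi : ∀ i : Fin d, Integrable fun z : Space d =>
      gk 1 z • (z i • D z (EuclideanSpace.single i 1)) := fun i => by
    refine integrable_gk_smul_of_le (c := ‖D‖) (by fun_prop) fun z => ?_
    rw [norm_smul, Real.norm_eq_abs]
    calc |z i| * ‖D z (EuclideanSpace.single i 1)‖ ≤ ‖z‖ * (‖D‖ * ‖z‖) := by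
          gcongr
          · exact hzi i z
          · refine ((D z).le_opNorm _).trans ?_
            rw [PiLp.norm_single, norm_one, mul_one]
            exact D.le_opNorm z
      _ ≤ ‖D‖ * (1 + ‖z‖ ^ 2) := by nlinarith [norm_nonneg D, norm_nonneg z]
  have key : ∀ i : Fin d, ∫ z : Space d, gk 1 z • (z i • D z (EuclideanSpace.single i 1))
      = D (EuclideanSpace.single i 1) (EuclideanSpace.single i 1) := fun i => by
    have h := integral_smul_fderiv_eq_neg_fderiv_smul_of_integrable (𝕜 := ℝ) (μ := volume)
      (f := (gk 1 : Space d → ℝ)) (g := fun z => D z (EuclideanSpace.single i 1))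
      (v := EuclideanSpace.single i 1) ?_ ?_ ?_ ?_ ?_
    · simp only [(hfd i _).fderiv, hcoord, ContinuousLinearMap.flip_apply, neg_smul,
        integral_neg, neg_neg, mul_smul] at h
      rw [← h, integral_smul_const, integral_gk one_pos, one_smul]
    · simp only [hcoord, neg_smul, mul_smul]
      exact (hi i).neg
    · simp only [(hfd i _).fderiv]
      exact (integrable_gk one_pos).smul_const _
    · refine integrable_gk_smul_of_le (c := ‖D‖) (by fun_prop) fun z => ?_
      refine ((D z).le_opNorm _).trans ?_
      rw [PiLp.norm_single, norm_one, mul_one]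
      refine (D.le_opNorm z).trans ?_
      gcongr
      exact norm_le_one_add_sq z
    · exact fun z _ => (hasFDerivAt_gk 1 z).differentiableAt
    · exact fun z _ => (hfd i z).differentiableAt
  rw [tr, ← Finset.sum_congr rfl fun i _ => key i, ← integral_finsetSum _ fun i _ => hi i]
  congr 1
  ext1 z
  rw [← Finset.smul_sum]
  congr 1
  nth_rewrite 2 [← sum_smul_single z]
  simp

section

variable {w : Space d → F} {V : Space d → Space d →L[ℝ] F}
  {W : Space d → Space d →L[ℝ] Space d →L[ℝ] F}

lemma norm_taylor_le (hw : ∀ x, HasFDerivAt w (V x) x) (hV : ∀ x, HasFDerivAt V (W x) x) {M : ℝ}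
    (hM : ∀ x, ‖W x‖ ≤ M) (x v : Space d) : ‖w (x + v) - w x - V x v‖ ≤ M * ‖v‖ ^ 2 := by
  have hM0 : 0 ≤ M := (norm_nonneg (W 0)).trans (hM 0)
  have h := Convex.norm_image_sub_le_of_norm_hasFDerivWithin_le' (𝕜 := ℝ) (f := w) (f' := V)
    (φ := V x) (C := M * ‖v‖) (s := Metric.closedBall x ‖v‖) (x := x) (y := x + v)
    (fun y _ => (hw y).hasFDerivWithinAt) (fun y hy => ?_) (convex_closedBall _ _)
    (by simp) (by simp)
  · rw [add_sub_cancel_left] at h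
    rwa [pow_two, ← mul_assoc]
  · refine (Convex.norm_image_sub_le_of_norm_hasFDerivWithin_le (𝕜 := ℝ) (f := V) (f' := W)
      (C := M) (fun y _ => (hV y).hasFDerivWithinAt) (fun y _ => hM y) convex_univ (mem_univ x)
      (mem_univ y)).trans ?_
    rw [mem_closedBall_iff_norm] at hy
    gcongr

/-- Along the line, the second-order remainder φ has φ' = o(r) by differentiability of V at x alone,
so the mean value inequality gives φ = o(r²). -/
lemma tendsto_taylor (hw : ∀ x, HasFDerivAt w (V x) x) {x : Space d}
    (hV : HasFDerivAt V (W x) x) (z : Space d) :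
    Tendsto (fun r : ℝ => (r ^ 2)⁻¹ • (w (x + r • z) - w x - r • V x z)) (𝓝[>] 0)
      (𝓝 ((1 / 2 : ℝ) • W x z z)) := by
  have hline : ∀ r : ℝ, HasDerivAt (fun r : ℝ => x + r • z) z r := fun r => by
    simpa using ((hasDerivAt_id r).smul_const z).const_add x
  let φ : ℝ → F := fun r => w (x + r • z) - w x - r • V x z - (r ^ 2 / 2) • W x z z
  let φ' : ℝ → F := fun r => V (x + r • z) z - V x z - r • W x z z
  have hφ : ∀ r, HasDerivAt φ (φ' r) r := fun r => by
    have h1 := (hw (x + r • z)).comp_hasDerivAt r (hline r)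
    have h2 : HasDerivAt (fun r : ℝ => r • V x z) (V x z) r := by
      simpa using (hasDerivAt_id r).smul_const (V x z)
    have h3 : HasDerivAt (fun r : ℝ => (r ^ 2 / 2) • W x z z) (r • W x z z) r := by
      have := ((hasDerivAt_pow 2 r).div_const 2).smul_const (W x z z)
      simpa using this
    exact ((h1.sub_const _).sub h2).sub h3
  have hV0 : HasDerivAt (fun r : ℝ => V (x + r • z) z) (W x z z) 0 := by
    have h1 : HasFDerivAt V (W x) (x + (0 : ℝ) • z) := by rwa [zero_smul, add_zero]
    have h2 := h1.comp_hasDerivAt (0 : ℝ) (hline 0)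
    exact ((ContinuousLinearMap.apply ℝ F z).hasFDerivAt).comp_hasDerivAt (0 : ℝ) h2
  have hφ'o : φ' =o[𝓝 0] fun r : ℝ => r := by
    have := hasDerivAt_iff_isLittleO.1 hV0
    simpa [φ'] using this
  rw [tendsto_iff_norm_sub_tendsto_zero]
  rw [Metric.tendsto_nhds]
  intro ε hε
  have h1 := hφ'o.bound (half_pos hε)
  obtain ⟨δ, hδ, hb⟩ := Metric.eventually_nhds_iff.1 h1
  filter_upwards [Ioo_mem_nhdsGT hδ] with r hr
  have h2 : ‖φ r - φ 0‖ ≤ ε / 2 * r * (r - 0) := by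
    refine norm_image_sub_le_of_norm_deriv_le_segment' (f := φ) (f' := φ')
      (fun s _ => (hφ s).hasDerivWithinAt) (fun s hs => ?_) r ⟨hr.1.le, le_rfl⟩
    have h3 := hb (y := s) (by
      rw [Real.dist_eq, sub_zero, abs_of_nonneg hs.1]; exact hs.2.trans hr.2)
    refine h3.trans ?_
    rw [Real.norm_of_nonneg hs.1]
    have := hs.2.le
    gcongr
  have h0 : φ 0 = 0 := by simp [φ]
  rw [h0, sub_zero, sub_zero, mul_assoc, ← pow_two] at h2
  have hr2 : 0 < r ^ 2 := pow_pos hr.1 2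
  have e : (r ^ 2)⁻¹ • (w (x + r • z) - w x - r • V x z) - (1 / 2 : ℝ) • W x z z
      = (r ^ 2)⁻¹ • φ r := by
    simp only [φ]
    rw [smul_sub _ _ ((r ^ 2 / 2) • W x z z), smul_smul,
      show (r ^ 2)⁻¹ * (r ^ 2 / 2) = 1 / 2 by
        rw [mul_div_assoc', inv_mul_cancel₀ hr2.ne']]
  rw [Real.dist_0_eq_abs, abs_of_nonneg (norm_nonneg _), e, norm_smul, norm_inv,
    Real.norm_of_nonneg hr2.le, inv_mul_lt_iff₀ hr2]
  nlinarith

/-- The generator of the heat semigroup is half the Laplacian. -/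
lemma tendsto_heat [CompleteSpace F] (hw : ∀ x, HasFDerivAt w (V x) x)
    (hV : ∀ x, HasFDerivAt V (W x) x) {M : ℝ} (hM : ∀ x, ‖W x‖ ≤ M) (x : Space d) :
    Tendsto (fun h : ℝ => h⁻¹ • ((∫ y, gk h (x - y) • w y) - w x)) (𝓝[>] 0)
      (𝓝 ((1 / 2 : ℝ) • tr (W x))) := by
  have hM0 : 0 ≤ M := (norm_nonneg (W 0)).trans (hM 0)
  have hwc : Continuous w := continuous_iff_continuousAt.2 fun x => (hw x).continuousAt
  -- After the substitution y = x + √h z the Gaussian is fixed and the first-order term integrates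
  -- to zero by symmetry. The remainder R is dominated by M|z|² and converges to ½ W(z,z).
  let R : ℝ → Space d → F := fun h z => h⁻¹ • (w (x + √h • z) - w x - √h • V x z)
  have hRc : ∀ h, Continuous (R h) := fun h => by fun_prop
  have hRb : ∀ h, 0 < h → ∀ z, ‖R h z‖ ≤ M * ‖z‖ ^ 2 := fun h hh z => by
    have h1 := norm_taylor_le hw hV hM x (√h • z)
    rw [map_smul, norm_smul, mul_pow, Real.norm_of_nonneg (Real.sqrt_nonneg h),
      Real.sq_sqrt hh.le] at h1
    rw [norm_smul, norm_inv, Real.norm_of_nonneg hh.le, inv_mul_le_iff₀ hh]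
    linarith
  have hlim : Tendsto (fun h => ∫ z, gk 1 z • R h z) (𝓝[>] 0)
      (𝓝 (∫ z, gk 1 z • ((1 / 2 : ℝ) • W x z z))) := by
    refine tendsto_integral_filter_of_dominated_convergence (fun z => M * (gk 1 z * ‖z‖ ^ 2))
      (.of_forall fun h => ((continuous_gk 1).smul (hRc h)).aestronglyMeasurable) ?_
      (integrable_gk_mul_sq.const_mul M) (ae_of_all _ fun z => ?_)
    · filter_upwards [self_mem_nhdsWithin] with h hh
      refine ae_of_all _ fun z => ?_
      rw [norm_smul, Real.norm_of_nonneg (gk_pos one_pos z).le]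
      have := hRb h hh z
      have := gk_pos one_pos z
      nlinarith
    · refine Tendsto.const_smul ?_ _
      have hs : Tendsto (fun h : ℝ => √h) (𝓝[>] 0) (𝓝[>] 0) := by
        refine tendsto_nhdsWithin_iff.2 ⟨?_, ?_⟩
        · have : Tendsto (fun h : ℝ => √h) (𝓝 0) (𝓝 √0) := Real.continuous_sqrt.tendsto 0
          rw [Real.sqrt_zero] at this
          exact this.mono_left nhdsWithin_le_nhds
        · filter_upwards [self_mem_nhdsWithin] with h hh using Real.sqrt_pos.2 hh
      refine ((tendsto_taylor hw (hV x) z).comp hs).congr' ?_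
      filter_upwards [self_mem_nhdsWithin] with h hh
      simp only [Function.comp, R, Real.sq_sqrt (le_of_lt hh)]
  have e : ∫ z, gk 1 z • ((1 / 2 : ℝ) • W x z z) = (1 / 2 : ℝ) • tr (W x) := by
    rw [← integral_gk_smul_apply_apply, ← integral_smul]
    congr 1; ext1 z; rw [smul_comm]
  rw [← e]
  refine hlim.congr' ?_
  filter_upwards [self_mem_nhdsWithin] with h hh
  have hh0 : (0 : ℝ) < h := hh
  have i1 : Integrable fun z => gk 1 z • R h z :=
    integrable_gk_smul_of_le (hRc h) (c := M) fun z => (hRb h hh z).trans (by nlinarith)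
  have i2 : Integrable fun z : Space d => gk 1 z • w x := (integrable_gk one_pos).smul_const _
  have i3 : Integrable fun z : Space d => gk 1 z • V x z :=
    integrable_gk_smul_of_le (by fun_prop) (c := ‖V x‖) fun z =>
      ((V x).le_opNorm z).trans (by gcongr; exact norm_le_one_add_sq z)
  have e2 : ∀ z, gk 1 z • w (x + √h • z)
      = h • (gk 1 z • R h z) + gk 1 z • w x + √h • (gk 1 z • V x z) := fun z => by
    simp only [R]
    rw [smul_comm h, smul_smul h, mul_inv_cancel₀ hh0.ne', one_smul, smul_comm (√h)]
    simp only [smul_sub]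
    abel
  have e3 : ∫ z, gk 1 z • w (x + √h • z) = h • (∫ z, gk 1 z • R h z) + w x := by
    simp_rw [e2]
    have j1 : Integrable fun z => h • (gk 1 z • R h z) := i1.smul h
    have j3 : Integrable fun z => √h • (gk 1 z • V x z) := i3.smul _
    have j12 : Integrable fun z => h • (gk 1 z • R h z) + gk 1 z • w x := j1.add i2
    rw [integral_add j12 j3, integral_add j1 i2, integral_smul,
      integral_smul, integral_gk_smul_clm, integral_smul_const, integral_gk one_pos, one_smul,
      smul_zero, add_zero]
  rw [integral_gk_smul hh0, e3, add_sub_cancel_right, smul_smul, inv_mul_cancel₀ hh0.ne', one_smul]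

end

end KatoPDE
end


/-! ### The time derivative of a heat potential. -/

open Set Filter Topology MeasureTheory
open scoped ENNReal NNReal BoundedContinuousFunction

noncomputable section

namespace KatoPDE

variable {d : ℕ} {F : Type*} [NormedAddCommGroup F] [NormedSpace ℝ F] [CompleteSpace F]

lemma integrable_gk_mul_gk {a b : ℝ} (ha : 0 < a) (hb : 0 < b) (x y : Space d) :
    Integrable fun z => gk a (x - z) * gk b (z - y) := by
  by_contra h
  have h1 := integral_gk_mul_gk ha hb x y
  rw [integral_undef h] at h1
  exact (gk_pos (add_pos ha hb) (x - y)).ne h1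

/-- The potential at an earlier time through the heat semigroup. -/
lemma Iop_kerq_sub {T : ℝ} (hT : T ≤ 1) {g : ℝ × Space d → F} (hg : Good T g) {t h : ℝ}
    (hh : 0 < h) (hth : h ≤ t) (htT : t ≤ T) (x : Space d) :
    Iop (kerq F) T g (t - h) x
      = (∫ p in Ioc (t - h) t ×ˢ univ, gk (p.1 - (t - h)) (x - p.2) • g p)
        + ∫ z, gk h (x - z) • Iop (kerq F) T g t z := by
  have hth0 : 0 ≤ t - h := sub_nonneg.2 hth
  have hint := isKer_kerq.integrable (F := F) hth0 hT hg.sm hg.fin x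
  have hU : Ioc (t - h) T ×ˢ (univ : Set (Space d))
      = Ioc (t - h) t ×ˢ univ ∪ Ioc t T ×ˢ univ := by
    rw [← union_prod, Ioc_union_Ioc_eq_Ioc (by linarith) htT]
  have hdisj : Disjoint (Ioc (t - h) t ×ˢ (univ : Set (Space d))) (Ioc t T ×ˢ univ) :=
    (Ioc_disjoint_Ioc_of_le le_rfl).set_prod_left _ _
  have hint1 := hint.mono_set (hU ▸ subset_union_left)
  have hint2 := hint.mono_set (hU ▸ subset_union_right)
  have hI : Iop (kerq F) T g (t - h) x
      = (∫ p in Ioc (t - h) t ×ˢ univ, gk (p.1 - (t - h)) (x - p.2) • g p)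
        + ∫ p in Ioc t T ×ˢ univ, gk (p.1 - (t - h)) (x - p.2) • g p := by
    rw [Iop, hU, setIntegral_union hdisj (measurableSet_strip measurableSet_Ioc) hint1 hint2]
    rfl
  rw [hI]
  congr 1
  -- For sources later than t, the kernel over time s - t + h factors through time t by
  -- Chapman–Kolmogorov; Fubini then exhibits the heat semigroup acting on the potential at time t.
  have hmeas : AEStronglyMeasurable
      (Function.uncurry fun (p : ℝ × Space d) (z : Space d) =>
        (gk h (x - z) * gk (p.1 - t) (z - p.2)) • g p)
      ((volume.restrict (Ioc t T ×ˢ univ)).prod volume) := by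
    refine StronglyMeasurable.aestronglyMeasurable ?_
    refine StronglyMeasurable.smul (Measurable.stronglyMeasurable ?_)
      (hg.sm.comp_measurable measurable_fst)
    have h1 : Measurable fun q : (ℝ × Space d) × Space d => gk h (x - q.2) :=
      (continuous_gk h).measurable.comp (by fun_prop)
    exact h1.mul (measurable_gk.comp (by fun_prop :
      Measurable fun q : (ℝ × Space d) × Space d => (q.1.1 - t, q.2 - q.1.2)))
  have hpos : ∀ p ∈ Ioc t T ×ˢ (univ : Set (Space d)), 0 < p.1 - t := fun p hp =>
    sub_pos.2 hp.1.1
  have hnorm : ∀ p ∈ Ioc t T ×ˢ (univ : Set (Space d)),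
      ∫ z, ‖(gk h (x - z) * gk (p.1 - t) (z - p.2)) • g p‖
        = ‖gk (p.1 - (t - h)) (x - p.2) • g p‖ := fun p hp => by
    simp_rw [norm_smul]
    rw [integral_mul_const]
    have e : p.1 - (t - h) = h + (p.1 - t) := by ring
    rw [Real.norm_of_nonneg (gk_pos (by rw [e]; linarith [hpos p hp]) _).le, e,
      ← integral_gk_mul_gk hh (hpos p hp)]
    congr 2
    ext z
    exact Real.norm_of_nonneg (mul_nonneg (gk_pos hh _).le (gk_pos (hpos p hp) _).le)
  have hprod : Integrable (Function.uncurry fun (p : ℝ × Space d) (z : Space d) =>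
        (gk h (x - z) * gk (p.1 - t) (z - p.2)) • g p)
      ((volume.restrict (Ioc t T ×ˢ univ)).prod volume) := by
    rw [integrable_prod_iff hmeas]
    constructor
    · refine ae_restrict_of_forall_mem (measurableSet_strip measurableSet_Ioc) fun p hp => ?_
      exact (integrable_gk_mul_gk hh (hpos p hp) x p.2).smul_const (g p)
    · refine hint2.norm.congr ?_
      refine ae_restrict_of_forall_mem (measurableSet_strip measurableSet_Ioc) fun p hp => ?_
      exact (hnorm p hp).symm
  calc ∫ p in Ioc t T ×ˢ univ, gk (p.1 - (t - h)) (x - p.2) • g p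
      = ∫ p in Ioc t T ×ˢ univ, ∫ z, (gk h (x - z) * gk (p.1 - t) (z - p.2)) • g p := by
        refine setIntegral_congr_fun (measurableSet_strip measurableSet_Ioc) fun p hp => ?_
        rw [integral_smul_const, integral_gk_mul_gk hh (hpos p hp)]
        congr 2
        ring
    _ = ∫ z, ∫ p in Ioc t T ×ˢ univ, (gk h (x - z) * gk (p.1 - t) (z - p.2)) • g p :=
        integral_integral_swap hprod
    _ = _ := by
        congr 1
        ext1 z
        simp_rw [mul_smul]
        rw [integral_smul]
        rfl

section

variable {g : ℝ × Space d → F} {c : ℝ≥0}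

/-- The rescaled form of the Gaussian average is continuous up to variance 0, where it equals g. -/
lemma continuous_integral_gk_smul (hg : Continuous g) (hc : ∀ p, ‖g p‖ ≤ c) (x : Space d) :
    Continuous fun q : ℝ × ℝ => ∫ z, gk 1 z • g (q.1, x + √q.2 • z) := by
  refine continuous_of_dominated (bound := fun z => gk 1 z * c)
    (fun q => ((continuous_gk 1).smul (by fun_prop)).aestronglyMeasurable)
    (fun q => ae_of_all _ fun z => ?_) ((integrable_gk one_pos).mul_const c)
    (ae_of_all _ fun z => by fun_prop)
  rw [norm_smul, Real.norm_of_nonneg (gk_pos one_pos z).le]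
  have := gk_pos one_pos z
  gcongr
  exact hc _

/-- Substituting s = t - h + hθ turns the quotient into an average over θ in [0,1] of a function
continuous in (h,θ). -/
lemma tendsto_short_time {T : ℝ} (hT0 : 0 < T) (hT : T ≤ 1) (hg : Continuous g)
    (hc : ∀ p, ‖g p‖ ≤ c) {t : ℝ} (ht : t ∈ Ioc 0 T) (x : Space d) :
    Tendsto (fun h : ℝ => h⁻¹ • ∫ p in Ioc (t - h) t ×ˢ univ, gk (p.1 - (t - h)) (x - p.2) • g p)
      (𝓝[>] 0) (𝓝 (g (t, x))) := by
  have hΦ := continuous_integral_gk_smul hg hc x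
  set Φ : ℝ × ℝ → F := fun q => ∫ z, gk 1 z • g (q.1, x + √q.2 • z) with hΦd
  have hgood : Good T g := Good.of_bounded hT0 hg.stronglyMeasurable (c := c) fun p => by
    rw [enorm_le_coe, ← NNReal.coe_le_coe]; exact hc p
  have h1 : Continuous fun h : ℝ => ∫ θ in (0 : ℝ)..1, Φ (h * θ + (t - h), h * θ) :=
    intervalIntegral.continuous_parametric_intervalIntegral_of_continuous'
      (f := fun h θ => Φ (h * θ + (t - h), h * θ))
      (hΦ.comp (by fun_prop : Continuous fun q : ℝ × ℝ => (q.1 * q.2 + (t - q.1), q.1 * q.2))) 0 1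
  have h2 := (h1.tendsto 0).mono_left (nhdsWithin_le_nhds (s := Ioi 0))
  have e0 : ∫ θ in (0 : ℝ)..1, Φ ((0 : ℝ) * θ + (t - 0), (0 : ℝ) * θ) = g (t, x) := by
    simp only [zero_mul, sub_zero, zero_add, hΦd, Real.sqrt_zero, zero_smul, add_zero]
    rw [integral_smul_const, integral_gk one_pos, one_smul, intervalIntegral.integral_const,
      sub_zero, one_smul]
  rw [e0] at h2
  refine h2.congr' ?_
  filter_upwards [Ioc_mem_nhdsGT ht.1] with h hh
  have hint := (isKer_kerq.integrable (F := F) (sub_nonneg.2 hh.2) hT hgood.sm hgood.fin x).mono_set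
    (prod_mono_left (Ioc_subset_Ioc_right ht.2) : Ioc (t - h) t ×ˢ univ ⊆ _)
  have h3 := setIntegral_prod _ hint
  have h4 : ∫ p in Ioc (t - h) t ×ˢ univ, gk (p.1 - (t - h)) (x - p.2) • g p
      = ∫ s in Ioc (t - h) t, Φ (s, s - (t - h)) := by
    refine Eq.trans h3 (setIntegral_congr_fun measurableSet_Ioc fun s hs => ?_)
    simp only [Measure.restrict_univ]
    exact integral_gk_smul (sub_pos.2 hs.1) (fun y => g (s, y)) x
  rw [h4, ← intervalIntegral.integral_of_le (by linarith [hh.1])]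
  have h5 := intervalIntegral.smul_integral_comp_mul_add (a := 0) (b := 1)
    (fun s => Φ (s, s - (t - h))) h (t - h)
  rw [mul_zero, zero_add, mul_one, add_sub_cancel] at h5
  rw [← h5, smul_smul, inv_mul_cancel₀ hh.1.ne', one_smul]
  congr 1
  ext1 θ
  rw [add_sub_cancel_right]

variable {T : ℝ} {V : ℝ → Space d → Space d →L[ℝ] F}
  {W : ℝ → Space d → Space d →L[ℝ] Space d →L[ℝ] F}

lemma continuous_tr : Continuous (tr : (Space d →L[ℝ] Space d →L[ℝ] F) → F) := by
  unfold tr; fun_prop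

/-- The backward heat equation with source `g` for the potential of `g`. -/
lemma hasDerivWithinAt_Iop_kerq (hT0 : 0 < T) (hT : T ≤ 1) (hg : Continuous g)
    (hc : ∀ p, ‖g p‖ ≤ c) (hV : ∀ t ∈ Icc 0 T, ∀ x, HasFDerivAt (Iop (kerq F) T g t) (V t x) x)
    (hW : ∀ t ∈ Icc 0 T, ∀ x, HasFDerivAt (V t) (W t x) x) {M : ℝ}
    (hM : ∀ t ∈ Icc 0 T, ∀ x, ‖W t x‖ ≤ M)
    (hWc : ∀ x, ContinuousOn (fun t => W t x) (Icc 0 T)) {t : ℝ} (ht : t ∈ Icc 0 T)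
    (x : Space d) :
    HasDerivWithinAt (fun t => Iop (kerq F) T g t x) (-((1 / 2 : ℝ) • tr (W t x) + g (t, x)))
      (Icc 0 T) t := by
  have hgood : Good T g := Good.of_bounded hT0 hg.stronglyMeasurable (c := c) fun p => by
    rw [enorm_le_coe, ← NNReal.coe_le_coe]; exact hc p
  set m : ℝ → F := fun t => (1 / 2 : ℝ) • tr (W t x) + g (t, x) with hm
  have hmc : ContinuousOn m (Icc 0 T) :=
    ((continuous_tr.comp_continuousOn (hWc x)).const_smul _).add (by fun_prop)
  -- The increment from t to t - h is the short-time source plus the heat semigroup minus the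
  -- identity applied to the potential at t. Only backward increments are accessible this way, so
  -- time is reversed below to obtain right derivatives.
  have hright : ∀ t ∈ Ioc 0 T, Tendsto (fun h : ℝ => h⁻¹ • (Iop (kerq F) T g (t - h) x
      - Iop (kerq F) T g t x)) (𝓝[>] 0) (𝓝 (m t)) := by
    intro t ht
    have h1 := tendsto_heat (hV t ⟨ht.1.le, ht.2⟩) (hW t ⟨ht.1.le, ht.2⟩) (hM t ⟨ht.1.le, ht.2⟩) x
    refine (h1.add (tendsto_short_time hT0 hT hg hc ht x)).congr' ?_
    filter_upwards [Ioc_mem_nhdsGT ht.1] with h hh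
    rw [Iop_kerq_sub hT hgood hh.1 hh.2 ht.2, ← smul_add]
    congr 1
    abel
  let y : ℝ → F := fun r => Iop (kerq F) T g (T - r) x
  have hyc : ContinuousOn (fun t => Iop (kerq F) T g t x) (Icc 0 T) :=
    (isKer_kerq.continuousOn_Iop hT hgood).comp (f := fun t => (t, x)) (by fun_prop)
      fun t ht => ⟨ht, mem_univ _⟩
  have hyd : ∀ r ∈ Ico 0 T, HasDerivWithinAt y (m (T - r)) (Ioi r) r := by
    intro r hr
    rw [hasDerivWithinAt_iff_tendsto_slope' (by simp)]
    have h1 : Tendsto (fun s => s - r) (𝓝[>] r) (𝓝[>] 0) := by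
      refine tendsto_nhdsWithin_iff.2 ⟨?_, ?_⟩
      · have : Tendsto (fun s => s - r) (𝓝 r) (𝓝 (r - r)) := (continuous_sub_right r).tendsto r
        rw [sub_self] at this
        exact this.mono_left nhdsWithin_le_nhds
      · filter_upwards [self_mem_nhdsWithin] with s hs using sub_pos.2 (mem_Ioi.1 hs)
    refine ((hright (T - r) ⟨by linarith [hr.2], by linarith [hr.1]⟩).comp h1).congr fun s => ?_
    simp only [Function.comp, slope_def_module, y]
    rw [show T - r - (s - r) = T - s by ring]
  have hmap : MapsTo (fun r => T - r) (Icc 0 T) (Icc 0 T) := fun r hr =>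
    ⟨by linarith [hr.2], by linarith [hr.1]⟩
  have hmc' : ContinuousOn (fun r => m (T - r)) (Icc 0 T) :=
    hmc.comp (by fun_prop) hmap
  have hyc' : ContinuousOn y (Icc 0 T) :=
    hyc.comp (f := fun r => T - r) (by fun_prop) hmap
  -- A continuous function with continuous right derivative is the integral of that derivative; this
  -- upgrades the one-sided limit to a genuine derivative. The constant extension of m outside [0,T]
  -- takes care of the endpoints.
  have hkey : ∀ t ∈ Icc 0 T, Iop (kerq F) T g t x
      = Iop (kerq F) T g T x - ∫ s in T..t, IccExtend hT0.le ((Icc 0 T).domRestrict m) s := by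
    intro t ht
    have hsub : Icc 0 (T - t) ⊆ Icc 0 T := Icc_subset_Icc_right (by linarith [ht.1])
    have h1 := intervalIntegral.integral_eq_sub_of_hasDeriv_right_of_le (a := 0) (b := T - t)
      (by linarith [ht.2]) (hyc'.mono hsub)
      (fun r hr => hyd r ⟨hr.1.le, by linarith [hr.2, ht.1]⟩)
      ((hmc'.mono hsub).intervalIntegrable_of_Icc (by linarith [ht.2]))
    rw [intervalIntegral.integral_comp_sub_left m T, sub_sub_cancel, sub_zero] at h1
    simp only [y, sub_sub_cancel, sub_zero] at h1
    rw [intervalIntegral.integral_symm, sub_neg_eq_add, ← sub_eq_iff_eq_add', ← h1]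
    refine intervalIntegral.integral_congr fun s hs => ?_
    rw [uIcc_of_le ht.2] at hs
    exact (IccExtend_of_mem hT0.le ((Icc 0 T).domRestrict m) ⟨ht.1.trans hs.1, hs.2⟩).symm
  have hext : Continuous (IccExtend hT0.le ((Icc 0 T).domRestrict m)) :=
    (continuousOn_iff_continuous_domRestrict.1 hmc).Icc_extend'
  have h2 : HasDerivAt (fun t => ∫ s in T..t, IccExtend hT0.le ((Icc 0 T).domRestrict m) s) (m t) t := by
    have := hext.integral_hasStrictDerivAt T t
    rw [IccExtend_of_mem hT0.le _ ht] at this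
    exact this.hasDerivAt
  exact (h2.const_sub _).hasDerivWithinAt.congr hkey (hkey t ht)

end

end KatoPDE
end


/-! ### Existence of classical solutions for smooth coefficients. -/

open Set Filter Topology MeasureTheory
open scoped ENNReal NNReal BoundedContinuousFunction

noncomputable section

namespace KatoPDE

variable {d : ℕ} {F : Type*} [NormedAddCommGroup F] [NormedSpace ℝ F]

lemma contDiff_two_of_hasFDerivAt {w : Space d → F} {V : Space d → Space d →L[ℝ] F}
    {W : Space d → Space d →L[ℝ] Space d →L[ℝ] F} (hw : ∀ x, HasFDerivAt w (V x) x)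
    (hV : ∀ x, HasFDerivAt V (W x) x) (hW : Continuous W) : ContDiff ℝ 2 w := by
  have h1 : ContDiff ℝ 1 V := contDiff_one_iff_hasFDerivAt.2 ⟨W, hW, hV⟩
  have e : (2 : WithTop ℕ∞) = 1 + 1 := by norm_num
  rw [e]
  refine contDiff_succ_iff_hasFDerivAt.2 ⟨V, h1, hw⟩

lemma laplacian_eq_tr {w : Space d → F} {V : Space d → Space d →L[ℝ] F}
    {W : Space d →L[ℝ] Space d →L[ℝ] F} (hw : ∀ x, HasFDerivAt w (V x) x) {x : Space d}
    (hV : HasFDerivAt V W x) : Laplacian.laplacian w x = tr W := by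
  have h := congrFun (InnerProductSpace.laplacian_eq_iteratedFDeriv_orthonormalBasis w
    (EuclideanSpace.basisFun (Fin d) ℝ)) x
  have e : fderiv ℝ w = V := funext fun x => (hw x).fderiv
  rw [h, tr]
  refine Finset.sum_congr rfl fun i _ => ?_
  rw [iteratedFDeriv_two_apply, e, hV.fderiv]
  simp

/-- The equation only involves times in (0,T), so b' and f' need to agree with the smooth
coefficients only there. This accommodates mollifications of untruncated coefficients. -/
lemma exists_isFix_isClassicalSolution {T : ℝ} {b f : ℝ × Space d → Space d} (hT0 : 0 < T)
    (hT : T ≤ 1) (hb : SmoothBdd b) (hf : SmoothBdd f) (hb4 : CE * kN b T ≤ 1 / 4) :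
    ∃ V : Slab d T →ᵇ (Space d →L[ℝ] Space d), IsFix hT0.le b f V ∧
      ∀ b' f' : ℝ → Space d → Space d, (∀ t ∈ Ioo 0 T, ∀ x, b' t x = b (t, x)) →
        (∀ t ∈ Ioo 0 T, ∀ x, f' t x = f (t, x)) →
        IsClassicalSolution b' f' T (Iop (kerq (Space d)) T (src hT0.le b f V)) := by
  obtain ⟨V, W, hfix, hW⟩ := exists_isFix_hasFDerivAt hT0 hT hb hf hb4
  have gb := hb.good hT0
  have gf := hf.good hT0
  refine ⟨V, hfix, fun b' f' hb' hf' => ?_⟩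
  set g := src hT0.le b f V with hg
  set u := Iop (kerq (Space d)) T g with hu
  -- The Hessian is retyped from `Hess d` to iterated continuous linear maps, the form in which
  -- second derivatives and `tr` are expressed.
  obtain ⟨W', hW'⟩ : ∃ W' : ℝ × Space d → Space d →L[ℝ] Space d →L[ℝ] Space d,
    W' = lift hT0.le W := ⟨_, rfl⟩
  have hWc : Continuous W' := hW' ▸ continuous_lift hT0.le W
  have hWb : ∀ p, ‖W' p‖ ≤ ‖W‖ := fun p => hW' ▸ W.norm_coe_le_norm _
  have hVc : Continuous (lift hT0.le V) := continuous_lift hT0.le V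
  have hgc : Continuous g := (hVc.clm_apply hb.contDiff.continuous).sub hf.contDiff.continuous
  obtain ⟨c, hc⟩ : ∃ c : ℝ≥0, ∀ p, ‖g p‖ ≤ c := by
    obtain ⟨c₁, h1⟩ := hb.bdd
    obtain ⟨c₂, h2⟩ := hf.bdd
    refine ⟨‖V‖₊ * c₁ + (1 : ℝ≥0) * c₂, fun p => ?_⟩
    have h : ‖g p‖ₑ ≤ ((‖V‖₊ * c₁ + (1 : ℝ≥0) * c₂ : ℝ≥0) : ℝ≥0∞) := by
      push_cast
      refine (enorm_src_le hT0.le V p).trans ?_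
      push_cast
      gcongr
      · exact h1 p
      · exact h2 p
    rwa [enorm_le_coe, ← NNReal.coe_le_coe] at h
  have hV1 : ∀ t ∈ Icc 0 T, ∀ x, HasFDerivAt (u t) (lift hT0.le V (t, x)) x := fun t ht x => by
    rw [lift_of_mem hT0.le V ht]
    exact hfix.hasFDerivAt hT gb gf ht x
  have hW1 : ∀ t ∈ Icc 0 T, ∀ x, HasFDerivAt (fun x => lift hT0.le V (t, x)) (W' (t, x)) x :=
    fun t ht x => by
      rw [hW', lift_of_mem hT0.le W ht]
      simp only [lift_of_mem hT0.le V ht]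
      exact hW t ht x
  have htime : ∀ t ∈ Icc 0 T, ∀ x, HasDerivWithinAt (fun t => u t x)
      (-((1 / 2 : ℝ) • tr (W' (t, x)) + g (t, x))) (Icc 0 T) t := fun t ht x =>
    hasDerivWithinAt_Iop_kerq (V := fun t x => lift hT0.le V (t, x)) (W := fun t x => W' (t, x))
      hT0 hT hgc hc hV1 hW1 (fun t _ x => hWb (t, x))
      (fun x => (hWc.comp (by fun_prop : Continuous fun t : ℝ => (t, x))).continuousOn) ht x
  have hfd : ∀ t ∈ Icc 0 T, fderiv ℝ (u t) = fun x => lift hT0.le V (t, x) := fun t ht =>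
    funext fun x => (hV1 t ht x).fderiv
  have hmc : Continuous fun p => -((1 / 2 : ℝ) • tr (W' p) + g p) := by
    have h1 : Continuous fun p => tr (W' p) := continuous_tr.comp hWc
    have h2 : Continuous fun p => (1 / 2 : ℝ) • tr (W' p) := by fun_prop
    exact (h2.add hgc).neg
  have hcb := hfix.isCb01 hT gb gf hb4
  refine ⟨⟨hcb.continuousOn, fun x t ht => (htime t ht x).differentiableWithinAt, ?_, ?_,
    hcb.continuousOn_fderiv, ?_⟩, hcb, ?_, ?_⟩
  · refine ContinuousOn.congr hmc.continuousOn fun p hp => ?_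
    exact (htime p.1 hp.1 p.2).derivWithin (uniqueDiffOn_Icc hT0 p.1 hp.1)
  · intro t ht
    exact contDiff_two_of_hasFDerivAt (hV1 t ht) (hW1 t ht) (hWc.comp (by fun_prop))
  · refine hWc.continuousOn.congr fun p hp => ?_
    rw [hfd p.1 hp.1]
    exact (hW1 p.1 hp.1 p.2).fderiv
  · intro t ht x
    have ht' : t ∈ Icc 0 T := Ioo_subset_Icc_self ht
    rw [((htime t ht' x).hasDerivAt (Icc_mem_nhds ht.1 ht.2)).deriv,
      laplacian_eq_tr (hV1 t ht') (hW1 t ht' x), hfd t ht', hb' t ht, hf' t ht, hg, src]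
    abel
  · intro x
    simp [hu, Iop]

end KatoPDE
end


/-! ### The maximum principle and uniqueness of classical solutions. -/

open Set Filter Topology MeasureTheory
open scoped ENNReal NNReal BoundedContinuousFunction

noncomputable section

namespace KatoPDE

variable {d : ℕ}

/-- If a were positive the point would also be a local minimum, so p would be locally constant and a
would vanish. -/
lemma deriv_two_nonpos_of_isLocalMax {p p' : ℝ → ℝ} {a : ℝ} (h1 : ∀ r, HasDerivAt p (p' r) r)
    (h2 : HasDerivAt p' a 0) (hm : IsLocalMax p 0) : a ≤ 0 := by
  by_contra! ha
  have e : deriv p = p' := funext fun r => (h1 r).deriv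
  have hmin : IsLocalMin p 0 := isLocalMin_of_deriv_deriv_pos (by rwa [e, h2.deriv])
    (by rw [e, hm.hasDerivAt_eq_zero (h1 0)]) (h1 0).continuousAt
  have hconst : p =ᶠ[𝓝 0] fun _ => p 0 := by
    filter_upwards [hm, hmin] with r h h' using le_antisymm h h'
  have h3 := hconst.deriv.deriv_eq
  rw [e, h2.deriv] at h3
  simp at h3
  exact ha.ne' h3

/-- Only later times are compared, because the maximum over [t,T] may be attained at the left
endpoint. -/
lemma deriv_nonpos_of_right_max {q : ℝ → ℝ} {a s T : ℝ} (h : HasDerivAt q a s) (hs : s < T)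
    (hm : ∀ r ∈ Ioo s T, q r ≤ q s) : a ≤ 0 := by
  have h1 := (hasDerivWithinAt_iff_tendsto_slope' (by simp)).1 (h.hasDerivWithinAt (s := Ioi s))
  refine le_of_tendsto h1 ?_
  filter_upwards [Ioo_mem_nhdsGT hs] with r hr
  rw [slope_def_field]
  exact div_nonpos_of_nonpos_of_nonneg (sub_nonpos.2 (hm r hr)) (sub_nonneg.2 hr.1.le)

/-- At a spatial maximum of `ω - c (1 + |·|²)`. -/
lemma spatial_max {ω : Space d → ℝ} {D : Space d → Space d →L[ℝ] ℝ}
    {H : Space d →L[ℝ] Space d →L[ℝ] ℝ} {c : ℝ} {y : Space d}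
    (hD : ∀ x, HasFDerivAt ω (D x) x) (hH : HasFDerivAt D H y)
    (hm : IsLocalMax (fun x => ω x - c * (1 + ‖x‖ ^ 2)) y) :
    (∀ v, D y v = 2 * c * inner ℝ y v) ∧ tr H ≤ 2 * c * d := by
  have hline : ∀ e : Space d, ∀ r : ℝ, HasDerivAt (fun r : ℝ => y + r • e) e r := fun e r => by
    simpa using ((hasDerivAt_id r).smul_const e).const_add y
  let p : Space d → ℝ → ℝ := fun e r =>
    ω (y + r • e) - c * (1 + (‖y‖ ^ 2 + 2 * (r * inner ℝ y e) + r ^ 2 * ‖e‖ ^ 2))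
  let p' : Space d → ℝ → ℝ := fun e r =>
    D (y + r • e) e - c * (2 * inner ℝ y e + 2 * r * ‖e‖ ^ 2)
  have hp : ∀ e r, p e r = ω (y + r • e) - c * (1 + ‖y + r • e‖ ^ 2) := fun e r => by
    simp only [p]
    rw [norm_add_sq_real, inner_smul_right, norm_smul, mul_pow, Real.norm_eq_abs, sq_abs]
  have hpd : ∀ e r, HasDerivAt (p e) (p' e r) r := fun e r => by
    have h1 := (hD (y + r • e)).comp_hasDerivAt r (hline e r)
    have h2 : HasDerivAt (fun r : ℝ => c * (1 + (‖y‖ ^ 2 + 2 * (r * inner ℝ y e)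
        + r ^ 2 * ‖e‖ ^ 2))) (c * (2 * inner ℝ y e + 2 * r * ‖e‖ ^ 2)) r := by
      have h3 : HasDerivAt (fun r : ℝ => 2 * (r * inner ℝ y e)) (2 * inner ℝ y e) r := by
        simpa using ((hasDerivAt_id r).mul_const (inner ℝ y e)).const_mul 2
      have h4 : HasDerivAt (fun r : ℝ => r ^ 2 * ‖e‖ ^ 2) (2 * r * ‖e‖ ^ 2) r := by
        simpa using (hasDerivAt_pow 2 r).mul_const (‖e‖ ^ 2)
      exact (((h3.const_add (‖y‖ ^ 2)).add h4).const_add 1).const_mul c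
    exact h1.sub h2
  have hpm : ∀ e, IsLocalMax (p e) 0 := fun e => by
    have hc : ContinuousAt (fun r : ℝ => y + r • e) 0 := (hline e 0).continuousAt
    have hc' : Tendsto (fun r : ℝ => y + r • e) (𝓝 0) (𝓝 y) := by
      simpa [ContinuousAt] using hc
    filter_upwards [hc'.eventually hm] with r hr
    rw [hp, hp, zero_smul, add_zero]
    exact hr
  have hpd2 : ∀ e, HasDerivAt (p' e) (H e e - c * (2 * ‖e‖ ^ 2)) 0 := fun e => by
    have h1 : HasFDerivAt D H (y + (0 : ℝ) • e) := by rwa [zero_smul, add_zero]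
    have h2 := h1.comp_hasDerivAt (0 : ℝ) (hline e 0)
    have h3 := ((ContinuousLinearMap.apply ℝ ℝ e).hasFDerivAt).comp_hasDerivAt (0 : ℝ) h2
    have h4 : HasDerivAt (fun r : ℝ => c * (2 * inner ℝ y e + 2 * r * ‖e‖ ^ 2))
        (c * (2 * ‖e‖ ^ 2)) 0 := by
      have : HasDerivAt (fun r : ℝ => 2 * r * ‖e‖ ^ 2) (2 * ‖e‖ ^ 2) 0 := by
        simpa using ((hasDerivAt_id (0 : ℝ)).const_mul 2).mul_const (‖e‖ ^ 2)
      exact (this.const_add _).const_mul c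
    exact h3.sub h4
  constructor
  · intro v
    have h := (hpm v).hasDerivAt_eq_zero (hpd v 0)
    simp only [p', zero_smul, add_zero, mul_zero, zero_mul] at h
    linarith
  · have h : ∀ i : Fin d, H (EuclideanSpace.single i 1) (EuclideanSpace.single i 1) ≤ 2 * c :=
      fun i => by
        have := deriv_two_nonpos_of_isLocalMax (hpd _) (hpd2 (EuclideanSpace.single i 1)) (hpm _)
        rw [PiLp.norm_single, norm_one] at this
        linarith
    refine (Finset.sum_le_sum fun i _ => h i).trans ?_
    simp [mul_comm]

/-- The parabolic maximum principle for bounded functions. -/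
lemma max_principle {T B N : ℝ} {ω ωt : ℝ → Space d → ℝ} {D : ℝ → Space d → Space d →L[ℝ] ℝ}
    {H : ℝ → Space d → Space d →L[ℝ] Space d →L[ℝ] ℝ} {β : ℝ → Space d → Space d}
    (hcont : ContinuousOn (Function.uncurry ω) (Icc 0 T ×ˢ univ))
    (hN : ∀ t ∈ Icc 0 T, ∀ x, ω t x ≤ N) (hterm : ∀ x, ω T x ≤ 0)
    (ht : ∀ t ∈ Ioo 0 T, ∀ x, HasDerivAt (fun s => ω s x) (ωt t x) t)
    (hD : ∀ t ∈ Ioo 0 T, ∀ x, HasFDerivAt (ω t) (D t x) x)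
    (hH : ∀ t ∈ Ioo 0 T, ∀ x, HasFDerivAt (D t) (H t x) x)
    (hβ : ∀ t ∈ Ioo 0 T, ∀ x, ‖β t x‖ ≤ B)
    (heq : ∀ t ∈ Ioo 0 T, ∀ x, 0 ≤ ωt t x + 1 / 2 * tr (H t x) + D t x (β t x))
    {t : ℝ} (htT : t ∈ Ioc 0 T) (x : Space d) : ω t x ≤ 0 := by
  rcases eq_or_lt_of_le htT.2 with rfl | htT'
  · exact hterm x
  have hB : 0 ≤ B := (norm_nonneg _).trans (hβ t ⟨htT.1, htT'⟩ x)
  -- The barrier e^{K(T-s)}(1+|x|²) is a strict supersolution: half its Laplacian contributes d, the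
  -- drift at most B(1+|x|²) since 2|x| ≤ 1+|x|², and the extra 1 makes the inequality strict.
  set K : ℝ := d + B + 1 with hK
  have hK0 : 0 < K := by positivity
  let E : ℝ → ℝ := fun s => Real.exp (K * (T - s))
  have hE1 : ∀ s ≤ T, 1 ≤ E s := fun s hs =>
    Real.one_le_exp (mul_nonneg hK0.le (sub_nonneg.2 hs))
  have main : ∀ ε > 0, ω t x ≤ ε * (E t * (1 + ‖x‖ ^ 2)) := by
    intro ε hε
    by_contra! hlt
    let Ψ : ℝ × Space d → ℝ := fun p => ω p.1 p.2 - ε * (E p.1 * (1 + ‖p.2‖ ^ 2))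
    -- R is so large that the barrier exceeds the bound N on |y| = R, which forces a positive
    -- maximum into the open ball.
    obtain ⟨R, hR0, hRx, hRN⟩ : ∃ R : ℝ, 0 ≤ R ∧ ‖x‖ ≤ R ∧ N ≤ ε * R ^ 2 := by
      refine ⟨max ‖x‖ (max 1 (N / ε)), by positivity, le_max_left _ _, ?_⟩
      set R := max ‖x‖ (max 1 (N / ε))
      have h1 : 1 ≤ R := (le_max_left _ _).trans (le_max_right _ _)
      have h2 : N / ε ≤ R := (le_max_right _ _).trans (le_max_right _ _)
      rw [div_le_iff₀ hε] at h2
      have h3 : R * 1 ≤ R * R := by gcongr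
      calc N ≤ ε * (R * 1) := by linarith
        _ ≤ ε * R ^ 2 := by rw [pow_two]; gcongr
    have hsub : Icc t T ×ˢ Metric.closedBall (0 : Space d) R ⊆ Icc 0 T ×ˢ univ :=
      prod_mono (Icc_subset_Icc_left htT.1.le) (subset_univ _)
    have hΨc : ContinuousOn Ψ (Icc t T ×ˢ Metric.closedBall 0 R) := by
      refine (hcont.mono hsub).sub (Continuous.continuousOn ?_)
      simp only [E]
      fun_prop
    have hxm : (t, x) ∈ Icc t T ×ˢ Metric.closedBall (0 : Space d) R :=
      ⟨⟨le_rfl, htT.2⟩, by simpa using hRx⟩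
    obtain ⟨⟨s, y⟩, ⟨hs, hy⟩, hmax⟩ :=
      (isCompact_Icc.prod (isCompact_closedBall (0 : Space d) R)).exists_isMaxOn ⟨_, hxm⟩ hΨc
    simp only at hs hy
    have hΨ0 : 0 < Ψ (s, y) := lt_of_lt_of_le (sub_pos.2 hlt) (hmax hxm)
    have hEs := hE1 s hs.2
    have hy' : ‖y‖ ≤ R := by simpa using hy
    have hsT : s < T := by
      refine lt_of_le_of_ne hs.2 fun h => ?_
      have h1 : ω s y ≤ 0 := by rw [h]; exact hterm y
      have h2 : 0 ≤ ε * (E s * (1 + ‖y‖ ^ 2)) := by positivity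
      simp only [Ψ] at hΨ0
      linarith
    have hyR : ‖y‖ < R := by
      refine lt_of_le_of_ne hy' fun h => ?_
      have h1 := hN s ⟨htT.1.le.trans hs.1, hs.2⟩ y
      have h2 : ε * (1 * (1 + R ^ 2)) ≤ ε * (E s * (1 + ‖y‖ ^ 2)) := by rw [h]; gcongr
      simp only [Ψ] at hΨ0
      nlinarith
    have hs0 : s ∈ Ioo 0 T := ⟨htT.1.trans_le hs.1, hsT⟩
    set c := ε * E s with hc
    have hc0 : 0 < c := by positivity
    have hspace : IsLocalMax (fun z => ω s z - c * (1 + ‖z‖ ^ 2)) y := by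
      have : Metric.ball (0 : Space d) R ∈ 𝓝 y := Metric.isOpen_ball.mem_nhds (by simpa using hyR)
      filter_upwards [this] with z hz
      have := hmax (⟨hs, Metric.ball_subset_closedBall hz⟩ :
        (s, z) ∈ Icc t T ×ˢ Metric.closedBall (0 : Space d) R)
      simp only [Ψ, mem_ofPred_eq, ← mul_assoc] at this
      exact this
    obtain ⟨hgrad, hlap⟩ := spatial_max (hD s hs0) (hH s hs0 y) hspace
    have htime : ωt s y + c * K * (1 + ‖y‖ ^ 2) ≤ 0 := by
      have hEd : HasDerivAt E (-(K * E s)) s := by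
        have h1 : HasDerivAt (fun s => K * (T - s)) (K * -1) s :=
          ((hasDerivAt_id s).const_sub T).const_mul K
        convert h1.exp using 1
        simp only [E]; ring
      have h1 := (ht s hs0 y).sub ((hEd.mul_const (1 + ‖y‖ ^ 2)).const_mul ε)
      have h2 := deriv_nonpos_of_right_max h1 hsT fun r hr => by
        have := hmax (⟨⟨hs.1.trans hr.1.le, hr.2.le⟩, hy⟩ :
          (r, y) ∈ Icc t T ×ˢ Metric.closedBall (0 : Space d) R)
        exact this
      rw [hc]
      linarith
    have hin : inner ℝ y (β s y) ≤ ‖y‖ * B :=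
      (real_inner_le_norm _ _).trans (by gcongr; exact hβ s hs0 y)
    have h0 := heq s hs0 y
    rw [hgrad] at h0
    have h1 : ‖y‖ * B ≤ B * (1 + ‖y‖ ^ 2) / 2 := by nlinarith [sq_nonneg (‖y‖ - 1)]
    have h2 : 2 * c * inner ℝ y (β s y) ≤ c * (B * (1 + ‖y‖ ^ 2)) := by nlinarith
    have hd0 : (0 : ℝ) ≤ d := Nat.cast_nonneg d
    have h3 : c * d ≤ c * (d * (1 + ‖y‖ ^ 2)) := by
      gcongr
      nlinarith [sq_nonneg ‖y‖]
    have h4 : c * K * (1 + ‖y‖ ^ 2)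
        = c * (d * (1 + ‖y‖ ^ 2)) + c * (B * (1 + ‖y‖ ^ 2)) + c * (1 + ‖y‖ ^ 2) := by
      rw [hK]; ring
    have h5 : 0 < c * (1 + ‖y‖ ^ 2) := by positivity
    linarith
  have hlim : Tendsto (fun ε : ℝ => ε * (E t * (1 + ‖x‖ ^ 2))) (𝓝[>] 0) (𝓝 0) := by
    have : Tendsto (fun ε : ℝ => ε * (E t * (1 + ‖x‖ ^ 2))) (𝓝 0) (𝓝 (0 * (E t * (1 + ‖x‖ ^ 2)))) :=
      (continuous_mul_const _).tendsto 0
    rw [zero_mul] at this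
    exact this.mono_left nhdsWithin_le_nhds
  refine ge_of_tendsto hlim ?_
  filter_upwards [self_mem_nhdsWithin] with ε hε using main ε hε

lemma IsCb01.exists_bound {T : ℝ} {u : ℝ → Space d → Space d} (hu : IsCb01 T u) :
    ∃ N : ℝ, ∀ t ∈ Icc 0 T, ∀ x, ‖u t x‖ ≤ N := by
  refine ⟨(c01Norm T univ u).toReal, fun t ht x => ?_⟩
  have h1 : ‖u t x‖ₑ ≤ c01Norm T univ u := by
    refine le_trans ?_ le_self_add
    exact le_trans (le_iSup₂ (f := fun x (_ : x ∈ (univ : Set (Space d))) => ‖u t x‖ₑ) x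
      (mem_univ _)) (le_iSup₂ (f := fun t (_ : t ∈ Icc 0 T) => ⨆ x ∈ (univ : Set (Space d)),
        ‖u t x‖ₑ) t ht)
  have h' := ENNReal.toReal_mono hu.norm_lt_top.ne h1
  rwa [toReal_enorm] at h'

lemma tr_compL (L : Space d →L[ℝ] ℝ) (A : Space d →L[ℝ] Space d →L[ℝ] Space d) :
    tr ((ContinuousLinearMap.compL ℝ (Space d) (Space d) ℝ L).comp A) = L (tr A) := by
  simp [tr]

/-- The drift acts in the same way on every component, so each scalar projection L(v - u) solves the
homogeneous equation and the scalar maximum principle applies. Pairing v - u with its own value at a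
point makes it vanish there; time 0 follows by continuity. -/
lemma IsClassicalSolution.unique {T B : ℝ} {b f u v : ℝ → Space d → Space d} (hT0 : 0 < T)
    (hB : ∀ t ∈ Ioo 0 T, ∀ x, ‖b t x‖ ≤ B) (hu : IsClassicalSolution b f T u)
    (hv : IsClassicalSolution b f T v) {t : ℝ} (ht : t ∈ Icc 0 T) (x : Space d) :
    v t x = u t x := by
  obtain ⟨N₁, h1⟩ := hu.isCb01.exists_bound
  obtain ⟨N₂, h2⟩ := hv.isCb01.exists_bound
  have hdt : ∀ {w : ℝ → Space d → Space d}, IsClassicalSolution b f T w → ∀ t ∈ Ioo 0 T, ∀ x,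
      HasDerivAt (fun s => w s x) (deriv (fun s => w s x) t) t := fun hw t ht x =>
    ((hw.isC12.differentiable_time x).differentiableAt (Icc_mem_nhds ht.1 ht.2)).hasDerivAt
  have hdx : ∀ {w : ℝ → Space d → Space d}, IsClassicalSolution b f T w → ∀ t ∈ Ioo 0 T, ∀ x,
      HasFDerivAt (w t) (fderiv ℝ (w t) x) x := fun hw t ht x =>
    (hw.isCb01.differentiable t (Ioo_subset_Icc_self ht) x).hasFDerivAt
  have hdxx : ∀ {w : ℝ → Space d → Space d}, IsClassicalSolution b f T w → ∀ t ∈ Ioo 0 T, ∀ x,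
      HasFDerivAt (fderiv ℝ (w t)) (fderiv ℝ (fderiv ℝ (w t)) x) x := fun hw t ht x => by
    have h := (hw.isC12.contDiff_space t (Ioo_subset_Icc_self ht)).fderiv_right
      (m := 1) (by norm_num)
    exact (h.differentiable one_ne_zero x).hasFDerivAt
  have key : ∀ L : Space d →L[ℝ] ℝ, ∀ t ∈ Ioc 0 T, ∀ x, L (v t x - u t x) ≤ 0 := by
    intro L t ht x
    refine max_principle (N := ‖L‖ * (N₂ + N₁)) (B := B) (T := T) (β := b)
      (ω := fun t x => L (v t x - u t x))
      (ωt := fun t x => L (deriv (fun s => v s x) t - deriv (fun s => u s x) t))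
      (D := fun t x => L.comp (fderiv ℝ (v t) x - fderiv ℝ (u t) x))
      (H := fun t x => (ContinuousLinearMap.compL ℝ (Space d) (Space d) ℝ L).comp
        (fderiv ℝ (fderiv ℝ (v t)) x - fderiv ℝ (fderiv ℝ (u t)) x))
      ?_ ?_ ?_ ?_ ?_ ?_ hB ?_ ht x
    · exact L.continuous.comp_continuousOn (hv.isCb01.continuousOn.sub hu.isCb01.continuousOn)
    · intro t ht x
      refine (le_abs_self _).trans ((L.le_opNorm _).trans ?_)
      gcongr
      exact (norm_sub_le _ _).trans (add_le_add (h2 t ht x) (h1 t ht x))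
    · intro x
      simp [hv.terminal x, hu.terminal x]
    · exact fun t ht x => L.hasFDerivAt.comp_hasDerivAt t ((hdt hv t ht x).sub (hdt hu t ht x))
    · exact fun t ht x => L.hasFDerivAt.comp x ((hdx hv t ht x).sub (hdx hu t ht x))
    · exact fun t ht x => (ContinuousLinearMap.compL ℝ (Space d) (Space d) ℝ L).hasFDerivAt.comp x
        ((hdxx hv t ht x).sub (hdxx hu t ht x))
    · intro t ht x
      have e1 := hu.equation t ht x
      have e2 := hv.equation t ht x
      rw [laplacian_eq_tr (hdx hu t ht) (hdxx hu t ht x)] at e1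
      rw [laplacian_eq_tr (hdx hv t ht) (hdxx hv t ht x)] at e2
      have e3 : ∀ A A' : Space d →L[ℝ] Space d →L[ℝ] Space d, tr (A - A') = tr A - tr A' :=
        fun A A' => by simp [tr]
      rw [tr_compL, e3]
      have e4 := congrArg L (e2.trans e1.symm)
      simp only [map_add, map_smul, smul_eq_mul] at e4
      simp only [map_sub, ContinuousLinearMap.comp_apply, _root_.sub_apply]
      linarith
  have hzero : ∀ t ∈ Ioc 0 T, ∀ x, v t x = u t x := by
    intro t ht x
    have h3 := key (innerSL ℝ (v t x - u t x)) t ht x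
    rw [innerSL_apply_apply, real_inner_self_eq_norm_sq] at h3
    have h4 : ‖v t x - u t x‖ = 0 := pow_eq_zero_iff two_ne_zero |>.1
      (le_antisymm h3 (by positivity))
    exact sub_eq_zero.1 (norm_eq_zero.1 h4)
  rcases eq_or_lt_of_le ht.1 with rfl | h0
  · have hcv : ContinuousOn (fun t => v t x - u t x) (Icc 0 T) :=
      (hv.isCb01.continuousOn.sub hu.isCb01.continuousOn).comp (f := fun t => (t, x))
        (by fun_prop) fun t ht => ⟨ht, mem_univ _⟩
    have h5 : Tendsto (fun t => v t x - u t x) (𝓝[>] 0) (𝓝 (v 0 x - u 0 x)) :=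
      ((hcv 0 ⟨le_rfl, hT0.le⟩).mono_left
        (by rw [← nhdsWithin_Ioc_eq_nhdsGT hT0]; exact nhdsWithin_mono _ Ioc_subset_Icc_self))
    have h6 : Tendsto (fun t => v t x - u t x) (𝓝[>] 0) (𝓝 0) := by
      refine tendsto_const_nhds.congr' ?_
      filter_upwards [Ioc_mem_nhdsGT hT0] with s hs
      rw [hzero s hs x, sub_self]
    exact sub_eq_zero.1 (tendsto_nhds_unique h5 h6)
  · exact hzero t ⟨h0, ht.2⟩ x

end KatoPDE
end


/-! ### The time horizon and the assembly of the theorem. -/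

open Set Filter Topology MeasureTheory
open scoped ENNReal NNReal BoundedContinuousFunction

noncomputable section

namespace KatoPDE

variable {d : ℕ}

lemma CE_pos : 0 < CE := by
  rw [← NNReal.coe_pos]; exact Real.exp_pos 4

lemma uncurry_zeroExt_eq_zero (b : ℝ → Space d → Space d) {p : ℝ × Space d} (hp : p.1 ≤ 0) :
    Function.uncurry (zeroExt b) p = 0 := by
  simp [Function.uncurry, zeroExt, not_lt.2 hp]

lemma trunc_eq_zero {h : ℝ × Space d → Space d} {p : ℝ × Space d} (hp : p.1 ∉ Ioc (0 : ℝ) 1) :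
    trunc h p = 0 := indicator_of_notMem (fun h => hp h.1) _

section

variable {b : ℝ → Space d → Space d} {φ : ℝ × Space d → ℝ}

/-- The mollification of `b` restricted to times in `(0, 1]`. -/
def mollTrunc (φ : ℝ × Space d → ℝ) (n : ℕ) (b : ℝ → Space d → Space d) :
    ℝ × Space d → Space d :=
  moll (scaled φ n) (trunc (Function.uncurry (zeroExt b)))

lemma mollify_eq (hφ : IsMollifier φ) (n : ℕ) {t : ℝ} (ht : t ≤ 1) (x : Space d) :
    mollify φ n b t x = mollTrunc φ n b (t, x) :=
  (moll_trunc (hφ.scaled n) (fun _ hp => uncurry_zeroExt_eq_zero b hp) (X := (t, x)) ht).symm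

lemma half_pow_le_one (n : ℕ) : ((1 : ℝ) / 2) ^ n ≤ 1 := pow_le_one₀ (by norm_num) (by norm_num)

lemma IsKato.unifLoc (hb : StronglyMeasurable (Function.uncurry (zeroExt b)))
    (hk : IsKato 1 (fun t x => ‖b t x‖)) :
    ∃ M, UnifLoc (trunc (Function.uncurry (zeroExt b))) M := by
  obtain ⟨M, hM, h⟩ := hk.uli hb
  exact ⟨_, unifLoc_trunc hb hM h⟩

lemma IsKato.smoothBdd (hb : StronglyMeasurable (Function.uncurry (zeroExt b)))
    (hk : IsKato 1 (fun t x => ‖b t x‖)) (hφ : IsMollifier φ) (n : ℕ) :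
    SmoothBdd (mollTrunc φ n b) := by
  obtain ⟨M, h⟩ := hk.unifLoc hb
  exact ⟨h.contDiff_moll (hφ.scaled n), h.moll_bounded (hφ.scaled n) (half_pow_le_one n),
    h.fderiv_moll_bounded (hφ.scaled n) (half_pow_le_one n)⟩

lemma kN_mollTrunc_le (hb : StronglyMeasurable (Function.uncurry (zeroExt b)))
    (hφ : IsMollifier φ) (n : ℕ) (S : ℝ) :
    kN (mollTrunc φ n b) S ≤ kN (Function.uncurry (zeroExt b)) S :=
  (kN_moll_le (hφ.scaled n).contDiff.continuous.measurable (hφ.scaled n).lint.le (trunc_sm hb)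
    (fun _ hp => trunc_eq_zero fun h => absurd h.1 (not_lt.2 hp)) S).trans (kN_trunc_le hb S)

lemma IsKato.tendsto_mollTrunc (hb : StronglyMeasurable (Function.uncurry (zeroExt b)))
    (hk : IsKato 1 (fun t x => ‖b t x‖)) (hφ : IsMollifier φ) {T : ℝ} (hT : T ≤ 1) (R : ℝ) :
    Tendsto (fun n => ∫⁻ p in Ioc 0 T ×ˢ univ,
      (if ‖p.2‖ ≤ R then ‖mollTrunc φ n b p - Function.uncurry (zeroExt b) p‖ₑ else 0))
      atTop (𝓝 0) := by
  obtain ⟨M, h⟩ := hk.unifLoc hb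
  have hms := measurableSet_near (0 : Space d) R
  simp only [zero_sub, norm_neg] at hms
  refine tendsto_of_tendsto_of_tendsto_of_le_of_le tendsto_const_nhds
    (h.tendsto_moll (fun p hp => trunc_eq_zero hp) (ψ := scaled φ) hφ.scaled R)
    (fun _ => zero_le) fun n => ?_
  rw [← lintegral_indicator hms, ← lintegral_indicator (measurableSet_strip measurableSet_Ioc)]
  refine lintegral_mono fun p => ?_
  by_cases hp : p ∈ Ioc 0 T ×ˢ (univ : Set (Space d))
  · rw [indicator_of_mem hp]
    split_ifs with hR
    · rw [indicator_of_mem (s := {p : ℝ × Space d | ‖p.2‖ ≤ R}) hR,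
        trunc_of_mem ⟨hp.1.1, hp.1.2.trans hT⟩]
      rfl
    · exact zero_le
  · rw [indicator_of_notMem hp]
    exact zero_le

end

/-- Admissible time horizons for given Kato functionals. -/
def Admissible (Nb Nf : ℝ → ℝ≥0∞) (t : ℝ) : Prop :=
  0 < t ∧ t ≤ 1 ∧ CE * Nb t ≤ 1 / 4 ∧ CE * Nf t ≤ 1 / 4

open Classical in
/-- A time horizon determined by the Kato functionals of the coefficients. -/
def horizon (Nb Nf : ℝ → ℝ≥0∞) : ℝ :=
  -- The value 1 only makes the function total; for coefficients in the Kato class an admissible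
  -- time exists.
  if h : ∃ t, Admissible Nb Nf t then h.choose else 1

lemma admissible_horizon {Nb Nf : ℝ → ℝ≥0∞} (hb : Tendsto Nb (𝓝[>] 0) (𝓝 0))
    (hf : Tendsto Nf (𝓝[>] 0) (𝓝 0)) : Admissible Nb Nf (horizon Nb Nf) := by
  have key : ∀ {N : ℝ → ℝ≥0∞}, Tendsto N (𝓝[>] 0) (𝓝 0) →
      ∀ᶠ t in 𝓝[>] 0, CE * N t ≤ 1 / 4 := fun {N} h => by
    have h1 : Tendsto (fun t => CE * N t) (𝓝[>] 0) (𝓝 (CE * 0)) :=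
      ENNReal.Tendsto.const_mul h (Or.inr ENNReal.coe_ne_top)
    rw [mul_zero] at h1
    exact h1.eventually_le_const (by rw [ennreal_quarter]; positivity)
  have h : ∃ t, Admissible Nb Nf t := by
    have h1 : ∀ᶠ t : ℝ in 𝓝[>] 0, t ∈ Ioc (0 : ℝ) 1 := Ioc_mem_nhdsGT one_pos
    obtain ⟨t, ht, h2, h3⟩ := (h1.and ((key hb).and (key hf))).exists
    exact ⟨t, ht.1, ht.2, h2, h3⟩
  rw [horizon, dif_pos h]
  exact h.choose_spec

lemma ne_top_of_CE_mul_le {a : ℝ≥0∞} (h : CE * a ≤ 1 / 4) : a ≠ ⊤ := by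
  rintro rfl
  rw [ENNReal.mul_top (by exact_mod_cast CE_pos.ne')] at h
  exact absurd h (by rw [ennreal_quarter]; simp)

end KatoPDE

end

theorem proposition4p3 (d : ℕ) (hd : 2 ≤ d) :
    ∃ (M₃ : ℝ≥0∞ → ℝ≥0) (T : (ℝ → ℝ≥0∞) → (ℝ → ℝ≥0∞) → ℝ),
      (∀ z, 0 < M₃ z) ∧
      ∀ b f : ℝ → KatoPDE.Space d → KatoPDE.Space d,
        Measurable (Function.uncurry (KatoPDE.zeroExt b)) →
        Measurable (Function.uncurry (KatoPDE.zeroExt f)) →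
        KatoPDE.IsKato 1 (fun t x => ‖b t x‖) →
        KatoPDE.IsKato 1 (fun t x => ‖f t x‖) →
        ∀ T₀ : ℝ, T₀ = T (KatoPDE.katoN 1 b) (KatoPDE.katoN 1 f) →
          0 < T₀ ∧
          ∃ u : ℝ → KatoPDE.Space d → KatoPDE.Space d,
            -- (i) existence and uniqueness of the mild solution
            KatoPDE.IsMildSolution b f T₀ u ∧
            (∀ v, KatoPDE.IsMildSolution b f T₀ v → ∀ t ∈ Icc 0 T₀, ∀ x, v t x = u t x) ∧
            -- (ii) the classical solutions of the mollified equations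
            (∀ φ : ℝ × KatoPDE.Space d → ℝ, KatoPDE.IsMollifier φ →
              ∃ un : ℕ → ℝ → KatoPDE.Space d → KatoPDE.Space d,
                (∀ n, 1 ≤ n →
                  KatoPDE.IsClassicalSolution
                    (KatoPDE.mollify φ n b) (KatoPDE.mollify φ n f) T₀ (un n) ∧
                  (∀ v, KatoPDE.IsClassicalSolution
                      (KatoPDE.mollify φ n b) (KatoPDE.mollify φ n f) T₀ v →
                    ∀ t ∈ Icc 0 T₀, ∀ x, v t x = un n t x)) ∧
                (⨆ n ∈ Ici 1, KatoPDE.c01Norm T₀ univ (un n)) ⊔ KatoPDE.c01Norm T₀ univ u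
                  ≤ M₃ (KatoPDE.katoN 1 b T₀) * KatoPDE.katoN 1 f T₀ ∧
                ∀ R : ℝ, 0 < R →
                  Tendsto (fun n => KatoPDE.c01Norm T₀ (Metric.ball 0 R)
                    (fun t x => un n t x - u t x)) atTop (𝓝 0)) ∧
            -- (iii) the Lipschitz bound
            (∀ t ∈ Icc 0 T₀, ∀ x y : KatoPDE.Space d,
              ‖u t y - u t x‖ ≤ 1 / 2 * ‖x - y‖) := by
  -- M₃ is the absolute constant 4e⁴: the dependence on b is used up by requiring e⁴ N_b(T) ≤ 1/4.
  refine ⟨fun _ => 4 * KatoPDE.CE, KatoPDE.horizon,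
    fun _ => mul_pos (by norm_num) KatoPDE.CE_pos, ?_⟩
  intro b f hbm hfm hb hf T hT
  have sb := hbm.stronglyMeasurable
  have sf := hfm.stronglyMeasurable
  rw [KatoPDE.katoN_eq_kN sb, KatoPDE.katoN_eq_kN sf] at hT
  obtain ⟨hT0, hT1, hb4, hf4⟩ :=
    KatoPDE.admissible_horizon (hb.tendsto_kN sb) (hf.tendsto_kN sf)
  rw [← hT] at hT0 hT1 hb4 hf4
  have gb := hb.good sb hT1 (KatoPDE.ne_top_of_CE_mul_le hb4)
  have gf := hf.good sf hT1 (KatoPDE.ne_top_of_CE_mul_le hf4)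
  obtain ⟨V, hV⟩ := KatoPDE.exists_isFix hT0.le hT1 gb gf hb4
  refine ⟨hT0, _, hV.isMildSolution hT1 gb gf hb4, ?_, ?_,
    fun t ht x y => hV.lipschitz hT1 gb gf hb4 hf4 ht x y⟩
  · intro v hv t ht x
    obtain ⟨V', hV', hv'⟩ := hv.exists_isFix hT0.le hT1 gb gf
    rw [hv' t ht x, hV'.unique hT1 gb gf hb4 hV]
  · intro φ hφ
    have hbn := fun n => hb.smoothBdd sb hφ n
    have hfn := fun n => hf.smoothBdd sf hφ n
    -- Mollification does not increase the Kato functional, so the horizon chosen for b serves every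
    -- n.
    have hbn4 : ∀ n, KatoPDE.CE * KatoPDE.kN (KatoPDE.mollTrunc φ n b) T ≤ 1 / 4 := fun n =>
      le_trans (by gcongr; exact KatoPDE.kN_mollTrunc_le sb hφ n T) hb4
    choose Vn hVn hcl using fun n =>
      KatoPDE.exists_isFix_isClassicalSolution hT0 hT1 (hbn n) (hfn n) (hbn4 n)
    have hmoll : ∀ (h : ℝ → KatoPDE.Space d → KatoPDE.Space d) (n : ℕ), ∀ t ∈ Ioo 0 T, ∀ x,
        KatoPDE.mollify φ n h t x = KatoPDE.mollTrunc φ n h (t, x) := fun h n t ht x =>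
      KatoPDE.mollify_eq hφ n (ht.2.le.trans hT1) x
    have hsol := fun n => hcl n _ _ (hmoll b n) (hmoll f n)
    refine ⟨fun n => KatoPDE.Iop (KatoPDE.kerq (KatoPDE.Space d)) T
      (KatoPDE.src hT0.le (KatoPDE.mollTrunc φ n b) (KatoPDE.mollTrunc φ n f) (Vn n)),
      fun n _ => ⟨hsol n, fun v hv t ht x => ?_⟩, ?_, fun R _ => ?_⟩
    · obtain ⟨B, hB⟩ := (hbn n).bdd
      refine (hsol n).unique (B := B) hT0 (fun t ht x => ?_) hv ht x
      rw [hmoll b n t ht x]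
      have h := hB (t, x)
      rwa [enorm_le_coe, ← NNReal.coe_le_coe] at h
    · rw [KatoPDE.katoN_eq_kN sf]
      refine sup_le (iSup₂_le fun n _ => ?_) (hV.c01Norm_le hT1 gb gf hb4)
      refine ((hVn n).c01Norm_le hT1 ((hbn n).good hT0) ((hfn n).good hT0) (hbn4 n)).trans ?_
      gcongr
      exact KatoPDE.kN_mollTrunc_le sf hφ n T
    · exact KatoPDE.tendsto_c01Norm_sub hT0 hT1 gb gf (fun n => (hbn n).good hT0)
        (fun n => (hfn n).good hT0) hbn4 (fun n S => KatoPDE.kN_mollTrunc_le sb hφ n S)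
        (fun n S => KatoPDE.kN_mollTrunc_le sf hφ n S)
        (fun R => hb.tendsto_mollTrunc sb hφ hT1 R) (fun R => hf.tendsto_mollTrunc sf hφ hT1 R)
        hV hVn R
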